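/- **Setting.** Consider $\min_{x\in\mathcal X}F(x)$, $F(x)=\frac1n\sum_{i=1}^n f_i(g_i(x))+r(x)$, where $\mathcal X\subseteq\mathbb R^d$ is closed and convex, $r:\mathbb R^d\to(-\infty,\infty]$ on $\mathcal X$ is proper, lower semicontinuous and $\mu$-strongly convex ($\mu>0$), and $g_i(x)=\mathbb E_{\zeta\sim\mathbb P_i}[g_i(x;\zeta)]\in\mathbb R^m$. Let $\|\cdot\|_*$ be a norm on $\mathbb R^m$, $\|\cdot\|$ its dual norm. Assume for every $i$: * each coordinate of $g_i$ is convex on $\mathcal X$, $\|g_i(x)-g_i(x')\|_*\le C_g\|x-x'\|_2$ on $\mathcal X$; the stochastic (sub)gradient $g_i'(x;\zeta)$ has mean $g_i'(x)\in\partial g_i(x)$ (the gradient, if $g_i$ is affine or smooth) with $\|g_i'(x)(x'-x)\|_*\le C_g\|x'-x\|_2$ for $x,x'\in\mathcal X$; * $f_i:\mathbb R^m\to\mathbb R$ is convex, $C_f$-Lipschitz and $L_f$-smooth with respect to $\|\cdot\|_*$, and it is non-decreasing in each coordinate unless $g_i$ is affine on $\mathcal X$; * for $x\in\mathcal X$,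 $y^{(j)}\in\mathcal Y_j:=\operatorname{dom}f_j^*$: $\ \mathbb E\|g_i(x)-g_i(x;\zeta)\|_*^2\le\sigma_0^2$, $\ \mathbb E\|g_i'(x)-g_i'(x;\zeta)\|_{\rm op}^2\le\sigma_1^2$, $\ \frac1n\sum_j\big\|[g_j'(x)]^\top y^{(j)}-\frac1n\sum_k[g_k'(x)]^\top y^{(k)}\big\|_2^2\le\delta^2$. **Algorithm (ALEXR).** For each $i$ the function $\psi_i$ is either $f_i^*$, or a function that is differentiable on $\mathcal Y_i$, $\mu_\psi$-strongly convex there with respect to $\|\cdot\|$, and satisfies $U_{f_i^*}\ge\rho\,U_{\psi_i}$ on $\mathcal Y_i$ ($\mu_\psi,\rho>0$), where $U_\psi(a,y)=\psi(a)-\psi(y)-\langle\psi'(y),a-y\rangle$ is the Bregman divergence. Start at $x_{-1}=x_0\in\mathcal X$ and $y_0^{(i)}\in\mathcal Y_i$ (with a subgradient $u_0^{(i)}\in\partial f_i^*(y_0^{(i)})$ if $\psi_i=f_i^*$). In iteration $t$ draw $\mathcal S_t\subseteq\{1,\dots,n\}$ uniformly among the subsets of size $S$ and, independently, batches $\mathcal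 B_t^{(i)},\tilde{\mathcal B}_t^{(i)}$ of $B$ i.i.d. samples from $\mathbb P_i$; all draws are independent. With $g_i(x;\mathcal B)$, $g_i'(x;\mathcal B)$ the batch averages, for $i\in\mathcal S_t$ put $\tilde g_t^{(i)}=g_i(x_t;\mathcal B_t^{(i)})+\theta\,(g_i(x_t;\mathcal B_t^{(i)})-g_i(x_{t-1};\mathcal B_t^{(i)}))$ and $$y_{t+1}^{(i)}=\arg\max_{v\in\mathcal Y_i}\{\langle v,\tilde g_t^{(i)}\rangle-f_i^*(v)-\tau U_{\psi_i}(v,y_t^{(i)})\},$$ and $y_{t+1}^{(i)}=y_t^{(i)}$ for $i\notin\mathcal S_t$; if $\psi_i=f_i^*$, the subgradient used in $U_{\psi_i}(\cdot,y_t^{(i)})$ is $u_t^{(i)}$, where $u_{t+1}^{(i)}=(\tau u_t^{(i)}+\tilde g_t^{(i)})/(1+\tau)$ for $i\in\mathcal S_t$ and $u_{t+1}^{(i)}=u_t^{(i)}$ otherwise. Then $$x_{t+1}=\arg\min_{x\in\mathcal X}\Big\{\langle G_t,x\rangle+r(x)+\tfrac\eta2\|x-x_t\|_2^2\Big\},\qquad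 G_t=\frac1S\sum_{i\in\mathcal S_t}[g_i'(x_t;\tilde{\mathcal B}_t^{(i)})]^\top y_{t+1}^{(i)}.$$ Let $x_*$ be the minimizer of $F$ over $\mathcal X$, $y_*^{(i)}=\nabla f_i(g_i(x_*))$, and $\Delta_0=\frac\mu2\|x_0-x_*\|_2^2+\frac1n\sum_i U_{\psi_i}(y_*^{(i)},y_0^{(i)})$. **Theorem.** (i) There are $c\in(0,1)$ and $K>0$, depending only on $(\mathbb R^m,\|\cdot\|_*)$, $C_f,L_f,C_g,L_g,\mu_\psi,\rho,\sigma_0,\sigma_1,\delta$ (and so not on $d,n,S,B,\mu,\varepsilon$ or the rest of the problem), such that the following holds. Let every $g_i$ be $L_g$-smooth on $\mathcal X$, that is, differentiable with $\|g_i(x')-g_i(x)-\nabla g_i(x)(x'-x)\|_*\le\frac{L_g}2\|x'-x\|_2^2$. Let $1\le S\le n$, $B\ge1$, $0<\varepsilon\le 1/B$, $M=\max\{\frac1{\mu S},\frac1{\mu B},\frac n{BS}\}$. Then ALEXR with $$\theta=1-\frac{c\,\varepsilon}{M},\qquad \eta=\frac{\mu\theta}{1-\theta},\qquad \tau=\frac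 S{n(1-\theta)}$$ satisfies $\frac\mu2\,\mathbb E\|x_T-x_*\|_2^2\le\varepsilon$ for every $T\ge K\,\frac M\varepsilon\,\log\!\big(2+\frac{\Delta_0}\varepsilon\big)$; that is, $\tilde O(\max\{\frac1{\mu S},\frac1{\mu B},\frac n{BS}\}\varepsilon^{-1})$ iterations suffice. (ii) The same holds without any smoothness of the $g_i$, with $M=\max\{\frac1\mu,\frac n{BS}\}$ and constants $c,K$ that depend only on the quantities listed in (i) other than $L_g$; that is, $\tilde O(\max\{\frac1\mu,\frac n{BS}\}\varepsilon^{-1})$ iterations suffice. -/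

import Mathlib

open MeasureTheory ProbabilityTheory

universe u w v

noncomputable section

namespace CFCCO

/-- The primal space `ℝ^d` with the Euclidean norm. -/
abbrev Primal (d : ℕ) : Type := EuclideanSpace ℝ (Fin d)

section Outer

/- `V` is `ℝ^m` with the norm `‖·‖_*` (the space in which the inner functions take their values), and
`StrongDual ℝ V` is the space of the dual blocks `y^{(i)}`, with the norm `‖·‖`. -/
variable {V : Type u} [NormedAddCommGroup V] [NormedSpace ℝ V]

/-- The effective domain of the convex conjugate of `f`; it is the dual domain `𝒴_i` for `f = f_i`. -/
def conjDom (f : V → ℝ) : Set (StrongDual ℝ V) :=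
  {y | BddAbove (Set.range fun z : V => y z - f z)}

/-- The convex conjugate `f^*`, to be used on `conjDom f`. -/
def conj (f : V → ℝ) (y : StrongDual ℝ V) : ℝ := ⨆ z : V, (y z - f z)

/-- `z` is a subgradient of `f^*` at `y`. -/
def IsConjSubgrad (f : V → ℝ) (y : StrongDual ℝ V) (z : V) : Prop :=
  ∀ y' ∈ conjDom f, conj f y + (y' - y) z ≤ conj f y'

/-- `z` is the gradient of `ψ` at `y`. -/
def IsGrad (ψ : StrongDual ℝ V → ℝ) (y : StrongDual ℝ V) (z : V) : Prop :=
  HasFDerivAt ψ (NormedSpace.inclusionInDoubleDual ℝ V z) y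

/-- The Bregman divergence `U_ψ(a, y) = ψ(a) - ψ(y) - ⟨z, a - y⟩` formed with the (sub)gradient `z`
of `ψ` at `y`. -/
def bregman (ψ : StrongDual ℝ V → ℝ) (a y : StrongDual ℝ V) (z : V) : ℝ :=
  ψ a - ψ y - (a - y) z

/-- `f` is convex, `C_f`-Lipschitz and `L_f`-smooth with respect to `‖·‖_*`. -/
structure OuterFunction (Cf Lf : ℝ) (f : V → ℝ) : Prop where
  convex : ConvexOn ℝ Set.univ f
  lipschitz : ∀ z z', |f z - f z'| ≤ Cf * ‖z - z'‖
  differentiable : Differentiable ℝ f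
  smooth : ∀ z₁ z₂, |f z₁ - f z₂ - fderiv ℝ f z₂ (z₁ - z₂)| ≤ Lf / 2 * ‖z₁ - z₂‖ ^ 2

/-- `f` is non-decreasing in every coordinate. -/
def CoordMonotone {m : ℕ} (b : Module.Basis (Fin m) ℝ V) (f : V → ℝ) : Prop :=
  ∀ z z', (∀ j, b.repr z j ≤ b.repr z' j) → f z ≤ f z'

variable (V) in
/-- The choice of a distance-generating function for a dual block: the conjugate `f_i^*` of the outer
function, or a given differentiable function `ψ_i`. -/
inductive DGF : Type u
  | conjugate : DGF
  | smooth (ψ : StrongDual ℝ V → ℝ) : DGF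

/-- The distance-generating function `ψ_i` itself. -/
def DGF.val (f : V → ℝ) : DGF V → StrongDual ℝ V → ℝ
  | .conjugate => conj f
  | .smooth ψ => ψ

/-- Requirements on the distance-generating function. None for `ψ_i = f_i^*`; otherwise `ψ_i` is
differentiable on `𝒴_i`, `μψ`-strongly convex there with respect to `‖·‖`, and
`U_{f_i^*} ≥ ρ U_{ψ_i}` on `𝒴_i`. -/
def DGF.Admissible (f : V → ℝ) (μψ ρ : ℝ) : DGF V → Prop
  | .conjugate => True
  | .smooth ψ => (∀ y ∈ conjDom f, DifferentiableAt ℝ ψ y) ∧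
      ∀ y ∈ conjDom f, ∀ z, IsGrad ψ y z → ∀ a ∈ conjDom f,
        μψ / 2 * ‖a - y‖ ^ 2 ≤ bregman ψ a y z ∧
        ∀ z', IsConjSubgrad f y z' → ρ * bregman ψ a y z ≤ bregman (conj f) a y z'

/-- `z` is a (sub)gradient of the distance-generating function at `y`. -/
def DGF.IsSubgrad (f : V → ℝ) (y : StrongDual ℝ V) (z : V) : DGF V → Prop
  | .conjugate => IsConjSubgrad f y z
  | .smooth ψ => IsGrad ψ y z

/-- The (sub)gradient `z'` of the distance-generating function at the new dual block `y'`. For a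
differentiable `ψ_i` it is the gradient; for `ψ_i = f_i^*`, whose subgradient need not be unique, it
is `z' = (τ z + g̃) / (1 + τ)`, with `z` the previous subgradient. -/
def DGF.NextSubgrad (τ : ℝ) (gt z : V) (y' : StrongDual ℝ V) (z' : V) : DGF V → Prop
  | .conjugate => z' = (1 / (1 + τ)) • (τ • z + gt)
  | .smooth ψ => IsGrad ψ y' z'

end Outer

/-- The data of `min_{x ∈ 𝒳} (1/n) ∑ f_i(g_i(x)) + r(x)` with `g_i(x) = 𝔼_{ζ ∼ P_i} g_i(x; ζ)`:
`g i x ζ` is the value oracle and `Dg i x ζ` the (sub)gradient oracle of the inner function. -/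
structure Problem (V : Type u) [NormedAddCommGroup V] [NormedSpace ℝ V] (d n : ℕ)
    (Z : Fin n → Type w) [∀ i, MeasurableSpace (Z i)] where
  X : Set (Primal d)
  r : Primal d → EReal
  f : Fin n → V → ℝ
  P : ∀ i, Measure (Z i)
  g : ∀ i, Primal d → Z i → V
  Dg : ∀ i, Primal d → Z i → Primal d →L[ℝ] V

section Problem

variable {V : Type u} [NormedAddCommGroup V] [NormedSpace ℝ V] {d n : ℕ}
  {Z : Fin n → Type w} [∀ i, MeasurableSpace (Z i)]

/-- The inner function `g_i(x) = 𝔼 g_i(x; ζ)`. -/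
def Problem.inner (p : Problem V d n Z) (i : Fin n) (x : Primal d) : V := ∫ s, p.g i x s ∂(p.P i)

/-- The mean `g_i'(x)` of the (sub)gradient oracle. -/
def Problem.innerD (p : Problem V d n Z) (i : Fin n) (x : Primal d) : Primal d →L[ℝ] V :=
  ∫ s, p.Dg i x s ∂(p.P i)

/-- The objective `F`. -/
def Problem.F (p : Problem V d n Z) (x : Primal d) : EReal :=
  (((1 / n : ℝ) * ∑ i, p.f i (p.inner i x) : ℝ) : EReal) + p.r x

/-- `x` minimizes `F` over `𝒳`. -/
def Problem.IsMinimizer (p : Problem V d n Z) (x : Primal d) : Prop :=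
  x ∈ p.X ∧ IsMinOn p.F p.X x

/-- The standing assumptions, with a `μ`-strongly convex regularizer and `L_f`-smooth outer
functions. -/
structure Problem.Assumptions {m : ℕ} (p : Problem V d n Z) (b : Module.Basis (Fin m) ℝ V)
    (μ Cf Lf Cg σ₀ σ₁ δ : ℝ) : Prop where
  prob : ∀ i, IsProbabilityMeasure (p.P i)
  -- the domain and the regularizer
  closed : IsClosed p.X
  convex : Convex ℝ p.X
  r_ne_bot : ∀ x ∈ p.X, p.r x ≠ ⊥
  r_proper : ∃ x ∈ p.X, p.r x ≠ ⊤
  r_lsc : LowerSemicontinuousOn p.r p.X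
  r_strong : ∀ x ∈ p.X, ∀ x' ∈ p.X, ∀ s t : ℝ, 0 < s → 0 < t → s + t = 1 →
    p.r (s • x + t • x') + ((μ / 2 * (s * t) * ‖x - x'‖ ^ 2 : ℝ) : EReal) ≤
      (s : EReal) * p.r x + (t : EReal) * p.r x'
  -- the oracles of the inner functions are measurable and integrable
  g_meas : ∀ i, StronglyMeasurable (Function.uncurry (p.g i))
  Dg_meas : ∀ i, StronglyMeasurable (Function.uncurry (p.Dg i))
  g_int : ∀ i, ∀ x ∈ p.X, Integrable (p.g i x) (p.P i)
  Dg_int : ∀ i, ∀ x ∈ p.X, Integrable (p.Dg i x) (p.P i)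
  -- the inner functions are convex (in each coordinate) and Lipschitz, and `g_i'(x) ∈ ∂ g_i(x)` has
  -- norm at most `C_g` along feasible directions
  g_convex : ∀ i j, ConvexOn ℝ p.X fun x => b.repr (p.inner i x) j
  g_lipschitz : ∀ i, ∀ x ∈ p.X, ∀ x' ∈ p.X, ‖p.inner i x - p.inner i x'‖ ≤ Cg * ‖x - x'‖
  Dg_subgrad : ∀ i, ∀ x ∈ p.X, ∀ x' ∈ p.X, ∀ j,
    b.repr (p.inner i x) j + b.repr (p.innerD i x (x' - x)) j ≤ b.repr (p.inner i x') j
  Dg_bound : ∀ i, ∀ x ∈ p.X, ∀ x' ∈ p.X, ‖p.innerD i x (x' - x)‖ ≤ Cg * ‖x' - x‖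
  -- the outer functions; monotonicity is needed only where the inner function is not affine
  outer : ∀ i, OuterFunction Cf Lf (p.f i)
  outer_mono : ∀ i, CoordMonotone b (p.f i) ∨
    ∀ x ∈ p.X, ∀ x' ∈ p.X, p.inner i x' = p.inner i x + p.innerD i x (x' - x)
  -- variances
  var_g : ∀ i, ∀ x ∈ p.X, Integrable (fun s => ‖p.inner i x - p.g i x s‖ ^ 2) (p.P i) ∧
    ∫ s, ‖p.inner i x - p.g i x s‖ ^ 2 ∂(p.P i) ≤ σ₀ ^ 2
  var_Dg : ∀ i, ∀ x ∈ p.X, Integrable (fun s => ‖p.innerD i x - p.Dg i x s‖ ^ 2) (p.P i) ∧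
    ∫ s, ‖p.innerD i x - p.Dg i x s‖ ^ 2 ∂(p.P i) ≤ σ₁ ^ 2
  var_comp : ∀ x ∈ p.X, ∀ y : Fin n → StrongDual ℝ V, (∀ i, y i ∈ conjDom (p.f i)) →
    (1 / n : ℝ) * ∑ j, ‖(y j).comp (p.innerD j x)
      - (1 / n : ℝ) • ∑ i, (y i).comp (p.innerD i x)‖ ^ 2 ≤ δ ^ 2

/-- The inner functions are `L_g`-smooth on `𝒳`, with gradient the mean of the gradient oracle. -/
def Problem.InnerSmooth (p : Problem V d n Z) (Lg : ℝ) : Prop :=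
  ∀ i, ∀ x ∈ p.X, HasFDerivWithinAt (p.inner i) (p.innerD i x) p.X x ∧
    ∀ x' ∈ p.X, ‖p.inner i x' - p.inner i x - p.innerD i x (x' - x)‖ ≤ Lg / 2 * ‖x' - x‖ ^ 2

/-- The randomness of one iteration: the outer batch `𝒮_t`, and the inner batches `ℬ_t^{(i)}` and
`ℬ̃_t^{(i)}` for each `i` (only those with `i ∈ 𝒮_t` are used by the algorithm). -/
abbrev Draw (n B : ℕ) (Z : Fin n → Type w) : Type w :=
  Finset (Fin n) × (∀ i, Fin B → Z i) × (∀ i, Fin B → Z i)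

/-- The law of one iteration's randomness: `𝒮_t` is uniform among the subsets of size `S`, the inner
batches are i.i.d. samples from `P_i`, and all of them are independent. -/
def Problem.drawLaw (p : Problem V d n Z) (S B : ℕ) : Measure (Draw n B Z) :=
  (uniformOn {A : Finset (Fin n) | A.card = S}).prod
    ((Measure.pi fun i => Measure.pi fun _ : Fin B => p.P i).prod
      (Measure.pi fun i => Measure.pi fun _ : Fin B => p.P i))

/-- The draws of the iterations are i.i.d. with the law `drawLaw`. -/
structure Problem.IsSampling {Ω : Type v} [MeasurableSpace Ω] (p : Problem V d n Z) (S B : ℕ)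
    (Pr : Measure Ω) (ξ : ℕ → Ω → Draw n B Z) : Prop where
  law : ∀ t, HasLaw (ξ t) (p.drawLaw S B) Pr
  indep : iIndepFun ξ Pr

/-- The mini-batch value `g_i(x; ℬ)`. -/
def Problem.batch {B : ℕ} (p : Problem V d n Z) (i : Fin n) (x : Primal d) (s : Fin B → Z i) : V :=
  (1 / B : ℝ) • ∑ k, p.g i x (s k)

/-- The mini-batch (sub)gradient `g_i'(x; ℬ)`. -/
def Problem.batchD {B : ℕ} (p : Problem V d n Z) (i : Fin n) (x : Primal d) (s : Fin B → Z i) :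
    Primal d →L[ℝ] V :=
  (1 / B : ℝ) • ∑ k, p.Dg i x (s k)

/-- The extrapolated estimator
`g̃^{(i)} = g_i(x; ℬ) + θ (g_i(x; ℬ) - g_i(x⁻; ℬ))`, with `x⁻` the previous iterate. -/
def Problem.extrap {B : ℕ} (p : Problem V d n Z) (θ : ℝ) (i : Fin n) (xprev x : Primal d)
    (s : Fin B → Z i) : V :=
  p.batch i x s + θ • (p.batch i x s - p.batch i xprev s)

/-- The stochastic gradient `G = (1/S) ∑_{i ∈ 𝒮} [g_i'(x; ℬ̃^{(i)})]ᵀ y^{(i)}`, as a functional. -/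
def Problem.gradEst {B : ℕ} (p : Problem V d n Z) (S : ℕ) (x : Primal d)
    (y : Fin n → StrongDual ℝ V) (ζ : Draw n B Z) : StrongDual ℝ (Primal d) :=
  (1 / S : ℝ) • ∑ i ∈ ζ.1, (y i).comp (p.batchD i x (ζ.2.2 i))

/-- `X`, `Y` are the iterates of ALEXR driven by the draws `ξ`, started at `x₀`, `y₀`;
`Q t ω i` is the (sub)gradient of `ψ_i` at `Y t ω i` in the Bregman divergence. For `t = 0`,
`X (t - 1)` is `X 0`, which is the convention `x_{-1} = x_0`. -/
structure Problem.IsALEXR {Ω : Type v} (p : Problem V d n Z) (ψ : Fin n → DGF V) (S B : ℕ)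
    (θ η τ : ℝ) (x₀ : Primal d) (y₀ : Fin n → StrongDual ℝ V) (q₀ : Fin n → V)
    (ξ : ℕ → Ω → Draw n B Z) (X : ℕ → Ω → Primal d) (Y : ℕ → Ω → Fin n → StrongDual ℝ V)
    (Q : ℕ → Ω → Fin n → V) : Prop where
  x_init : x₀ ∈ p.X ∧ ∀ ω, X 0 ω = x₀
  y_init : (∀ i, y₀ i ∈ conjDom (p.f i)) ∧ ∀ ω, Y 0 ω = y₀
  q_init : (∀ i, (ψ i).IsSubgrad (p.f i) (y₀ i) (q₀ i)) ∧ ∀ ω, Q 0 ω = q₀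
  dual : ∀ t ω, ∀ i ∈ (ξ t ω).1,
    Y (t + 1) ω i ∈ conjDom (p.f i) ∧
    IsMaxOn (fun a => a (p.extrap θ i (X (t - 1) ω) (X t ω) ((ξ t ω).2.1 i)) - conj (p.f i) a
      - τ * bregman ((ψ i).val (p.f i)) a (Y t ω i) (Q t ω i))
      (conjDom (p.f i)) (Y (t + 1) ω i) ∧
    (ψ i).NextSubgrad τ (p.extrap θ i (X (t - 1) ω) (X t ω) ((ξ t ω).2.1 i)) (Q t ω i)
      (Y (t + 1) ω i) (Q (t + 1) ω i)
  dual_idle : ∀ t ω, ∀ i ∉ (ξ t ω).1, Y (t + 1) ω i = Y t ω i ∧ Q (t + 1) ω i = Q t ω i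
  primal : ∀ t ω, X (t + 1) ω ∈ p.X ∧
    IsMinOn (fun x => ((p.gradEst S (X t ω) (Y (t + 1) ω) (ξ t ω) x
      + η / 2 * ‖x - X t ω‖ ^ 2 : ℝ) : EReal) + p.r x) p.X (X (t + 1) ω)

/-- The initial error `(μ/2) ‖x_0 - x_*‖² + (1/n) ∑ U_{ψ_i}(y_*^{(i)}, y_0^{(i)})`, where
`y_*^{(i)} = ∇ f_i(g_i(x_*))`. -/
def Problem.initGap (p : Problem V d n Z) (ψ : Fin n → DGF V) (μ : ℝ) (x₀ : Primal d)
    (y₀ : Fin n → StrongDual ℝ V) (q₀ : Fin n → V) (xs : Primal d) : ℝ :=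
  μ / 2 * ‖x₀ - xs‖ ^ 2 + (1 / n : ℝ) *
    ∑ i, bregman ((ψ i).val (p.f i)) (fderiv ℝ (p.f i) (p.inner i xs)) (y₀ i) (q₀ i)

/-- ALEXR with parameters `θ, η, τ` and batch sizes `S, B` satisfies
`(μ/2) 𝔼 ‖x_T - x_*‖² ≤ ε` for all `T ≥ N log (2 + Δ / ε)`, with `Δ` the initial error. -/
def Problem.ReachesAccuracy (p : Problem V d n Z) (ψ : Fin n → DGF V) (S B : ℕ)
    (μ θ η τ ε N : ℝ) : Prop :=
  ∀ (Ω : Type v) [MeasurableSpace Ω] (Pr : Measure Ω) [IsProbabilityMeasure Pr]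
    (ξ : ℕ → Ω → Draw n B Z) (x₀ : Primal d) (y₀ : Fin n → StrongDual ℝ V) (q₀ : Fin n → V)
    (X : ℕ → Ω → Primal d) (Y : ℕ → Ω → Fin n → StrongDual ℝ V) (Q : ℕ → Ω → Fin n → V)
    (xs : Primal d),
    p.IsMinimizer xs → p.IsSampling S B Pr ξ → p.IsALEXR ψ S B θ η τ x₀ y₀ q₀ ξ X Y Q →
    ∀ T : ℕ, N * Real.log (2 + p.initGap ψ μ x₀ y₀ q₀ xs / ε) ≤ T →
      Integrable (fun ω => ‖X T ω - xs‖ ^ 2) Pr ∧ μ / 2 * ∫ ω, ‖X T ω - xs‖ ^ 2 ∂Pr ≤ ε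

end Problem

end CFCCO

end

open CFCCO

/-! ALEXR is a stochastic primal-dual method for the saddle function (1/n) ∑ (⟨y_i, g_i(x)⟩ -
f_i^*(y_i)) + r(x). No duality gap is followed. The proof tracks the distance to the pair (x_*,
y_*), with y_*^{(i)} = ∇f_i(g_i(x_*)), and shows that a Lyapunov function contracts up to noise.

Two sources of contraction are used. Smoothness of f_i makes f_i^* strongly convex, so a dual step
turns τ U(y_*, y) into (τ + ρ) U(y_*, y⁺) (`DGF.exists_dual_step`). Strong convexity of r turns η
into η + μ (`primal_three_point`). The two are linked by the optimality of x_*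
(`first_order_optimality`), whose directional term is estimated block by block in
`dual_block_bound`. Half of the dual gain ρ pays for the mismatch between the extrapolated value and
g_i(x_{t+1}), so the extrapolation terms need not telescope. The result is the deterministic
inequality `one_step`.

That inequality concerns a virtual update of all n blocks. The virtual blocks depend only on the
past and on the value batches, hence are independent of the sampled subset and of the gradient
batches, and the linear noise terms have mean zero (`expected_value_noise`, `expected_grad_noise`).
A block is really updated with probability S/n, which replaces the dual weight by n/S times it
(`expected_step`). Since the algorithm is given by optimality relations, measurability and
independence of its states must be derived: the primal and dual steps are realized by measurable
maps and each state is a function of the earlier draws (`state_indep`).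

In `error_bound` the Lyapunov function contracts by 1 - ρ(1-θ)/4 per step, leaving an error 4ν/ρ. Up
to constants, the sampling and oracle parts of ν are 1-θ times n/(BS), 1/(μS) and 1/(μB), all at
most M, so 1-θ = cε/M makes them O(cε). Smoothness of g_i gives a linearization error that the
primal proximal term absorbs. Without it, Young's inequality leaves an extra constant of order 1/η,
that is (1-θ)/μ, and this is why M then contains 1/μ. -/

namespace CFCCO

/-! ### Directional derivatives and a dual norm estimate. -/

/-- A one-sided difference quotient bound passes to the derivative. -/
theorem fderiv_apply_le_of_slope {E : Type*} [NormedAddCommGroup E] [NormedSpace ℝ E] {φ : E → ℝ}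
    {φ' : E →L[ℝ] ℝ} {x v : E} {K : ℝ} (h : HasFDerivAt φ φ' x)
    (hs : ∀ s : ℝ, 0 < s → s ≤ 1 → φ (x + s • v) - φ x ≤ s * K) : φ' v ≤ K := by
  have h1 : HasDerivAt (fun s : ℝ => φ (x + s • v)) (φ' v) 0 := by
    have h2 : HasDerivAt (fun s : ℝ => x + s • v) v 0 := by
      simpa using ((hasDerivAt_id (0 : ℝ)).smul_const v).const_add x
    have h3 : HasFDerivAt φ φ' (x + (0 : ℝ) • v) := by simpa using h
    exact h3.comp_hasDerivAt (0 : ℝ) h2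
  have h4 := hasDerivWithinAt_iff_tendsto_slope.1 (h1.hasDerivWithinAt (s := Set.Ioi 0))
  have h5 : (Set.Ioi (0 : ℝ)) \ {0} = Set.Ioi 0 := by
    ext s; simp only [Set.mem_sdiff, Set.mem_Ioi, Set.mem_singleton_iff]; constructor
    · exact fun h => h.1
    · exact fun h => ⟨h, h.ne'⟩
  rw [h5] at h4
  refine le_of_tendsto h4 ?_
  have : Set.Ioc (0 : ℝ) 1 ∈ nhdsWithin (0 : ℝ) (Set.Ioi 0) := Ioc_mem_nhdsGT one_pos
  filter_upwards [this] with s hs'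
  rw [slope_def_field]
  simp only [zero_smul, add_zero, sub_zero]
  rw [div_le_iff₀ hs'.1, mul_comm]
  exact hs s hs'.1 hs'.2

theorem le_fderiv_apply_of_slope {E : Type*} [NormedAddCommGroup E] [NormedSpace ℝ E] {φ : E → ℝ}
    {φ' : E →L[ℝ] ℝ} {x v : E} {K : ℝ} (h : HasFDerivAt φ φ' x)
    (hs : ∀ s : ℝ, 0 < s → s ≤ 1 → s * K ≤ φ (x + s • v) - φ x) : K ≤ φ' v := by
  have := fderiv_apply_le_of_slope (K := -K) h.neg (v := v) (fun s h0 h1 => by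
    have := hs s h0 h1
    simp only [Pi.neg_apply]; linarith)
  simp only [neg_apply] at this
  linarith

/-- If `ℓ v - L/2 ‖v‖² ≤ K` for all `v`, then `‖ℓ‖² ≤ 2 L K`. -/
theorem norm_sq_le_of_forall_sub_le {E : Type*} [NormedAddCommGroup E] [NormedSpace ℝ E]
    {ℓ : StrongDual ℝ E} {L K : ℝ} (hL : 0 < L) (h : ∀ v, ℓ v - L / 2 * ‖v‖ ^ 2 ≤ K) :
    1 / L / 2 * ‖ℓ‖ ^ 2 ≤ K := by
  have hK : 0 ≤ K := by simpa using h 0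
  have hb : ‖ℓ‖ ≤ Real.sqrt (2 * L * K) := by
    refine ℓ.opNorm_le_bound (Real.sqrt_nonneg _) fun v => ?_
    rcases eq_or_ne v 0 with rfl | hv
    · simp
    have hv' : 0 < ‖v‖ ^ 2 := by positivity
    -- This multiple of v maximizes the concave quadratic t ↦ t ℓ(v) - (L/2) t² ‖v‖².
    have h1 := h ((ℓ v / (L * ‖v‖ ^ 2)) • v)
    have h2 : ℓ ((ℓ v / (L * ‖v‖ ^ 2)) • v) - L / 2 * ‖(ℓ v / (L * ‖v‖ ^ 2)) • v‖ ^ 2 =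
        (ℓ v) ^ 2 / (2 * L * ‖v‖ ^ 2) := by
      rw [map_smul, norm_smul, mul_pow, Real.norm_eq_abs, sq_abs, smul_eq_mul]
      field_simp
      ring
    rw [h2, div_le_iff₀ (by positivity)] at h1
    rw [Real.norm_eq_abs]
    refine abs_le_of_sq_le_sq ?_ (by positivity)
    rw [mul_pow, Real.sq_sqrt (by positivity)]
    linarith
  have h3 : ‖ℓ‖ ^ 2 ≤ 2 * L * K := by
    have := pow_le_pow_left₀ (norm_nonneg _) hb 2
    rwa [Real.sq_sqrt (by positivity)] at this
  have : 1 / L / 2 * ‖ℓ‖ ^ 2 ≤ 1 / L / 2 * (2 * L * K) := by gcongr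
  refine this.trans (le_of_eq ?_)
  field_simp

/-! ### Convex conjugates of the outer functions. -/

section Conj

variable {V : Type*} [NormedAddCommGroup V] [NormedSpace ℝ V] {f : V → ℝ}

theorem le_conj {y : StrongDual ℝ V} (hy : y ∈ conjDom f) (z : V) : y z - f z ≤ conj f y :=
  le_ciSup hy z

theorem mem_conjDom_of_le {y : StrongDual ℝ V} {C : ℝ} (h : ∀ z, y z - f z ≤ C) :
    y ∈ conjDom f := ⟨C, by rintro _ ⟨z, rfl⟩; exact h z⟩

theorem conj_le {y : StrongDual ℝ V} {C : ℝ} (h : ∀ z, y z - f z ≤ C) : conj f y ≤ C :=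
  ciSup_le h

theorem convexOn_conj : ConvexOn ℝ (conjDom f) (conj f) := by
  have key : ∀ y ∈ conjDom f, ∀ y' ∈ conjDom f, ∀ s t : ℝ, 0 ≤ s → 0 ≤ t → s + t = 1 →
      ∀ z, (s • y + t • y') z - f z ≤ s * conj f y + t * conj f y' := by
    intro y hy y' hy' s t hs ht hst z
    have h1 := mul_le_mul_of_nonneg_left (le_conj hy z) hs
    have h2 := mul_le_mul_of_nonneg_left (le_conj hy' z) ht
    have : f z = s * f z + t * f z := by rw [← add_mul, hst, one_mul]
    simp only [add_apply, smul_apply, smul_eq_mul]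
    linarith
  refine ⟨fun y hy y' hy' s t hs ht hst => mem_conjDom_of_le (key y hy y' hy' s t hs ht hst),
    fun y hy y' hy' s t hs ht hst => conj_le (key y hy y' hy' s t hs ht hst)⟩

/-- If y v exceeded Cf ‖v‖, then y - f would grow linearly along the ray through v and the conjugate
would be infinite. -/
theorem norm_le_of_mem_conjDom {Cf : ℝ} (hCf : 0 ≤ Cf) (hf : ∀ z z', |f z - f z'| ≤ Cf * ‖z - z'‖)
    {y : StrongDual ℝ V} (hy : y ∈ conjDom f) : ‖y‖ ≤ Cf := by
  have key : ∀ v, y v ≤ Cf * ‖v‖ := by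
    intro v
    by_contra! hlt
    set D := y v - Cf * ‖v‖
    have hD : 0 < D := by simp only [D]; linarith
    have hs : ∀ s : ℝ, 0 ≤ s → s * D ≤ conj f y + f 0 := by
      intro s hs
      have h1 := le_conj hy (s • v)
      have h2 := (abs_le.1 (hf (s • v) 0)).2
      rw [sub_zero, norm_smul, Real.norm_of_nonneg hs] at h2
      rw [map_smul, smul_eq_mul] at h1
      simp only [D]; nlinarith
    have h0 := hs 0 le_rfl
    -- The value at s = 0 shows that the numerator is positive; this s overshoots the bound by
    -- exactly 1.
    have h1 := hs ((conj f y + f 0 + 1) / D) (by apply div_nonneg <;> linarith)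
    rw [div_mul_cancel₀ _ hD.ne'] at h1
    linarith
  refine y.opNorm_le_bound hCf fun v => ?_
  rw [Real.norm_eq_abs, abs_le]
  refine ⟨?_, key v⟩
  have := key (-v)
  rw [map_neg, norm_neg] at this
  linarith

/-- Along -s b_j the function f does not increase, so a negative y (b_j) would make y - f unbounded.
This sign is what lets a dual point be applied to coordinatewise inequalities for g_i. -/
theorem apply_basis_nonneg {m : ℕ} {b : Module.Basis (Fin m) ℝ V} (hf : CoordMonotone b f)
    {y : StrongDual ℝ V} (hy : y ∈ conjDom f) (j : Fin m) : 0 ≤ y (b j) := by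
  by_contra! hlt
  have hs : ∀ s : ℝ, 0 ≤ s → s * (-y (b j)) ≤ conj f y + f 0 := by
    intro s hs
    have h1 := le_conj hy (-(s • b j))
    have h2 : f (-(s • b j)) ≤ f 0 := hf _ _ fun k => by
      simp only [map_neg, map_smul, Module.Basis.repr_self, Finsupp.smul_single, smul_eq_mul,
        mul_one, Finsupp.coe_neg, Pi.neg_apply, map_zero, Finsupp.coe_zero, Pi.zero_apply,
        Left.neg_nonpos_iff, Finsupp.single_apply]
      split_ifs <;> simp [hs]
    rw [map_neg, map_smul, smul_eq_mul] at h1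
    linarith
  have h0 := hs 0 le_rfl
  have h1 := hs ((conj f y + f 0 + 1) / (-y (b j))) (by apply div_nonneg <;> linarith)
  rw [div_mul_cancel₀ _ (by linarith : 0 < -y (b j)).ne'] at h1
  linarith

theorem apply_mono_of_coordMonotone {m : ℕ} {b : Module.Basis (Fin m) ℝ V} (hf : CoordMonotone b f)
    {y : StrongDual ℝ V} (hy : y ∈ conjDom f) {z z' : V} (h : ∀ j, b.repr z j ≤ b.repr z' j) :
    y z ≤ y z' := by
  rw [← b.sum_repr z, ← b.sum_repr z', map_sum, map_sum]
  refine Finset.sum_le_sum fun j _ => ?_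
  rw [map_smul, map_smul, smul_eq_mul, smul_eq_mul]
  exact mul_le_mul_of_nonneg_right (h j) (apply_basis_nonneg hf hy j)

namespace OuterFunction

variable {Cf Lf : ℝ}

theorem add_fderiv_le (hf : OuterFunction Cf Lf f) (z z' : V) :
    f z + fderiv ℝ f z (z' - z) ≤ f z' := by
  have := fderiv_apply_le_of_slope (K := f z' - f z) (hf.differentiable z).hasFDerivAt (v := z' - z)
    fun s h0 h1 => by
      have := hf.convex.2 (Set.mem_univ z) (Set.mem_univ z') (by linarith : 0 ≤ 1 - s) h0.le (by ring)
      have e : (1 - s) • z + s • z' = z + s • (z' - z) := by module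
      rw [e, smul_eq_mul, smul_eq_mul] at this
      linarith
  linarith

theorem fderiv_mem_conjDom (hf : OuterFunction Cf Lf f) (z : V) : fderiv ℝ f z ∈ conjDom f :=
  mem_conjDom_of_le (C := fderiv ℝ f z z - f z) fun z' => by
    have := hf.add_fderiv_le z z'
    rw [map_sub] at this
    linarith

theorem conj_fderiv (hf : OuterFunction Cf Lf f) (z : V) :
    conj f (fderiv ℝ f z) = fderiv ℝ f z z - f z := by
  refine le_antisymm (conj_le fun z' => ?_) (le_conj (hf.fderiv_mem_conjDom z) z)
  have := hf.add_fderiv_le z z'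
  rw [map_sub] at this
  linarith

/-- Equality in Fenchel–Young makes f(q) + y(· - q) an affine minorant touching the differentiable f
at q, so its slope is the derivative. Dual points are thereby determined by their subgradients. -/
theorem eq_fderiv_of_le (hf : OuterFunction Cf Lf f) {y : StrongDual ℝ V} (hy : y ∈ conjDom f) {q : V}
    (h : conj f y ≤ y q - f q) : y = fderiv ℝ f q := by
  ext v
  have hle : ∀ z, f q + y (z - q) ≤ f z := fun z => by
    have := le_conj hy z
    rw [map_sub]; linarith
  refine le_antisymm ?_ ?_
  · refine le_fderiv_apply_of_slope (hf.differentiable q).hasFDerivAt fun s _ _ => ?_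
    have := hle (q + s • v)
    rw [add_sub_cancel_left, map_smul, smul_eq_mul] at this
    linarith
  · have : -y v ≤ fderiv ℝ f q (-v) :=
      le_fderiv_apply_of_slope (hf.differentiable q).hasFDerivAt fun s _ _ => by
        have := hle (q + s • -v)
        rw [add_sub_cancel_left, map_smul, smul_eq_mul, map_neg] at this
        linarith
    rw [map_neg] at this
    linarith

/-- Testing the subgradient inequality at ∇f(q), where the conjugate is known, gives equality in
Fenchel–Young without biconjugation. -/
theorem conj_eq_of_isConjSubgrad (hf : OuterFunction Cf Lf f) {y : StrongDual ℝ V}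
    (hy : y ∈ conjDom f) {q : V} (h : IsConjSubgrad f y q) : conj f y = y q - f q := by
  refine le_antisymm ?_ (le_conj hy q)
  have := h _ (hf.fderiv_mem_conjDom q)
  rw [hf.conj_fderiv, sub_apply] at this
  linarith

theorem isConjSubgrad_fderiv (hf : OuterFunction Cf Lf f) (q : V) :
    IsConjSubgrad f (fderiv ℝ f q) q := by
  intro a ha
  have := le_conj ha q
  rw [hf.conj_fderiv, sub_apply]
  linarith

/-- The conjugate of an `L_f`-smooth function is `1/L_f`-strongly convex. -/
theorem strong_convexity_conj (hf : OuterFunction Cf Lf f) (hLf : 0 < Lf) {y a : StrongDual ℝ V}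
    (hy : y ∈ conjDom f) (ha : a ∈ conjDom f) {q : V} (h : IsConjSubgrad f y q) :
    1 / Lf / 2 * ‖a - y‖ ^ 2 ≤ bregman (conj f) a y q := by
  have e := hf.conj_eq_of_isConjSubgrad hy h
  have ey := hf.eq_fderiv_of_le hy e.le
  -- The conjugate at a is at least a(q+v) - f(q+v) for every v. Bounding f(q+v) by smoothness
  -- leaves (a - y)v - (Lf/2)‖v‖², whose supremum over v is the squared norm.
  refine norm_sq_le_of_forall_sub_le hLf fun v => ?_
  have h1 := le_conj ha (q + v)
  have h2 := (abs_le.1 (hf.smooth (q + v) q)).2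
  rw [← ey, add_sub_cancel_left] at h2
  rw [bregman, e]
  simp only [sub_apply, map_add] at *
  linarith

end OuterFunction

end Conj

/-! ### The dual step: existence, uniqueness, measurability, three-point inequality. -/

section DualStep

variable {V : Type*} [NormedAddCommGroup V] [NormedSpace ℝ V] {f : V → ℝ}

/-- The domain need not be closed, but it is the countable union of the closed sublevel sets of the
conjugate. -/
theorem measurableSet_conjDom : MeasurableSet (conjDom f) := by
  have : conjDom f = ⋃ N : ℕ, ⋂ z : V, {y : StrongDual ℝ V | y z - f z ≤ N} := by
    ext y
    simp only [Set.mem_iUnion, Set.mem_iInter, Set.mem_ofPred_eq]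
    constructor
    · rintro ⟨C, hC⟩
      obtain ⟨N, hN⟩ := exists_nat_ge C
      exact ⟨N, fun z => (hC ⟨z, rfl⟩).trans hN⟩
    · rintro ⟨N, hN⟩
      exact mem_conjDom_of_le hN
  rw [this]
  refine MeasurableSet.iUnion fun N => IsClosed.measurableSet (isClosed_iInter fun z => ?_)
  exact isClosed_le (by fun_prop) continuous_const

/-- In finite dimension every functional on the dual is evaluation at a vector. -/
theorem inclusionInDoubleDual_bijective [FiniteDimensional ℝ V] :
    Function.Bijective (NormedSpace.inclusionInDoubleDual ℝ V) := by
  have hinj : Function.Injective (NormedSpace.inclusionInDoubleDual ℝ V) :=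
    (NormedSpace.inclusionInDoubleDualLi ℝ (E := V)).injective
  refine ⟨hinj, ?_⟩
  have hd : ∀ (W : Type _) [NormedAddCommGroup W] [NormedSpace ℝ W] [FiniteDimensional ℝ W],
      Module.finrank ℝ (StrongDual ℝ W) = Module.finrank ℝ W := fun W _ _ _ => by
    rw [← Subspace.dual_finrank_eq (K := ℝ) (V := W)]
    exact (LinearMap.toContinuousLinearMap (𝕜 := ℝ) (E := W) (F' := ℝ)).symm.finrank_eq
  have e : Module.finrank ℝ V = Module.finrank ℝ (StrongDual ℝ (StrongDual ℝ V)) := by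
    rw [hd, hd]
  exact (LinearMap.injective_iff_surjective_of_finrank_eq_finrank
    (f := (NormedSpace.inclusionInDoubleDual ℝ V).toLinearMap) e).1 hinj

/-- Turns the derivative of ψ, an element of the bidual, into a vector of V that depends measurably
on it. -/
theorem exists_doubleDual_inverse [FiniteDimensional ℝ V] [MeasurableSpace V] [BorelSpace V] :
    ∃ J : StrongDual ℝ (StrongDual ℝ V) → V, Measurable J ∧
      (∀ φ, NormedSpace.inclusionInDoubleDual ℝ V (J φ) = φ) ∧
      ∀ z, J (NormedSpace.inclusionInDoubleDual ℝ V z) = z := by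
  let e := LinearEquiv.ofBijective (NormedSpace.inclusionInDoubleDual ℝ V).toLinearMap
    inclusionInDoubleDual_bijective
  refine ⟨e.symm, ?_, fun φ => e.apply_symm_apply φ, fun z => e.symm_apply_apply z⟩
  exact (LinearMap.continuous_of_finiteDimensional e.symm.toLinearMap).measurable

/-- The conjugate maximization problem of a dual step has a solution. -/
theorem exists_isMaxOn_dual [FiniteDimensional ℝ V] {Cf Lf τ : ℝ} (hf : OuterFunction Cf Lf f)
    (hCf : 0 ≤ Cf) (hτ : 0 < τ) {ψ : StrongDual ℝ V → ℝ} {y : StrongDual ℝ V} {q : V}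
    (hy : y ∈ conjDom f) (hd : ∀ y ∈ conjDom f, DifferentiableAt ℝ ψ y)
    (hq : ∀ a ∈ conjDom f, 0 ≤ bregman ψ a y q) (w : V) :
    ∃ a ∈ conjDom f, IsMaxOn (fun a => a w - (conj f a + τ * ψ a)) (conjDom f) a := by
  set h : StrongDual ℝ V → ℝ := fun a => a w - (conj f a + τ * ψ a) with hh
  -- The domain may fail to be compact, so the search is restricted to the compact sublevel set f^*
  -- ≤ C. The bound on ψ from below by its linearization at y makes C large enough that every
  -- competitor at least as good as y lies in this set.
  set C : ℝ := Cf * ‖w‖ + |τ * (ψ y)| + τ * (2 * Cf * ‖q‖) - h y with hC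
  set s : Set (StrongDual ℝ V) := {a | ∀ z, a z - f z ≤ C} with hs
  have hsub : s ⊆ conjDom f := fun a ha => mem_conjDom_of_le ha
  have hbig : ∀ a ∈ conjDom f, h y ≤ h a → a ∈ s := by
    intro a ha hle z
    refine (le_conj ha z).trans ?_
    have h1 := hq a ha
    have na := norm_le_of_mem_conjDom hCf hf.lipschitz ha
    have ny := norm_le_of_mem_conjDom hCf hf.lipschitz hy
    have h2 : a w ≤ Cf * ‖w‖ := (le_abs_self _).trans ((a.le_opNorm w).trans (by gcongr))
    have h3 : -((a - y) q) ≤ 2 * Cf * ‖q‖ := by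
      refine (neg_le_abs _).trans (((a - y).le_opNorm q).trans ?_)
      gcongr
      exact (norm_sub_le _ _).trans (by linarith)
    have h4 : ψ y - 2 * Cf * ‖q‖ ≤ ψ a := by
      rw [bregman] at h1; linarith
    have h5 := mul_le_mul_of_nonneg_left h4 hτ.le
    have h6 := neg_abs_le (τ * ψ y)
    rw [hC]
    simp only [hh] at hle ⊢
    nlinarith
  have hys : y ∈ s := hbig y hy le_rfl
  have hcomp : IsCompact s := by
    refine Metric.isCompact_of_isClosed_isBounded ?_ ?_
    · have : s = ⋂ z, {a : StrongDual ℝ V | a z - f z ≤ C} := by ext; simp [hs]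
      rw [this]
      exact isClosed_iInter fun z => isClosed_le (by fun_prop) continuous_const
    · refine (Metric.isBounded_closedBall (x := (0 : StrongDual ℝ V)) (r := Cf)).subset fun a ha => ?_
      rw [mem_closedBall_zero_iff]
      exact norm_le_of_mem_conjDom hCf hf.lipschitz (hsub ha)
  have hconj : LowerSemicontinuousOn (conj f) s := by
    have := lowerSemicontinuousOn_ciSup (s := s) (f := fun (z : V) (a : StrongDual ℝ V) => a z - f z)
      (fun a ha => hsub ha) (fun z => (by fun_prop : Continuous _).lowerSemicontinuous.lowerSemicontinuousOn _)
    exact this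
  have hrest : ContinuousOn (fun a : StrongDual ℝ V => τ * ψ a - a w) s := by
    intro a ha
    have := (hd a (hsub ha)).continuousAt.continuousWithinAt (s := s)
    exact (this.const_mul τ).sub
      (by fun_prop : Continuous fun a : StrongDual ℝ V => a w).continuousWithinAt
  obtain ⟨a, ha, hmin⟩ := LowerSemicontinuousOn.exists_isMinOn ⟨y, hys⟩ hcomp
    (hconj.add hrest.lowerSemicontinuousOn)
  refine ⟨a, hsub ha, fun a' ha' => ?_⟩
  have hle : ∀ a' ∈ s, h a' ≤ h a := fun a' ha' => by
    have := hmin ha'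
    simp only [Set.mem_ofPred_eq] at this
    simp only [hh]; linarith
  by_cases hc : h y ≤ h a'
  · exact hle a' (hbig a' ha' hc)
  · exact (not_le.1 hc).le.trans (hle y hys)

/-- At a maximizer of `a w - f^*(a) - τ ψ(a)`, the vector `w - τ ∇ψ` is a subgradient of `f^*`. -/
theorem isConjSubgrad_of_isMaxOn {τ : ℝ} {ψ : StrongDual ℝ V → ℝ} {a : StrongDual ℝ V}
    {w z : V} (ha : a ∈ conjDom f)
    (hmax : IsMaxOn (fun a => a w - (conj f a + τ * ψ a)) (conjDom f) a) (hz : IsGrad ψ a z) :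
    IsConjSubgrad f a (w - τ • z) := by
  intro a' ha'
  have h1 : HasFDerivAt (fun a => τ * ψ a) (τ • NormedSpace.inclusionInDoubleDual ℝ V z) a :=
    HasFDerivAt.const_mul hz τ
  -- Moving from a towards a', only the conjugate is treated by convexity; ψ enters through its
  -- derivative alone.
  have h2 := le_fderiv_apply_of_slope (v := a' - a) (K := (a' - a) w - (conj f a' - conj f a)) h1
    fun s h0 h1 => by
      have e : a + s • (a' - a) = (1 - s) • a + s • a' := by module
      have hm : a + s • (a' - a) ∈ conjDom f := by
        rw [e]; exact convexOn_conj.1 ha ha' (by linarith) h0.le (by ring)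
      have hc := convexOn_conj.2 ha ha' (by linarith : 0 ≤ 1 - s) h0.le (by ring)
      rw [← e, smul_eq_mul, smul_eq_mul] at hc
      have := hmax hm
      simp only [Set.mem_ofPred_eq, add_apply, smul_apply, smul_eq_mul] at this
      linarith
  simp only [smul_apply, NormedSpace.dual_def, smul_eq_mul] at h2
  rw [map_sub, map_smul, smul_eq_mul]
  linarith

namespace DGF

variable {Cf Lf μψ ρ κ : ℝ} {ψ : DGF V}

/-- One modulus κ serves both choices of ψ: 1/Lf is the strong convexity of the conjugate, μψ that
of a given ψ. -/
theorem bregman_lower (hf : OuterFunction Cf Lf f) (hLf : 0 < Lf) (hψ : ψ.Admissible f μψ ρ)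
    (hκ : κ ≤ μψ) (hκ' : κ ≤ 1 / Lf) {y a : StrongDual ℝ V} (hy : y ∈ conjDom f)
    (ha : a ∈ conjDom f) {q : V} (hq : ψ.IsSubgrad f y q) :
    κ / 2 * ‖a - y‖ ^ 2 ≤ bregman (ψ.val f) a y q := by
  cases ψ with
  | conjugate =>
    refine le_trans ?_ (hf.strong_convexity_conj hLf hy ha hq)
    gcongr
  | smooth ψ =>
    refine le_trans ?_ (hψ.2 y hy q hq a ha).1
    gcongr

/-- On pairs of a dual point and a subgradient, the Bregman divergence is measurable. -/
theorem exists_measurable_bregman [FiniteDimensional ℝ V] [MeasurableSpace V] [BorelSpace V]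
    (hf : OuterFunction Cf Lf f) (hψ : ψ.Admissible f μψ ρ) (a : StrongDual ℝ V) :
    ∃ D : StrongDual ℝ V × V → ℝ, Measurable D ∧ ∀ y ∈ conjDom f, ∀ q, ψ.IsSubgrad f y q →
      bregman (ψ.val f) a y q = D (y, q) := by
  cases ψ with
  | conjugate =>
    -- By Fenchel equality f^*(y) = y q - f q, so y cancels and the divergence is a continuous
    -- function of q.
    refine ⟨fun yq => conj f a - (a yq.2 - f yq.2), ?_, fun y hy q hq => ?_⟩
    · have := hf.differentiable.continuous
      fun_prop
    · have := hf.conj_eq_of_isConjSubgrad hy hq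
      simp only [DGF.val, bregman, sub_apply]
      linarith
  | smooth ψ =>
    classical
    -- Nothing is known about ψ off the domain, so it is replaced by 0 there.
    refine ⟨fun yq => ψ a - (conjDom f).piecewise ψ 0 yq.1 - (a - yq.1) yq.2, ?_,
      fun y hy q hq => ?_⟩
    · have h1 : Measurable ((conjDom f).piecewise ψ 0) :=
        ContinuousOn.measurable_piecewise
          (fun y hy => (hψ.1 y hy).continuousAt.continuousWithinAt) continuousOn_const
          measurableSet_conjDom
      have h2 : Measurable fun yq : StrongDual ℝ V × V => (a - yq.1) yq.2 :=
        Continuous.measurable (by fun_prop)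
      exact (measurable_const.sub (h1.comp measurable_fst)).sub h2
    · simp only [DGF.val, bregman]
      rw [Set.piecewise_eq_of_mem _ _ _ hy]

/-- The dual step as a measurable map of the extrapolated estimate and the current subgradient. -/
theorem exists_dual_step [FiniteDimensional ℝ V] [MeasurableSpace V] [BorelSpace V] {τ ρ₁ : ℝ}
    (hf : OuterFunction Cf Lf f) (hCf : 0 ≤ Cf) (hLf : 0 < Lf) (hμψ : 0 < μψ)
    (hψ : ψ.Admissible f μψ ρ) (hτ : 0 < τ) (hρ₁ : ρ₁ ≤ 1) (hρ₁' : ρ₁ ≤ ρ) :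
    ∃ T : V × V → StrongDual ℝ V × V, Measurable T ∧ ∀ (gt q : V) (y : StrongDual ℝ V),
      y ∈ conjDom f → ψ.IsSubgrad f y q →
      (T (gt, q)).1 ∈ conjDom f ∧ ψ.IsSubgrad f (T (gt, q)).1 (T (gt, q)).2 ∧
      (∀ a ∈ conjDom f, (a - (T (gt, q)).1) gt - conj f a + conj f (T (gt, q)).1 ≤
        τ * bregman (ψ.val f) a y q - τ * bregman (ψ.val f) (T (gt, q)).1 y q
          - (τ + ρ₁) * bregman (ψ.val f) a (T (gt, q)).1 (T (gt, q)).2) ∧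
      ∀ y' q', y' ∈ conjDom f →
        IsMaxOn (fun a => a gt - conj f a - τ * bregman (ψ.val f) a y q) (conjDom f) y' →
        ψ.NextSubgrad τ gt q y' q' → y' = (T (gt, q)).1 ∧ q' = (T (gt, q)).2 := by
  cases ψ with
  | conjugate =>
    have hτ1 : 0 < 1 + τ := by linarith
    -- With this N the objective equals, up to a constant, (1+τ)(a N - f^*(a)), so its maximizer is
    -- ∇f(N) and N is a subgradient there.
    set N : V × V → V := fun w => (1 / (1 + τ)) • (τ • w.2 + w.1) with hN
    have hNm : Continuous N := by fun_prop
    have hNe : ∀ gt q, gt + τ • q = (1 + τ) • N (gt, q) := fun gt q => by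
      simp only [hN, smul_smul]
      rw [mul_one_div_cancel hτ1.ne', one_smul, add_comm]
    refine ⟨fun w => (fderiv ℝ f (N w), N w),
      ((measurable_fderiv ℝ f).comp hNm.measurable).prodMk hNm.measurable, ?_⟩
    intro gt q y hy hq
    dsimp only
    set Q := N (gt, q) with hQ
    have hdom := hf.fderiv_mem_conjDom Q
    have hap : ∀ a : StrongDual ℝ V, a gt = (1 + τ) * a Q - τ * a q := fun a => by
      have := congrArg a (hNe gt q)
      rw [map_add, map_smul, map_smul, smul_eq_mul, smul_eq_mul] at this
      linarith
    refine ⟨hdom, hf.isConjSubgrad_fderiv Q, fun a ha => ?_, fun y' q' hy' hmax hn => ?_⟩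
    · have hU : 0 ≤ bregman (conj f) a (fderiv ℝ f Q) Q :=
        le_trans (by positivity)
          (hf.strong_convexity_conj hLf hdom ha (hf.isConjSubgrad_fderiv Q))
      have h1 : ρ₁ * bregman (conj f) a (fderiv ℝ f Q) Q ≤ 1 * bregman (conj f) a (fderiv ℝ f Q) Q :=
        by gcongr
      rw [hap]
      simp only [DGF.val, bregman, sub_apply] at h1 ⊢
      linarith
    -- Comparing a maximizer with ∇f(Q) forces equality in Fenchel–Young, which identifies it.
    · refine ⟨hf.eq_fderiv_of_le hy' ?_, hn⟩
      have := hmax hdom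
      simp only [Set.mem_ofPred_eq, hap, DGF.val, bregman, sub_apply] at this
      have h2 := hf.conj_fderiv Q
      have h3 : (1 + τ) * (conj f y' - (y' Q - f Q)) ≤ 0 := by
        rw [show f Q = fderiv ℝ f Q Q - conj f (fderiv ℝ f Q) by linarith]
        linarith
      by_contra! hlt
      nlinarith
  | smooth ψ =>
    obtain ⟨J, hJm, hJ, hJ'⟩ := exists_doubleDual_inverse (V := V)
    have hgrad : ∀ y ∈ conjDom f, IsGrad ψ y (J (fderiv ℝ ψ y)) := fun y hy => by
      rw [IsGrad, hJ]
      exact (hψ.1 y hy).hasFDerivAt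
    have hnn : ∀ y ∈ conjDom f, ∀ z, IsGrad ψ y z → ∀ a ∈ conjDom f, 0 ≤ bregman ψ a y z :=
      fun y hy z hz a ha => le_trans (by positivity) (hψ.2 y hy z hz a ha).1
    have hex : ∀ w : V, ∃ a ∈ conjDom f,
        IsMaxOn (fun a => a w - (conj f a + τ * ψ a)) (conjDom f) a :=
      fun w => exists_isMaxOn_dual hf hCf hτ (hf.fderiv_mem_conjDom 0) hψ.1
        (hnn _ (hf.fderiv_mem_conjDom 0) _ (hgrad _ (hf.fderiv_mem_conjDom 0))) w
    -- Quadratic growth away from a maximizer, from the strong convexity of the conjugate alone. It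
    -- gives uniqueness of the maximizer and its Lipschitz dependence on w.
    have hgrow : ∀ w, ∀ a ∈ conjDom f,
        IsMaxOn (fun a => a w - (conj f a + τ * ψ a)) (conjDom f) a → ∀ a' ∈ conjDom f,
        1 / Lf / 2 * ‖a' - a‖ ^ 2 ≤
          (a w - (conj f a + τ * ψ a)) - (a' w - (conj f a' + τ * ψ a')) := by
      intro w a ha hmax a' ha'
      have h1 := hf.strong_convexity_conj hLf ha ha'
        (isConjSubgrad_of_isMaxOn ha hmax (hgrad a ha))
      have h2 := mul_nonneg hτ.le (hnn a ha _ (hgrad a ha) a' ha')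
      simp only [bregman, map_sub, sub_apply, map_smul, smul_eq_mul] at h1 h2 ⊢
      linarith
    choose A hA hAmax using hex
    -- Quadratic growth at both maximizers, added; the values of f^* and ψ cancel.
    have hlip : ∀ w w', ‖A w - A w'‖ ≤ Lf * ‖w - w'‖ := by
      intro w w'
      have h1 := hgrow w (A w) (hA w) (hAmax w) (A w') (hA w')
      have h2 := hgrow w' (A w') (hA w') (hAmax w') (A w) (hA w)
      rw [norm_sub_rev] at h1
      have h3 : (A w - A w') (w - w') ≤ ‖A w - A w'‖ * ‖w - w'‖ :=
        (le_abs_self _).trans ((A w - A w').le_opNorm _)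
      simp only [map_sub, sub_apply] at h3
      have h4 : 1 / Lf * ‖A w - A w'‖ ^ 2 ≤ ‖A w - A w'‖ * ‖w - w'‖ := by linarith
      rw [one_div, inv_mul_le_iff₀ hLf] at h4
      by_contra! hlt
      have h5 : 0 ≤ Lf * ‖w - w'‖ := by positivity
      nlinarith
    have hAm : Measurable A := by
      have : LipschitzWith ⟨Lf, hLf.le⟩ A := LipschitzWith.of_dist_le_mul fun w w' => by
        rw [dist_eq_norm, dist_eq_norm]; exact hlip w w'
      exact this.continuous.measurable
    have hWm : Measurable fun w : V × V => A (w.1 + τ • w.2) :=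
      hAm.comp (Continuous.measurable (by fun_prop))
    refine ⟨fun w => (A (w.1 + τ • w.2), J (fderiv ℝ ψ (A (w.1 + τ • w.2)))),
      hWm.prodMk (hJm.comp ((measurable_fderiv ℝ ψ).comp hWm)), ?_⟩
    intro gt q y hy hq
    dsimp only
    set w := gt + τ • q with hw
    refine ⟨hA w, hgrad _ (hA w), fun a ha => ?_, fun y' q' hy' hmax hn => ?_⟩
    · have hU := hnn _ (hA w) _ (hgrad _ (hA w)) a ha
      -- The comparison of the two Bregman divergences, taken at the subgradient w - τ∇ψ of f^*,
      -- supplies the gain ρ beyond τ.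
      have h1 := (hψ.2 _ (hA w) _ (hgrad _ (hA w)) a ha).2 _
        (isConjSubgrad_of_isMaxOn (hA w) (hAmax w) (hgrad _ (hA w)))
      have h2 : ρ₁ * bregman ψ a (A w) (J (fderiv ℝ ψ (A w))) ≤
        ρ * bregman ψ a (A w) (J (fderiv ℝ ψ (A w))) := by gcongr
      have h3 : ∀ a : StrongDual ℝ V, a w = a gt + τ * a q := fun a => by simp [hw]
      simp only [DGF.val, bregman, map_sub, sub_apply, map_smul, smul_eq_mul, h3] at h1 h2 ⊢
      linarith
    · have h3 : ∀ a : StrongDual ℝ V, a w = a gt + τ * a q := fun a => by simp [hw]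
      have h4 := hgrow w (A w) (hA w) (hAmax w) y' hy'
      have h5 := hmax (hA w)
      simp only [Set.mem_ofPred_eq, DGF.val, bregman, sub_apply, h3] at h4 h5
      have h6 : 1 / Lf / 2 * ‖y' - A w‖ ^ 2 ≤ 0 := by linarith
      have h7 : ‖y' - A w‖ ^ 2 ≤ 0 := by
        by_contra! hlt
        have : 0 < 1 / Lf / 2 * ‖y' - A w‖ ^ 2 := by positivity
        linarith
      have h8 : y' = A w := by
        rw [← sub_eq_zero, ← norm_eq_zero]
        exact pow_eq_zero_iff two_ne_zero |>.1 (le_antisymm h7 (by positivity))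
      refine ⟨h8, ?_⟩
      rw [← h8]
      have h9 : HasFDerivAt ψ (NormedSpace.inclusionInDoubleDual ℝ V q') y' := hn
      rw [h9.fderiv, hJ']

end DGF

end DualStep

/-! ### The primal step and first-order optimality. -/

theorem le_of_forall_one_sub_mul_le {K L : ℝ} (h : ∀ s : ℝ, 0 < s → s < 1 → (1 - s) * K ≤ L) :
    K ≤ L := by
  have h1 : Filter.Tendsto (fun s : ℝ => (1 - s) * K) (nhdsWithin 0 (Set.Ioi 0)) (nhds K) := by
    have : Filter.Tendsto (fun s : ℝ => (1 - s) * K) (nhds 0) (nhds ((1 - 0) * K)) :=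
      Continuous.tendsto (by fun_prop) 0
    rw [sub_zero, one_mul] at this
    exact this.mono_left nhdsWithin_le_nhds
  refine le_of_tendsto h1 ?_
  filter_upwards [Ioo_mem_nhdsGT (one_pos : (0 : ℝ) < 1)] with s hs
  exact h s hs.1 hs.2

theorem norm_sq_convex_comb {E : Type*} [NormedAddCommGroup E] [InnerProductSpace ℝ E] (x u v : E)
    (s : ℝ) : ‖(1 - s) • u + s • v - x‖ ^ 2 =
      (1 - s) * ‖u - x‖ ^ 2 + s * ‖v - x‖ ^ 2 - s * (1 - s) * ‖v - u‖ ^ 2 := by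
  have e1 : (1 - s) • u + s • v - x = (u - x) + s • (v - u) := by module
  have e2 : v - x = (u - x) + (v - u) := by module
  rw [e1, e2, norm_add_sq_real, norm_add_sq_real, norm_smul, inner_smul_right, mul_pow,
    Real.norm_eq_abs, sq_abs]
  ring

section Primal

variable {V : Type u} [NormedAddCommGroup V] [NormedSpace ℝ V] {d n m : ℕ}
  {Z : Fin n → Type w} [∀ i, MeasurableSpace (Z i)] {p : Problem V d n Z}
  {b : Module.Basis (Fin m) ℝ V} {μ Cf Lf Cg σ₀ σ₁ δ : ℝ}

namespace Problem.Assumptions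

theorem r_coe (h : p.Assumptions b μ Cf Lf Cg σ₀ σ₁ δ) {x : Primal d} (hx : x ∈ p.X)
    (hr : p.r x ≠ ⊤) : p.r x = ((p.r x).toReal : EReal) :=
  (EReal.coe_toReal hr (h.r_ne_bot x hx)).symm

theorem convex_comb_mem (h : p.Assumptions b μ Cf Lf Cg σ₀ σ₁ δ) {x u : Primal d} (hx : x ∈ p.X)
    (hu : u ∈ p.X) {s : ℝ} (h0 : 0 < s) (h1 : s < 1) : (1 - s) • x + s • u ∈ p.X :=
  h.convex hx hu (by linarith) h0.le (by ring)

theorem r_strong_real (h : p.Assumptions b μ Cf Lf Cg σ₀ σ₁ δ) {x u : Primal d} (hx : x ∈ p.X)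
    (hu : u ∈ p.X) (hrx : p.r x ≠ ⊤) (hru : p.r u ≠ ⊤) {s : ℝ} (h0 : 0 < s) (h1 : s < 1) :
    p.r ((1 - s) • x + s • u) ≠ ⊤ ∧
    (p.r ((1 - s) • x + s • u)).toReal + μ / 2 * (s * (1 - s)) * ‖u - x‖ ^ 2 ≤
      (1 - s) * (p.r x).toReal + s * (p.r u).toReal := by
  have key := h.r_strong x hx u hu (1 - s) s (by linarith) h0 (by ring)
  rw [h.r_coe hx hrx, h.r_coe hu hru, ← EReal.coe_mul, ← EReal.coe_mul, ← EReal.coe_add] at key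
  have hm := h.convex_comb_mem hx hu h0 h1
  have hne : p.r ((1 - s) • x + s • u) ≠ ⊤ := by
    intro htop
    rw [htop, EReal.top_add_coe, top_le_iff] at key
    exact EReal.coe_ne_top _ key
  refine ⟨hne, ?_⟩
  rw [h.r_coe hm hne, ← EReal.coe_add, EReal.coe_le_coe_iff] at key
  rw [norm_sub_rev u x]
  linarith

/-- The proximal objective is (η+μ)-strongly convex. Comparing its minimizer with a point at
fraction s of the way to u, dividing by s and letting s → 0 gives the quadratic growth. -/
theorem primal_three_point (h : p.Assumptions b μ Cf Lf Cg σ₀ σ₁ δ)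
    {ℓ : StrongDual ℝ (Primal d)} {η : ℝ} {x x' : Primal d} (hx' : x' ∈ p.X)
    (hmin : IsMinOn (fun u => ((ℓ u + η / 2 * ‖u - x‖ ^ 2 : ℝ) : EReal) + p.r u) p.X x') :
    p.r x' ≠ ⊤ ∧ ∀ u ∈ p.X, p.r u ≠ ⊤ →
      ℓ x' + (p.r x').toReal + η / 2 * ‖x' - x‖ ^ 2 + (η + μ) / 2 * ‖u - x'‖ ^ 2 ≤
        ℓ u + (p.r u).toReal + η / 2 * ‖u - x‖ ^ 2 := by
  have hfin : p.r x' ≠ ⊤ := by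
    obtain ⟨u, hu, hru⟩ := h.r_proper
    have := hmin hu
    simp only [Set.mem_ofPred_eq] at this
    intro htop
    rw [htop, h.r_coe hu hru, ← EReal.coe_add, EReal.coe_add_top, top_le_iff] at this
    exact EReal.coe_ne_top _ this
  refine ⟨hfin, fun u hu hru => ?_⟩
  suffices H : (η + μ) / 2 * ‖u - x'‖ ^ 2 ≤ ℓ u + (p.r u).toReal + η / 2 * ‖u - x‖ ^ 2 -
      (ℓ x' + (p.r x').toReal + η / 2 * ‖x' - x‖ ^ 2) by linarith
  refine le_of_forall_one_sub_mul_le fun s h0 h1 => ?_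
  obtain ⟨hne, hstr⟩ := h.r_strong_real hx' hu hfin hru h0 h1
  have hm := h.convex_comb_mem hx' hu h0 h1
  have key := hmin hm
  simp only [Set.mem_ofPred_eq] at key
  rw [h.r_coe hx' hfin, h.r_coe hm hne, ← EReal.coe_add, ← EReal.coe_add,
    EReal.coe_le_coe_iff, norm_sq_convex_comb, map_add, map_smul, map_smul, smul_eq_mul,
    smul_eq_mul] at key
  refine le_of_mul_le_mul_left ?_ h0
  nlinarith

/-- Two three-point inequalities, added, show that a solution depends in a Lipschitz way on the
linear term and the centre. Existence of solutions is not needed: the solution map is defined where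
solutions exist and then extended to the whole space. -/
theorem exists_prox (h : p.Assumptions b μ Cf Lf Cg σ₀ σ₁ δ) {η : ℝ} (hη : 0 ≤ η) (hμ : 0 < μ) :
    ∃ P : StrongDual ℝ (Primal d) × Primal d → Primal d, Continuous P ∧ ∀ ℓ x x', x' ∈ p.X →
      IsMinOn (fun u => ((ℓ u + η / 2 * ‖u - x‖ ^ 2 : ℝ) : EReal) + p.r u) p.X x' →
      x' = P (ℓ, x) := by
  let IsSol : StrongDual ℝ (Primal d) × Primal d → Primal d → Prop := fun w x' => x' ∈ p.X ∧
    IsMinOn (fun u => ((w.1 u + η / 2 * ‖u - w.2‖ ^ 2 : ℝ) : EReal) + p.r u) p.X x'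
  have hlip : ∀ w w' x x', IsSol w x → IsSol w' x' →
      (η + μ) * ‖x - x'‖ ≤ ‖w.1 - w'.1‖ + η * ‖w.2 - w'.2‖ := by
    rintro ⟨ℓ, c⟩ ⟨ℓ', c'⟩ x x' ⟨hx, hmin⟩ ⟨hx', hmin'⟩
    obtain ⟨hr, h1⟩ := h.primal_three_point hx hmin
    obtain ⟨hr', h2⟩ := h.primal_three_point hx' hmin'
    have h1 := h1 x' hx' hr'
    have h2 := h2 x hx hr
    rw [norm_sub_rev x' x] at h1
    have h3 : (ℓ - ℓ') (x' - x) ≤ ‖ℓ - ℓ'‖ * ‖x - x'‖ := by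
      rw [norm_sub_rev x x']
      exact (le_abs_self _).trans ((ℓ - ℓ').le_opNorm _)
    have h4 : Inner.inner ℝ (c - c') (x - x') ≤ ‖c - c'‖ * ‖x - x'‖ := real_inner_le_norm _ _
    have h5 : ‖x' - c‖ ^ 2 - ‖x - c‖ ^ 2 + ‖x - c'‖ ^ 2 - ‖x' - c'‖ ^ 2 =
        2 * Inner.inner ℝ (c - c') (x - x') := by
      simp only [norm_sub_sq_real, inner_sub_left, inner_sub_right, real_inner_comm]
      ring
    have h6 : (η + μ) * ‖x - x'‖ ^ 2 ≤ (‖ℓ - ℓ'‖ + η * ‖c - c'‖) * ‖x - x'‖ := by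
      simp only [sub_apply, map_sub] at h3
      have : η / 2 * (‖x' - c‖ ^ 2 - ‖x - c‖ ^ 2 + ‖x - c'‖ ^ 2 - ‖x' - c'‖ ^ 2) ≤
          η * (‖c - c'‖ * ‖x - x'‖) := by
        rw [h5]
        have := mul_le_mul_of_nonneg_left h4 hη
        linarith
      nlinarith
    dsimp only
    rcases (norm_nonneg (x - x')).eq_or_lt with h0 | h0
    · rw [← h0, mul_zero]; positivity
    · refine le_of_mul_le_mul_right ?_ h0
      rw [mul_assoc, ← sq]
      exact h6
  classical
  let P₀ : StrongDual ℝ (Primal d) × Primal d → Primal d := fun w =>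
    if hw : ∃ x', IsSol w x' then hw.choose else 0
  have hP₀ : ∀ w, (∃ x', IsSol w x') → IsSol w (P₀ w) := fun w hw => by
    simp only [P₀, dif_pos hw]; exact hw.choose_spec
  -- The pair carries the sup norm, so the two contributions add up to 1 + η.
  have hL : LipschitzOnWith ⟨(1 + η) / (η + μ), by positivity⟩ P₀ {w | ∃ x', IsSol w x'} := by
    refine LipschitzOnWith.of_dist_le_mul fun w hw w' hw' => ?_
    have h1 := hlip w w' _ _ (hP₀ w hw) (hP₀ w' hw')
    have h2 : ‖w.1 - w'.1‖ ≤ dist w w' := by rw [dist_eq_norm]; exact norm_fst_le (w - w')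
    have h3 : ‖w.2 - w'.2‖ ≤ dist w w' := by rw [dist_eq_norm]; exact norm_snd_le (w - w')
    change dist (P₀ w) (P₀ w') ≤ (1 + η) / (η + μ) * dist w w'
    rw [dist_eq_norm, div_mul_eq_mul_div, le_div_iff₀ (by positivity)]
    nlinarith
  obtain ⟨P, hP, hPe⟩ := hL.extend_finite_dimension
  refine ⟨P, hP.continuous, fun ℓ x x' hx' hmin => ?_⟩
  have hs : IsSol (ℓ, x) x' := ⟨hx', hmin⟩
  rw [← hPe ⟨x', hs⟩]
  have h1 := hlip _ _ _ _ hs (hP₀ _ ⟨x', hs⟩)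
  rw [sub_self, norm_zero, sub_self, norm_zero, mul_zero, add_zero] at h1
  have h2 : ‖x' - P₀ (ℓ, x)‖ ≤ 0 := by
    by_contra! hlt
    have : 0 < (η + μ) * ‖x' - P₀ (ℓ, x)‖ := by positivity
    linarith
  exact sub_eq_zero.1 (norm_le_zero_iff.1 h2)

/-- Replaces the curve s ↦ g_i((1-s)x + su) by the chord in V, by monotonicity of f_i over convex
coordinates, or because g_i is affine. Only f_i has to be differentiated afterwards. -/
theorem f_inner_comb_le (h : p.Assumptions b μ Cf Lf Cg σ₀ σ₁ δ) (i : Fin n) {x u : Primal d}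
    (hx : x ∈ p.X) (hu : u ∈ p.X) {s : ℝ} (h0 : 0 < s) (h1 : s < 1) :
    p.f i (p.inner i ((1 - s) • x + s • u)) ≤
      p.f i (p.inner i x + s • (p.inner i u - p.inner i x)) := by
  rcases h.outer_mono i with hm | ha
  · refine hm _ _ fun j => ?_
    have := (h.g_convex i j).2 hx hu (by linarith : 0 ≤ 1 - s) h0.le (by ring)
    refine this.trans (le_of_eq ?_)
    simp only [map_add, map_smul, map_sub, Finsupp.coe_add, Finsupp.coe_smul, Finsupp.coe_sub,
      Pi.add_apply, Pi.smul_apply, Pi.sub_apply, smul_eq_mul]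
    ring
  · have e1 := ha x hx _ (h.convex_comb_mem hx hu h0 h1)
    have e2 := ha x hx u hu
    have e3 : (1 - s) • x + s • u - x = s • (u - x) := by module
    rw [e1, e2, e3, map_smul, add_sub_cancel_left]

/-- First-order optimality of the minimizer. -/
theorem first_order_optimality (h : p.Assumptions b μ Cf Lf Cg σ₀ σ₁ δ) (hμ : 0 ≤ μ)
    {xs : Primal d} (hxs : p.IsMinimizer xs) :
    p.r xs ≠ ⊤ ∧ ∀ u ∈ p.X, p.r u ≠ ⊤ →
      0 ≤ (1 / n : ℝ) * ∑ i, fderiv ℝ (p.f i) (p.inner i xs) (p.inner i u - p.inner i xs) +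
        (p.r u).toReal - (p.r xs).toReal := by
  obtain ⟨hX, hmin⟩ := hxs
  have hfin : p.r xs ≠ ⊤ := by
    obtain ⟨u, hu, hru⟩ := h.r_proper
    have := hmin hu
    simp only [Set.mem_ofPred_eq, Problem.F] at this
    intro htop
    rw [htop, h.r_coe hu hru, ← EReal.coe_add, EReal.coe_add_top, top_le_iff] at this
    exact EReal.coe_ne_top _ this
  refine ⟨hfin, fun u hu hru => ?_⟩
  -- The function differentiated lives on V^n, where the values of all g_i move along a straight
  -- line; the g_i themselves may be nonsmooth.
  have hder : HasFDerivAt (fun v : Fin n → V => (1 / n : ℝ) * ∑ i, p.f i (v i))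
      ((1 / n : ℝ) • ∑ i, (fderiv ℝ (p.f i) (p.inner i xs)).comp
        (ContinuousLinearMap.proj (R := ℝ) i)) (fun i => p.inner i xs) := by
    refine HasFDerivAt.const_mul (HasFDerivAt.fun_sum fun i _ => ?_) _
    have h1 : HasFDerivAt (p.f i) (fderiv ℝ (p.f i) (p.inner i xs)) (p.inner i xs) :=
      ((h.outer i).differentiable _).hasFDerivAt
    exact HasFDerivAt.comp (g := p.f i) (f := fun v : Fin n → V => v i) (fun i => p.inner i xs) h1
      (hasFDerivAt_apply (𝕜 := ℝ) i (fun i => p.inner i xs))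
  have hmain := le_fderiv_apply_of_slope (v := fun i => p.inner i u - p.inner i xs)
    (K := (p.r xs).toReal - (p.r u).toReal) hder fun s h0 h1 => by
      -- At s = 1 the point is u itself and minimality suffices; strong convexity was prepared only
      -- for 0 < s < 1.
      rcases h1.eq_or_lt with rfl | h1
      · have key := hmin hu
        simp only [Set.mem_ofPred_eq, Problem.F] at key
        rw [h.r_coe hX hfin, h.r_coe hu hru, ← EReal.coe_add, ← EReal.coe_add,
          EReal.coe_le_coe_iff] at key
        simp only [Pi.add_apply, one_smul, add_sub_cancel]
        linarith
      · obtain ⟨hne, hstr⟩ := h.r_strong_real hX hu hfin hru h0 h1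
        have hm := h.convex_comb_mem hX hu h0 h1
        have key := hmin hm
        simp only [Set.mem_ofPred_eq, Problem.F] at key
        rw [h.r_coe hX hfin, h.r_coe hm hne, ← EReal.coe_add, ← EReal.coe_add,
          EReal.coe_le_coe_iff] at key
        have h2 : (1 / n : ℝ) * ∑ i, p.f i (p.inner i ((1 - s) • xs + s • u)) ≤
            (1 / n : ℝ) * ∑ i, p.f i (p.inner i xs + s • (p.inner i u - p.inner i xs)) := by
          gcongr with i
          exact h.f_inner_comb_le i hX hu h0 h1
        have h3 : 0 ≤ μ / 2 * (s * (1 - s)) * ‖u - xs‖ ^ 2 := by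
          have : 0 ≤ 1 - s := by linarith
          positivity
        simp only [Pi.add_apply, Pi.smul_apply]
        linarith
  simp only [smul_apply, sum_apply, ContinuousLinearMap.comp_apply,
    ContinuousLinearMap.proj_apply, smul_eq_mul] at hmain
  linarith

end Problem.Assumptions

end Primal

/-! ### The deterministic inequality of one iteration. -/

section OneStep

variable {V : Type u} [NormedAddCommGroup V] [NormedSpace ℝ V] {d n m : ℕ}
  {Z : Fin n → Type w} [∀ i, MeasurableSpace (Z i)] {p : Problem V d n Z}
  {b : Module.Basis (Fin m) ℝ V} {μ Cf Lf Cg σ₀ σ₁ δ : ℝ}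

theorem mul_le_young {a x y : ℝ} (ha : 0 < a) : x * y ≤ a * x ^ 2 + y ^ 2 / (4 * a) := by
  have : a * x ^ 2 + y ^ 2 / (4 * a) - x * y = (2 * a * x - y) ^ 2 / (4 * a) := by
    field_simp; ring
  have : 0 ≤ (2 * a * x - y) ^ 2 / (4 * a) := by positivity
  linarith

namespace Problem.Assumptions

/-- Convexity of the inner function, tested with a dual point of the outer function. -/
theorem apply_inner_ge (h : p.Assumptions b μ Cf Lf Cg σ₀ σ₁ δ) (i : Fin n) {x u : Primal d}
    (hx : x ∈ p.X) (hu : u ∈ p.X) {y : StrongDual ℝ V} (hy : y ∈ conjDom (p.f i)) :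
    y (p.inner i x) + y (p.innerD i x (u - x)) ≤ y (p.inner i u) := by
  rw [← map_add]
  rcases h.outer_mono i with hm | ha
  · refine apply_mono_of_coordMonotone hm hy fun j => ?_
    rw [map_add, Finsupp.add_apply]
    exact h.Dg_subgrad i x hx u hu j
  · rw [ha x hx u hu]

/-- Write gt as its noiseless value plus N and decompose ys(g(x')). The movement of g is paid for by
ρ/2 of the gain in Ub. The noise is split as (y - ys)N + (yb - y)N: the first part has a factor
fixed before the batch is drawn, the second is absorbed by τR. The linearization error costs Cf, and
convexity of g replaces g(xs) by its linearization at x. -/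
theorem dual_block_bound (h : p.Assumptions b μ Cf Lf Cg σ₀ σ₁ δ) (hCf : 0 ≤ Cf)
    (i : Fin n)
    {xs xp x x' : Primal d} (hxs : xs ∈ p.X) (hxp : xp ∈ p.X) (hx : x ∈ p.X) (hx' : x' ∈ p.X)
    {ys y yb : StrongDual ℝ V} (hys : ys = fderiv ℝ (p.f i) (p.inner i xs))
    (hyb : yb ∈ conjDom (p.f i)) {gt : V} {U Ub R τ ρ κ θ k₁ k₂ : ℝ} (hτ : 0 < τ) (hρ : 0 < ρ)
    (hκ : 0 < κ) (hθ : 0 ≤ θ) (hθ1 : θ ≤ 1)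
    (hstep : (ys - yb) gt - conj (p.f i) ys + conj (p.f i) yb ≤ τ * U - τ * R - (τ + ρ) * Ub)
    (hUb : κ / 2 * ‖ys - yb‖ ^ 2 ≤ Ub) (hR : κ / 2 * ‖yb - y‖ ^ 2 ≤ R)
    (hcurv : ‖p.inner i x' - p.inner i x - p.innerD i x (x' - x)‖ ≤ k₁ * ‖x' - x‖ ^ 2 + k₂) :
    ys (p.inner i x' - p.inner i xs) ≤ τ * U - (τ + ρ / 2) * Ub
      + 2 * Cg ^ 2 / (ρ * κ) * (‖x' - x‖ ^ 2 + ‖x - xp‖ ^ 2)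
      + (y - ys) (gt - ((1 + θ) • p.inner i x - θ • p.inner i xp))
      + ‖gt - ((1 + θ) • p.inner i x - θ • p.inner i xp)‖ ^ 2 / (2 * τ * κ)
      + Cf * (k₁ * ‖x' - x‖ ^ 2 + k₂) + yb (p.innerD i x (x' - xs)) := by
  set N := gt - ((1 + θ) • p.inner i x - θ • p.inner i xp) with hN
  have hgt : gt = N + ((1 + θ) • p.inner i x - θ • p.inner i xp) := by rw [hN]; abel
  -- Fenchel–Young at g_i(xs), where ys attains equality.
  have hfen : yb (p.inner i xs) - conj (p.f i) yb ≤ ys (p.inner i xs) - conj (p.f i) ys := by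
    have h1 := le_conj hyb (p.inner i xs)
    have h2 := (h.outer i).conj_fderiv (p.inner i xs)
    rw [← hys] at h2
    linarith
  have hcv := h.apply_inner_ge i hx hxs hyb
  have hcu : yb (p.inner i x' - p.inner i x - p.innerD i x (x' - x)) ≤
      Cf * (k₁ * ‖x' - x‖ ^ 2 + k₂) := by
    refine (le_abs_self _).trans ((yb.le_opNorm _).trans ?_)
    exact mul_le_mul (norm_le_of_mem_conjDom hCf (h.outer i).lipschitz hyb) hcurv
      (norm_nonneg _) hCf
  have hD : p.innerD i x (x' - x) - p.innerD i x (xs - x) = p.innerD i x (x' - xs) := by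
    rw [← map_sub]; congr 1; abel
  have hmove : (ys - yb) (p.inner i x' - p.inner i x - θ • (p.inner i x - p.inner i xp)) ≤
      ρ / 2 * Ub + 2 * Cg ^ 2 / (ρ * κ) * (‖x' - x‖ ^ 2 + ‖x - xp‖ ^ 2) := by
    have h1 : ‖p.inner i x' - p.inner i x - θ • (p.inner i x - p.inner i xp)‖ ≤
        Cg * (‖x' - x‖ + ‖x - xp‖) := by
      refine (norm_sub_le _ _).trans ?_
      rw [norm_smul, Real.norm_of_nonneg hθ]
      have h2 := h.g_lipschitz i x' hx' x hx
      have h3 := h.g_lipschitz i x hx xp hxp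
      have h4 : θ * ‖p.inner i x - p.inner i xp‖ ≤ 1 * (Cg * ‖x - xp‖) := by gcongr
      linarith
    have h5 : (ys - yb) (p.inner i x' - p.inner i x - θ • (p.inner i x - p.inner i xp)) ≤
        ‖ys - yb‖ * (Cg * (‖x' - x‖ + ‖x - xp‖)) :=
      (le_abs_self _).trans (((ys - yb).le_opNorm _).trans (by gcongr))
    -- The weight ρκ/4 makes the quadratic term at most (ρ/2) Ub.
    have h6 := mul_le_young (x := ‖ys - yb‖) (y := Cg * (‖x' - x‖ + ‖x - xp‖))
      (by positivity : 0 < ρ * κ / 4)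
    have h7 : (Cg * (‖x' - x‖ + ‖x - xp‖)) ^ 2 / (4 * (ρ * κ / 4)) ≤
        2 * Cg ^ 2 / (ρ * κ) * (‖x' - x‖ ^ 2 + ‖x - xp‖ ^ 2) := by
      rw [mul_pow, show 4 * (ρ * κ / 4) = ρ * κ by ring, div_mul_eq_mul_div]
      gcongr ?_ / _
      nlinarith [mul_nonneg (sq_nonneg Cg) (sq_nonneg (‖x' - x‖ - ‖x - xp‖))]
    have h8 := mul_le_mul_of_nonneg_left hUb hρ.le
    linarith
  have hnoise : (yb - y) N ≤ τ * R + ‖N‖ ^ 2 / (2 * τ * κ) := by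
    have h5 : (yb - y) N ≤ ‖yb - y‖ * ‖N‖ := (le_abs_self _).trans ((yb - y).le_opNorm _)
    have h6 := mul_le_young (x := ‖yb - y‖) (y := ‖N‖) (by positivity : 0 < τ * κ / 2)
    rw [show 4 * (τ * κ / 2) = 2 * τ * κ by ring] at h6
    have h8 := mul_le_mul_of_nonneg_left hR hτ.le
    linarith
  rw [hgt] at hstep
  have hDy := congrArg yb hD
  simp only [map_sub, map_add, map_smul, sub_apply, smul_eq_mul] at *
  linarith

/-- The deterministic inequality of one iteration, with the dual blocks `yb` updated for all `i`. -/
theorem one_step (h : p.Assumptions b μ Cf Lf Cg σ₀ σ₁ δ) (hμ : 0 ≤ μ) (hCf : 0 ≤ Cf)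
    {xs xp x x' : Primal d} (hxs : p.IsMinimizer xs) (hxp : xp ∈ p.X)
    (hx : x ∈ p.X) (hx' : x' ∈ p.X) {y yb : Fin n → StrongDual ℝ V}
    (hyb : ∀ i, yb i ∈ conjDom (p.f i)) {gt : Fin n → V} {U Ub R : Fin n → ℝ}
    {τ ρ κ θ η k₁ k₂ : ℝ} (hτ : 0 < τ) (hρ : 0 < ρ) (hκ : 0 < κ) (hθ : 0 ≤ θ) (hθ1 : θ ≤ 1)
    (hη : 0 < η) (hη1 : 2 * Cg ^ 2 / (ρ * κ) ≤ η / 16) (hη2 : Cf * k₁ ≤ η / 8)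
    {ys : Fin n → StrongDual ℝ V} (hys : ∀ i, ys i = fderiv ℝ (p.f i) (p.inner i xs))
    (hstep : ∀ i, (ys i - yb i) (gt i) - conj (p.f i) (ys i) + conj (p.f i) (yb i) ≤
      τ * U i - τ * R i - (τ + ρ) * Ub i)
    (hUb : ∀ i, κ / 2 * ‖ys i - yb i‖ ^ 2 ≤ Ub i) (hR : ∀ i, κ / 2 * ‖yb i - y i‖ ^ 2 ≤ R i)
    (hcurv : ∀ i, ‖p.inner i x' - p.inner i x - p.innerD i x (x' - x)‖ ≤ k₁ * ‖x' - x‖ ^ 2 + k₂)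
    (hn : 0 < n) {G Gb : StrongDual ℝ (Primal d)}
    (hGb : Gb = (1 / n : ℝ) • ∑ i, (yb i).comp (p.innerD i x))
    (hmin : IsMinOn (fun u => ((G u + η / 2 * ‖u - x‖ ^ 2 : ℝ) : EReal) + p.r u) p.X x') :
    (η + μ) / 2 * ‖x' - xs‖ ^ 2 + η / 8 * ‖x' - x‖ ^ 2 + (τ + ρ / 2) * ((1 / n : ℝ) * ∑ i, Ub i) ≤
      η / 2 * ‖x - xs‖ ^ 2 + η / 16 * ‖x - xp‖ ^ 2 + τ * ((1 / n : ℝ) * ∑ i, U i)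
      + (1 / n : ℝ) * ∑ i, (y i - ys i) (gt i - ((1 + θ) • p.inner i x - θ • p.inner i xp))
      + (1 / n : ℝ) * ∑ i, ‖gt i - ((1 + θ) • p.inner i x - θ • p.inner i xp)‖ ^ 2 / (2 * τ * κ)
      + (Gb - G) (x - xs) + 2 / η * ‖Gb - G‖ ^ 2 + Cf * k₂ := by
  obtain ⟨hrx', h3⟩ := h.primal_three_point hx' hmin
  obtain ⟨hrs, hopt⟩ := h.first_order_optimality hμ hxs
  have h3 := h3 xs hxs.1 hrs
  have hopt := hopt x' hx' hrx'
  have hn' : (0 : ℝ) < n := by exact_mod_cast hn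
  have hblock : (1 / n : ℝ) * ∑ i, fderiv ℝ (p.f i) (p.inner i xs) (p.inner i x' - p.inner i xs) ≤
      (1 / n : ℝ) * ∑ i, (τ * U i - (τ + ρ / 2) * Ub i
      + 2 * Cg ^ 2 / (ρ * κ) * (‖x' - x‖ ^ 2 + ‖x - xp‖ ^ 2)
      + (y i - ys i) (gt i - ((1 + θ) • p.inner i x - θ • p.inner i xp))
      + ‖gt i - ((1 + θ) • p.inner i x - θ • p.inner i xp)‖ ^ 2 / (2 * τ * κ)
      + Cf * (k₁ * ‖x' - x‖ ^ 2 + k₂) + yb i (p.innerD i x (x' - xs))) := by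
    gcongr with i
    rw [← hys]
    exact h.dual_block_bound hCf i hxs.1 hxp hx hx' (hys i) (hyb i) hτ hρ hκ hθ hθ1 (hstep i)
      (hUb i) (hR i) (hcurv i)
  have hconst : ∀ c : ℝ, (1 / n : ℝ) * ∑ _i : Fin n, c = c := fun c => by
    rw [Finset.sum_const, Finset.card_univ, Fintype.card_fin, nsmul_eq_mul]
    field_simp
  have hGb' : (1 / n : ℝ) * ∑ i, yb i (p.innerD i x (x' - xs)) = Gb (x' - xs) := by
    rw [hGb]
    simp only [smul_apply, sum_apply, ContinuousLinearMap.comp_apply, smul_eq_mul]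
  simp only [Finset.sum_add_distrib, Finset.sum_sub_distrib, mul_add, mul_sub] at hblock
  rw [hGb', ← Finset.mul_sum, ← Finset.mul_sum] at hblock
  simp only [hconst] at hblock
  -- The first term pairs the gradient error with a point fixed before the draw and will have mean
  -- zero; only the second needs Young's inequality.
  have hG : Gb (x' - xs) - G x' + G xs = (Gb - G) (x - xs) + (Gb - G) (x' - x) := by
    simp only [map_sub, sub_apply]; ring
  have hy1 : (Gb - G) (x' - x) ≤ η / 8 * ‖x' - x‖ ^ 2 + 2 / η * ‖Gb - G‖ ^ 2 := by
    have h5 : (Gb - G) (x' - x) ≤ ‖Gb - G‖ * ‖x' - x‖ :=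
      (le_abs_self _).trans ((Gb - G).le_opNorm _)
    have h6 := mul_le_young (x := ‖x' - x‖) (y := ‖Gb - G‖) (by positivity : 0 < η / 8)
    have h7 : ‖Gb - G‖ ^ 2 / (4 * (η / 8)) = 2 / η * ‖Gb - G‖ ^ 2 := by field_simp; ring
    linarith
  -- Budget for the η/2 ‖x'-x‖² of the proximal step: η/16 for the movement of g, η/8 for the
  -- curvature, η/8 for the gradient error, η/8 kept on the left.
  have h8 := mul_le_mul_of_nonneg_right hη1 (sq_nonneg ‖x' - x‖)
  have h9 := mul_le_mul_of_nonneg_right hη1 (sq_nonneg ‖x - xp‖)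
  have h10 := mul_le_mul_of_nonneg_right hη2 (sq_nonneg ‖x' - x‖)
  have h11 : 0 ≤ η * ‖x' - x‖ ^ 2 := by positivity
  rw [norm_sub_rev xs x', norm_sub_rev xs x] at h3
  simp only [map_sub, sub_apply] at hG hy1 hblock hopt ⊢
  linarith

end Problem.Assumptions

end OneStep

/-! ### Independence and conditioning on the past. -/

section Independence

variable {Ω 𝓧 𝓨 𝓩 : Type*} [MeasurableSpace Ω] [MeasurableSpace 𝓧] [MeasurableSpace 𝓨]
  [MeasurableSpace 𝓩] {Pr : Measure Ω} [IsProbabilityMeasure Pr]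

/-- Reassociation of a triple product law. It yields independence from a growing past: history,
value batches, gradient batches, subset. -/
theorem indepFun_prodMk_left {X : Ω → 𝓧} {Y : Ω → 𝓨} {W : Ω → 𝓩} (hX : AEMeasurable X Pr)
    (hY : AEMeasurable Y Pr) (hW : AEMeasurable W Pr)
    (h : IndepFun X (fun ω => (Y ω, W ω)) Pr) (h' : IndepFun Y W Pr) :
    IndepFun (fun ω => (X ω, Y ω)) W Pr := by
  have hXY : IndepFun X Y Pr := h.comp measurable_id measurable_fst
  rw [indepFun_iff_map_prod_eq_prod_map_map hX hY] at hXY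
  rw [indepFun_iff_map_prod_eq_prod_map_map hY hW] at h'
  rw [indepFun_iff_map_prod_eq_prod_map_map hX (hY.prodMk hW), h'] at h
  rw [indepFun_iff_map_prod_eq_prod_map_map (hX.prodMk hY) hW, hXY]
  have := Measure.isProbabilityMeasure_map hX
  have := Measure.isProbabilityMeasure_map hY
  have := Measure.isProbabilityMeasure_map hW
  have h3 := Measure.prodAssoc_prod (μ := Pr.map X) (ν := Pr.map Y) (τ := Pr.map W)
  rw [← h] at h3
  have h4 := congrArg (Measure.map (MeasurableEquiv.prodAssoc (α := 𝓧) (β := 𝓨) (γ := 𝓩)).symm) h3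
  rw [Measure.map_map (MeasurableEquiv.measurable _) (MeasurableEquiv.measurable _),
    MeasurableEquiv.symm_comp_self, Measure.map_id,
    AEMeasurable.map_map_of_aemeasurable (MeasurableEquiv.measurable _).aemeasurable
      (hX.prodMk (hY.prodMk hW))] at h4
  rw [h4]
  rfl

/-- Freezing argument: the joint law is a product, so a bound valid for almost every fixed value of
W integrates by Tonelli. -/
theorem integrable_and_integral_le_of_indepFun {W : Ω → 𝓧} {β : Ω → 𝓨} {ν : Measure 𝓨}
    [IsProbabilityMeasure ν] (hW : AEMeasurable W Pr) (hβ : AEMeasurable β Pr)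
    (hlaw : Pr.map β = ν) (hind : IndepFun W β Pr) {h : 𝓧 × 𝓨 → ℝ} (hm : Measurable h)
    (h0 : ∀ z, 0 ≤ h z) {C : ℝ}
    (hC : ∀ᵐ x ∂(Pr.map W), Integrable (fun y => h (x, y)) ν ∧ ∫ y, h (x, y) ∂ν ≤ C) :
    Integrable (fun ω => h (W ω, β ω)) Pr ∧ ∫ ω, h (W ω, β ω) ∂Pr ≤ C := by
  have := Measure.isProbabilityMeasure_map hW
  have hjoint := (indepFun_iff_map_prod_eq_prod_map_map hW hβ).1 hind
  rw [hlaw] at hjoint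
  have hi2 : Integrable (fun x => ∫ y, h (x, y) ∂ν) (Pr.map W) := by
    refine Integrable.of_bound (hm.stronglyMeasurable.integral_prod_right').aestronglyMeasurable C ?_
    filter_upwards [hC] with x hx
    rw [Real.norm_of_nonneg (integral_nonneg fun y => h0 _)]
    exact hx.2
  have hi : Integrable h ((Pr.map W).prod ν) := by
    rw [integrable_prod_iff hm.aestronglyMeasurable]
    refine ⟨hC.mono fun x hx => hx.1, ?_⟩
    simpa only [Real.norm_of_nonneg (h0 _)] using hi2
  have hpair := hW.prodMk hβ
  constructor
  · rw [← hjoint] at hi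
    exact hi.comp_aemeasurable hpair
  · have e : ∫ ω, h (W ω, β ω) ∂Pr = ∫ z, h z ∂((Pr.map W).prod ν) := by
      rw [← hjoint, integral_map hpair hm.aestronglyMeasurable]
    rw [e, integral_prod _ hi]
    calc ∫ x, ∫ y, h (x, y) ∂ν ∂(Pr.map W) ≤ ∫ _x, C ∂(Pr.map W) :=
          integral_mono_ae hi2 (integrable_const _) (hC.mono fun x hx => hx.2)
      _ = C := by simp

theorem integral_eq_zero_of_indepFun {W : Ω → 𝓧} {β : Ω → 𝓨} {ν : Measure 𝓨}
    [IsProbabilityMeasure ν] (hW : AEMeasurable W Pr) (hβ : AEMeasurable β Pr)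
    (hlaw : Pr.map β = ν) (hind : IndepFun W β Pr) {h : 𝓧 × 𝓨 → ℝ} (hm : Measurable h)
    (hi : Integrable (fun ω => h (W ω, β ω)) Pr)
    (hC : ∀ᵐ x ∂(Pr.map W), ∫ y, h (x, y) ∂ν = 0) :
    ∫ ω, h (W ω, β ω) ∂Pr = 0 := by
  have := Measure.isProbabilityMeasure_map hW
  have hjoint := (indepFun_iff_map_prod_eq_prod_map_map hW hβ).1 hind
  rw [hlaw] at hjoint
  have hpair := hW.prodMk hβ
  have hi' : Integrable h ((Pr.map W).prod ν) := by
    rw [← hjoint]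
    exact (integrable_map_measure hm.aestronglyMeasurable hpair).2 hi
  have e : ∫ ω, h (W ω, β ω) ∂Pr = ∫ z, h z ∂((Pr.map W).prod ν) := by
    rw [← hjoint, integral_map hpair hm.aestronglyMeasurable]
  rw [e, integral_prod _ hi', integral_eq_zero_of_ae]
  exact hC

end Independence

/-! ### Variance of averages of independent samples. -/

section Batch

variable {𝒵 E : Type*} [MeasurableSpace 𝒵] {P : Measure 𝒵} [IsProbabilityMeasure P]
  [NormedAddCommGroup E] [InnerProductSpace ℝ E] [CompleteSpace E]

/-- The variance of the average of `B` i.i.d. centred samples. -/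
theorem batch_average {B : ℕ} (hB : 1 ≤ B) {N : 𝒵 → E} (hN : Integrable N P)
    (hN0 : ∫ z, N z ∂P = 0) (hN2 : Integrable (fun z => ‖N z‖ ^ 2) P) {s : ℝ}
    (hs : ∫ z, ‖N z‖ ^ 2 ∂P ≤ s) :
    (Integrable (fun β : Fin B → 𝒵 => (1 / B : ℝ) • ∑ k, N (β k)) (Measure.pi fun _ => P) ∧
      ∫ β : Fin B → 𝒵, (1 / B : ℝ) • ∑ k, N (β k) ∂(Measure.pi fun _ => P) = 0) ∧
    Integrable (fun β : Fin B → 𝒵 => ‖(1 / B : ℝ) • ∑ k, N (β k)‖ ^ 2) (Measure.pi fun _ => P) ∧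
    ∫ β : Fin B → 𝒵, ‖(1 / B : ℝ) • ∑ k, N (β k)‖ ^ 2 ∂(Measure.pi fun _ => P) ≤ s / B := by
  have hBpos : (0 : ℝ) < B := by exact_mod_cast hB
  set ν : Measure (Fin B → 𝒵) := Measure.pi fun _ => P with hν
  have hmp : ∀ k : Fin B, MeasurePreserving (Function.eval k) ν P := fun k =>
    measurePreserving_eval (fun _ : Fin B => P) k
  have hint : ∀ k, Integrable (fun β : Fin B → 𝒵 => N (β k)) ν := fun k =>
    (hmp k).integrable_comp_of_integrable hN
  have hmean : ∀ k, ∫ β, N (β k) ∂ν = 0 := fun k => by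
    rw [← hN0, ← (hmp k).map_eq, integral_map (hmp k).measurable.aemeasurable]
    rw [(hmp k).map_eq]; exact hN.1
  have hint2 : ∀ k, Integrable (fun β : Fin B → 𝒵 => ‖N (β k)‖ ^ 2) ν := fun k =>
    (hmp k).integrable_comp_of_integrable hN2
  have hsq : ∀ k, ∫ β, ‖N (β k)‖ ^ 2 ∂ν ≤ s := fun k => by
    refine le_trans (le_of_eq ?_) hs
    rw [← (hmp k).map_eq, integral_map (hmp k).measurable.aemeasurable]
    rw [(hmp k).map_eq]; exact hN2.1
  have hind : ∀ j k, j ≠ k → IndepFun (fun β : Fin B → 𝒵 => β j) (fun β => β k) ν := fun j k hjk =>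
    (iIndepFun_pi (μ := fun _ : Fin B => P) (X := fun _ z => z) fun _ => aemeasurable_id).indepFun hjk
  borelize E
  -- Off-diagonal products vanish in mean by independence and centring; only the B diagonal terms
  -- survive against the factor 1/B².
  have hcross : ∀ j k, j ≠ k → Integrable (fun β : Fin B → 𝒵 => inner ℝ (N (β j)) (N (β k))) ν ∧
      ∫ β, inner ℝ (N (β j)) (N (β k)) ∂ν = 0 := by
    intro j k hjk
    have hNm : ∀ k : Fin B, AEMeasurable N (Measure.map (fun β : Fin B → 𝒵 => β k) ν) := fun k => by
      have := (hmp k).map_eq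
      change Measure.map (fun β : Fin B → 𝒵 => β k) ν = P at this
      rw [this]; exact hN.1.aemeasurable
    have hI : IndepFun (fun β : Fin B → 𝒵 => N (β j)) (fun β => N (β k)) ν :=
      (hind j k hjk).comp₀ (measurable_pi_apply j).aemeasurable (measurable_pi_apply k).aemeasurable
        (hNm j) (hNm k)
    refine ⟨hI.integrable_bilin (hint j) (hint k) (innerSL ℝ), ?_⟩
    have h2 := hI.integral_bilin (hint j) (hint k) (innerSL ℝ)
    rw [hmean j, map_zero] at h2
    exact h2
  have hexp : ∀ β : Fin B → 𝒵, ‖(1 / B : ℝ) • ∑ k, N (β k)‖ ^ 2 =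
      (1 / B : ℝ) ^ 2 * ∑ j, ∑ k, inner ℝ (N (β j)) (N (β k)) := fun β => by
    rw [norm_smul, mul_pow, Real.norm_eq_abs, sq_abs, ← real_inner_self_eq_norm_sq, sum_inner]
    simp only [inner_sum]
  have hpair : ∀ j k, Integrable (fun β : Fin B → 𝒵 => inner ℝ (N (β j)) (N (β k))) ν := by
    intro j k
    by_cases hjk : j = k
    · subst hjk
      simpa only [real_inner_self_eq_norm_sq] using hint2 j
    · exact (hcross j k hjk).1
  refine ⟨⟨(integrable_finsetSum _ fun k _ => hint k).smul _, ?_⟩, ?_, ?_⟩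
  · rw [integral_smul, integral_finsetSum _ fun k _ => hint k]
    simp [hmean]
  · simp only [hexp]
    exact (integrable_finsetSum _ fun j _ => integrable_finsetSum _ fun k _ => hpair j k).const_mul _
  · simp only [hexp]
    rw [integral_const_mul, integral_finsetSum _ fun j _ => integrable_finsetSum _ fun k _ => hpair j k]
    have hrow : ∀ j, ∫ β, ∑ k, inner ℝ (N (β j)) (N (β k)) ∂ν ≤ s := by
      intro j
      rw [integral_finsetSum _ fun k _ => hpair j k, Finset.sum_eq_single j]
      · simpa only [real_inner_self_eq_norm_sq] using hsq j
      · exact fun k _ hk => (hcross j k (Ne.symm hk)).2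
      · simp
    calc (1 / B : ℝ) ^ 2 * ∑ j, ∫ β, ∑ k, inner ℝ (N (β j)) (N (β k)) ∂ν
        ≤ (1 / B : ℝ) ^ 2 * ∑ _j : Fin B, s := by gcongr with j; exact hrow j
      _ = s / B := by
        rw [Finset.sum_const, Finset.card_univ, Fintype.card_fin, nsmul_eq_mul]
        field_simp

end Batch

/-! ### Sampling subsets without replacement. -/

section Subset

/-- Only the equality of the weights matters later; the value of c is never used, because
normalization and symmetry determine all that is needed. -/
theorem uniformOn_card_real {n S : ℕ} (hS : S ≤ n) :
    IsProbabilityMeasure (uniformOn {A : Finset (Fin n) | A.card = S}) ∧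
    ∃ c : ℝ, 0 ≤ c ∧ ∀ A : Finset (Fin n),
      (uniformOn {A : Finset (Fin n) | A.card = S}).real {A} = if A.card = S then c else 0 := by
  have hne : {A : Finset (Fin n) | A.card = S}.Nonempty := by
    obtain ⟨A, _, hA⟩ := Finset.exists_subset_card_eq (s := (Finset.univ : Finset (Fin n))) (n := S)
      (by simpa using hS)
    exact ⟨A, hA⟩
  refine ⟨isProbabilityMeasure_uniformOn (Set.toFinite _) hne,
    (Measure.count {A : Finset (Fin n) | A.card = S})⁻¹.toReal, ENNReal.toReal_nonneg, fun A => ?_⟩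
  rw [Measure.real, uniformOn, cond_apply (Set.toFinite _).measurableSet]
  split_ifs with h
  · have : {A : Finset (Fin n) | A.card = S} ∩ {A} = {A} := by
      rw [Set.inter_eq_right, Set.singleton_subset_iff]; exact h
    rw [this, Measure.count_singleton, mul_one]
  · have : {A : Finset (Fin n) | A.card = S} ∩ {A} = ∅ := by
      rw [Set.inter_singleton_eq_empty]; exact h
    rw [this]; simp

variable {n : ℕ} {pA : Finset (Fin n) → ℝ} {c : ℝ} {S : ℕ}

/-- Expectation of a function of a random subset is invariant under relabelling. -/
theorem sum_subset_perm (hp : ∀ A, pA A = if A.card = S then c else 0) (π : Equiv.Perm (Fin n))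
    (φ : Finset (Fin n) → ℝ) : ∑ A, pA A * φ (A.map π.toEmbedding) = ∑ A, pA A * φ A := by
  refine Fintype.sum_equiv (Equiv.finsetCongr π) _ _ fun A => ?_
  simp [hp, Equiv.finsetCongr]

/-- All inclusion probabilities agree by exchanging labels, and they add up to the expected
cardinality S. -/
theorem sum_subset_mem (hp : ∀ A, pA A = if A.card = S then c else 0) (h1 : ∑ A, pA A = 1)
    (i : Fin n) : ∑ A, pA A * (if i ∈ A then 1 else 0) = (S : ℝ) / n := by
  have hn : (0 : ℝ) < n := by
    have : 0 < n := i.pos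
    exact_mod_cast this
  have hall : ∀ j, ∑ A, pA A * (if j ∈ A then (1 : ℝ) else 0) =
      ∑ A, pA A * (if i ∈ A then 1 else 0) := by
    intro j
    rw [← sum_subset_perm hp (Equiv.swap i j)]
    refine Finset.sum_congr rfl fun A _ => ?_
    congr 2
    rw [eq_iff_iff]
    constructor
    · intro h
      obtain ⟨k, hk, hkj⟩ := Finset.mem_map.1 h
      have : k = i := by
        have := congrArg (Equiv.swap i j) hkj
        simpa using this
      exact this ▸ hk
    · intro h
      exact Finset.mem_map.2 ⟨i, h, by simp⟩
  have hsum : ∑ j, ∑ A, pA A * (if j ∈ A then (1 : ℝ) else 0) = S := by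
    rw [Finset.sum_comm]
    have : ∀ A, ∑ j, pA A * (if j ∈ A then (1 : ℝ) else 0) = pA A * S := by
      intro A
      rw [← Finset.mul_sum, Finset.sum_boole, hp]
      split_ifs with h
      · congr 1
        simp [h]
      · simp
    simp only [this, ← Finset.sum_mul, h1, one_mul]
  simp only [hall, Finset.sum_const, Finset.card_univ, Fintype.card_fin, nsmul_eq_mul] at hsum
  rw [eq_div_iff hn.ne']
  linarith

/-- The variance of sampling without replacement is at most that of sampling with replacement. -/
theorem sum_subset_norm_sq_le {E : Type*} [NormedAddCommGroup E] [InnerProductSpace ℝ E]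
    (hc : 0 ≤ c) (hp : ∀ A, pA A = if A.card = S then c else 0) (h1 : ∑ A, pA A = 1)
    (e : Fin n → E) (he : ∑ i, e i = 0) :
    ∑ A, pA A * ‖∑ i ∈ A, e i‖ ^ 2 ≤ (S : ℝ) / n * ∑ i, ‖e i‖ ^ 2 := by
  set q : Fin n → Fin n → ℝ := fun i j => ∑ A, pA A * (if i ∈ A ∧ j ∈ A then 1 else 0) with hq
  have hq0 : ∀ i j, 0 ≤ q i j := fun i j => Finset.sum_nonneg fun A _ => by
    rw [hp]; split_ifs <;> simp [hc]
  have hperm : ∀ (π : Equiv.Perm (Fin n)) i j, q (π i) (π j) = q i j := by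
    intro π i j
    simp only [hq]
    rw [← sum_subset_perm hp π]
    simp
  have hexp : ∑ A, pA A * ‖∑ i ∈ A, e i‖ ^ 2 = ∑ i, ∑ j, q i j * inner ℝ (e i) (e j) := by
    have h2 : ∀ A, ‖∑ i ∈ A, e i‖ ^ 2 =
        ∑ i, ∑ j, (if i ∈ A ∧ j ∈ A then (1 : ℝ) else 0) * inner ℝ (e i) (e j) := by
      intro A
      rw [← real_inner_self_eq_norm_sq, sum_inner, ← Finset.sum_filter_add_sum_filter_not Finset.univ (· ∈ A)]
      rw [Finset.sum_eq_zero (s := Finset.univ.filter fun x => ¬ x ∈ A), add_zero]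
      · rw [Finset.filter_univ_mem]
        refine Finset.sum_congr rfl fun i hi => ?_
        rw [inner_sum, ← Finset.sum_filter_add_sum_filter_not Finset.univ (· ∈ A)]
        rw [Finset.sum_eq_zero (s := Finset.univ.filter fun x => ¬ x ∈ A), add_zero]
        · rw [Finset.filter_univ_mem]
          refine Finset.sum_congr rfl fun j hj => ?_
          simp [hi, hj]
        · intro j hj
          simp [(Finset.mem_filter.1 hj).2]
      · intro i hi
        refine Finset.sum_eq_zero fun j _ => ?_
        simp [(Finset.mem_filter.1 hi).2]
    simp only [h2, hq, Finset.mul_sum, Finset.sum_mul]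
    rw [Finset.sum_comm]
    refine Finset.sum_congr rfl fun i _ => ?_
    rw [Finset.sum_comm]
    refine Finset.sum_congr rfl fun j _ => Finset.sum_congr rfl fun A _ => ?_
    ring
  -- Two transpositions carry any pair of distinct labels to any other. Without such a pair the
  -- value of r is irrelevant.
  have hconst : ∃ r, 0 ≤ r ∧ ∀ i j, i ≠ j → q i j = r := by
    by_cases hex : ∃ i j : Fin n, i ≠ j
    · obtain ⟨i₀, j₀, h0⟩ := hex
      refine ⟨q i₀ j₀, hq0 _ _, fun i j hij => ?_⟩
      set j' := Equiv.swap i₀ i j₀ with hj'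
      have hne : i ≠ j' := by
        intro h
        apply h0
        have := congrArg (Equiv.swap i₀ i) h
        simpa [hj'] using this
      rw [← hperm (Equiv.swap i₀ i) i₀ j₀, ← hj', Equiv.swap_apply_left, ← hperm (Equiv.swap j' j) i j',
        Equiv.swap_apply_left, Equiv.swap_apply_of_ne_of_ne hne hij]
    · push Not at hex
      exact ⟨0, le_rfl, fun i j hij => absurd (hex i j) hij⟩
  obtain ⟨r, hr, hqr⟩ := hconst
  have hdiag : ∀ i, q i i = (S : ℝ) / n := fun i => by
    simp only [hq, and_self]
    exact sum_subset_mem hp h1 i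
  -- Subtracting r from every entry of the row is free because the vectors sum to zero; only the
  -- diagonal is left. Since r ≥ 0, dropping it gives the with-replacement bound.
  have hrow : ∀ i, ∑ j, q i j * inner ℝ (e i) (e j) = ((S : ℝ) / n - r) * ‖e i‖ ^ 2 := by
    intro i
    have h3 : ∑ j, r * inner ℝ (e i) (e j) = 0 := by
      rw [← Finset.mul_sum, ← inner_sum, he, inner_zero_right, mul_zero]
    have h4 : ∑ j, (q i j - r) * inner ℝ (e i) (e j) = ((S : ℝ) / n - r) * ‖e i‖ ^ 2 := by
      rw [Finset.sum_eq_single i]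
      · rw [hdiag, real_inner_self_eq_norm_sq]
      · intro j _ hj
        rw [hqr i j (Ne.symm hj), sub_self, zero_mul]
      · simp
    rw [← h4, ← add_zero (∑ j, (q i j - r) * _), ← h3, ← Finset.sum_add_distrib]
    exact Finset.sum_congr rfl fun j _ => by ring
  rw [hexp, Finset.mul_sum]
  refine Finset.sum_le_sum fun i _ => ?_
  rw [hrow]
  nlinarith [mul_nonneg hr (sq_nonneg ‖e i‖)]

variable {Ω 𝓧 : Type*} [MeasurableSpace Ω] [MeasurableSpace 𝓧] {Pr : Measure Ω}
  [IsProbabilityMeasure Pr]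

/-- Disintegration of an expectation over an independent random subset. -/
theorem integral_subset {W : Ω → 𝓧} {σ : Ω → Finset (Fin n)} {ν : Measure (Finset (Fin n))}
    (hσ : AEMeasurable σ Pr) (hlaw : Pr.map σ = ν) (hind : IndepFun W σ Pr)
    {φ : Finset (Fin n) → 𝓧 → ℝ} (hm : ∀ A, Measurable (φ A))
    (hi : ∀ A, Integrable (fun ω => φ A (W ω)) Pr) :
    Integrable (fun ω => φ (σ ω) (W ω)) Pr ∧
      ∫ ω, φ (σ ω) (W ω) ∂Pr = ∑ A, ν.real {A} * ∫ ω, φ A (W ω) ∂Pr := by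
  classical
  have e : ∀ ω, φ (σ ω) (W ω) = ∑ A, φ A (W ω) * ({A} : Set (Finset (Fin n))).indicator 1 (σ ω) := by
    intro ω
    rw [Finset.sum_eq_single (σ ω)]
    · simp
    · intro A _ hA
      rw [Set.indicator_of_notMem (by simpa using hA.symm), mul_zero]
    · simp
  have hg : ∀ A, Measurable (({A} : Set (Finset (Fin n))).indicator (1 : Finset (Fin n) → ℝ)) :=
    fun A => measurable_one.indicator (measurableSet_singleton A)
  have hgi : ∀ A, Integrable (fun ω => ({A} : Set (Finset (Fin n))).indicator (1 : Finset (Fin n) → ℝ) (σ ω)) Pr :=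
    fun A => by
      refine Integrable.of_bound ((hg A).comp_aemeasurable hσ).aestronglyMeasurable 1
        (Filter.Eventually.of_forall fun ω => ?_)
      by_cases h : σ ω ∈ ({A} : Set (Finset (Fin n))) <;> simp [Set.indicator, h]
  have hI : ∀ A, IndepFun (fun ω => φ A (W ω))
      (fun ω => ({A} : Set (Finset (Fin n))).indicator (1 : Finset (Fin n) → ℝ) (σ ω)) Pr :=
    fun A => hind.comp (hm A) (hg A)
  have hint : ∀ A, Integrable
      (fun ω => φ A (W ω) * ({A} : Set (Finset (Fin n))).indicator (1 : Finset (Fin n) → ℝ) (σ ω)) Pr :=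
    fun A => (hI A).integrable_mul (hi A) (hgi A)
  simp only [e]
  refine ⟨integrable_finsetSum _ fun A _ => hint A, ?_⟩
  rw [integral_finsetSum _ fun A _ => hint A]
  refine Finset.sum_congr rfl fun A _ => ?_
  rw [(hI A).integral_fun_mul_eq_mul_integral (hi A).1 (hgi A).1, mul_comm]
  congr 1
  rw [← hlaw, ← integral_map hσ (hg A).aestronglyMeasurable,
    integral_indicator_one (measurableSet_singleton A)]

end Subset

/-! ### Noise of the value and derivative oracles. -/

/-- The Riesz isomorphism over `ℝ` as a linear isometry. -/
theorem exists_riesz (k : ℕ) : ∃ R : StrongDual ℝ (Primal k) ≃ₗᵢ[ℝ] Primal k,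
    ∀ ℓ v, inner ℝ (R ℓ) v = ℓ v := by
  let T := (InnerProductSpace.toDual ℝ (Primal k)).symm
  refine ⟨⟨⟨⟨⟨T, fun a b => T.map_add a b⟩, fun c a => ?_⟩, T.symm, T.left_inv, T.right_inv⟩,
    fun a => T.norm_map a⟩, fun ℓ v => ?_⟩
  · simp
  · exact InnerProductSpace.toDual_symm_apply

section Oracle

variable {Ω 𝓧 𝒵 : Type*} [MeasurableSpace Ω] [MeasurableSpace 𝓧] [MeasurableSpace 𝒵]
  {Pr : Measure Ω} [IsProbabilityMeasure Pr] {P : Measure 𝒵} [IsProbabilityMeasure P] {B k : ℕ}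
  {W : Ω → 𝓧} {β : Ω → Fin B → 𝒵} {N : 𝓧 → 𝒵 → Primal k} {s : ℝ}

/-- Batch averages of a centred oracle evaluated at an independent random point. -/
theorem oracle_average (hB : 1 ≤ B) (hW : AEMeasurable W Pr) (hβ : AEMeasurable β Pr)
    (hlaw : Pr.map β = Measure.pi fun _ => P) (hind : IndepFun W β Pr)
    (hm : Measurable (Function.uncurry N))
    (hN : ∀ᵐ x ∂(Pr.map W), Integrable (N x) P ∧ ∫ z, N x z ∂P = 0 ∧
      Integrable (fun z => ‖N x z‖ ^ 2) P ∧ ∫ z, ‖N x z‖ ^ 2 ∂P ≤ s) :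
    (Integrable (fun ω => ‖(1 / B : ℝ) • ∑ j, N (W ω) (β ω j)‖ ^ 2) Pr ∧
      ∫ ω, ‖(1 / B : ℝ) • ∑ j, N (W ω) (β ω j)‖ ^ 2 ∂Pr ≤ s / B) ∧
    ∀ v : 𝓧 → Primal k, Measurable v → Integrable (fun ω => ‖v (W ω)‖ ^ 2) Pr →
      Integrable (fun ω => inner ℝ (v (W ω)) ((1 / B : ℝ) • ∑ j, N (W ω) (β ω j))) Pr ∧
      ∫ ω, inner ℝ (v (W ω)) ((1 / B : ℝ) • ∑ j, N (W ω) (β ω j)) ∂Pr = 0 := by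
  have hA : Measurable fun z : 𝓧 × (Fin B → 𝒵) => (1 / B : ℝ) • ∑ j, N z.1 (z.2 j) := by
    have hj : ∀ j, Measurable fun z : 𝓧 × (Fin B → 𝒵) => N z.1 (z.2 j) := fun j =>
      hm.comp (measurable_fst.prodMk ((measurable_pi_apply j).comp measurable_snd))
    exact (Finset.measurable_fun_sum _ fun j _ => hj j).const_smul (1 / B : ℝ)
  have hav : ∀ᵐ x ∂(Pr.map W), _ := hN.mono fun x hx => batch_average hB hx.1 hx.2.1 hx.2.2.1 hx.2.2.2
  have h1 := integrable_and_integral_le_of_indepFun hW hβ hlaw hind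
    (h := fun z : 𝓧 × (Fin B → 𝒵) => ‖(1 / B : ℝ) • ∑ j, N z.1 (z.2 j)‖ ^ 2) (hA.norm.pow_const 2)
    (fun z => by positivity) (hav.mono fun x hx => hx.2)
  refine ⟨h1, fun v hv hvi => ?_⟩
  have hpm : Measurable fun z : 𝓧 × (Fin B → 𝒵) =>
      (inner ℝ (v z.1) ((1 / B : ℝ) • ∑ j, N z.1 (z.2 j)) : ℝ) :=
    (hv.comp measurable_fst).inner hA
  have hi : Integrable (fun ω => (inner ℝ (v (W ω)) ((1 / B : ℝ) • ∑ j, N (W ω) (β ω j)) : ℝ)) Pr := by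
    refine Integrable.mono' (hvi.add h1.1) (hpm.comp_aemeasurable (hW.prodMk hβ)).aestronglyMeasurable
      (Filter.Eventually.of_forall fun ω => ?_)
    refine (norm_inner_le_norm _ _).trans ?_
    simp only [Pi.add_apply]
    nlinarith [sq_nonneg (‖v (W ω)‖ - ‖(1 / B : ℝ) • ∑ j, N (W ω) (β ω j)‖),
      sq_nonneg ‖v (W ω)‖, sq_nonneg ‖(1 / B : ℝ) • ∑ j, N (W ω) (β ω j)‖]
  refine ⟨hi, integral_eq_zero_of_indepFun hW hβ hlaw hind hpm hi ?_⟩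
  filter_upwards [hav] with x hx
  have h2 := integral_inner (𝕜 := ℝ) hx.1.1 (v x)
  rw [hx.1.2, inner_zero_right] at h2
  exact h2

end Oracle

section Noise

variable {V : Type u} [NormedAddCommGroup V] [NormedSpace ℝ V] {d n m : ℕ}
  {Z : Fin n → Type w} [∀ i, MeasurableSpace (Z i)] {p : Problem V d n Z}
  {b : Module.Basis (Fin m) ℝ V} {μ Cf Lf Cg σ₀ σ₁ δ : ℝ}
  {Ω : Type v} {𝓧 : Type*} [MeasurableSpace Ω] [MeasurableSpace 𝓧]
  {Pr : Measure Ω} [IsProbabilityMeasure Pr] {B k : ℕ} {W : Ω → 𝓧} {i : Fin n} {β : Ω → Fin B → Z i}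

namespace Problem.Assumptions

theorem measurable_innerD (h : p.Assumptions b μ Cf Lf Cg σ₀ σ₁ δ) (i : Fin n) :
    Measurable (p.innerD i) := by
  have := h.prob i
  exact ((h.Dg_meas i).integral_prod_right (f := p.Dg i)).measurable

theorem measurable_inner [MeasurableSpace V] [BorelSpace V] (h : p.Assumptions b μ Cf Lf Cg σ₀ σ₁ δ) (i : Fin n) :
    Measurable (p.inner i) := by
  have := h.prob i
  exact ((h.g_meas i).integral_prod_right (f := p.g i)).measurable

variable [FiniteDimensional ℝ V]

theorem measurable_batchD (h : p.Assumptions b μ Cf Lf Cg σ₀ σ₁ δ) (i : Fin n) :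
    Measurable fun z : Primal d × (Fin B → Z i) => p.batchD i z.1 z.2 := by
  have hj : ∀ j, Measurable fun z : Primal d × (Fin B → Z i) => p.Dg i z.1 (z.2 j) := fun j =>
    (h.Dg_meas i).measurable.comp
      (measurable_fst.prodMk ((measurable_pi_apply j).comp measurable_snd))
  exact (Finset.measurable_fun_sum _ fun j _ => hj j).const_smul (1 / B : ℝ)

/-- Composing with a dual point fixed before the batch turns operator noise into functionals on
Euclidean space. There Riesz gives the Hilbert structure needed for a 1/B variance, and no norm
comparison is lost. -/
theorem deriv_noise (h : p.Assumptions b μ Cf Lf Cg σ₀ σ₁ δ) (hB : 1 ≤ B)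
    (hW : AEMeasurable W Pr) (hβ : AEMeasurable β Pr)
    (hlaw : Pr.map β = Measure.pi fun _ => p.P i) (hind : IndepFun W β Pr)
    {xf : 𝓧 → Primal d} (hxf : Measurable xf) (hX : ∀ ω, xf (W ω) ∈ p.X)
    {uf : 𝓧 → StrongDual ℝ V} (huf : Measurable uf) {C : ℝ} (hC : ∀ ω, ‖uf (W ω)‖ ≤ C) :
    (Integrable (fun ω => ‖(uf (W ω)).comp (p.batchD i (xf (W ω)) (β ω) - p.innerD i (xf (W ω)))‖ ^ 2) Pr ∧
      ∫ ω, ‖(uf (W ω)).comp (p.batchD i (xf (W ω)) (β ω) - p.innerD i (xf (W ω)))‖ ^ 2 ∂Pr ≤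
        C ^ 2 * σ₁ ^ 2 / B) ∧
    ∀ v : 𝓧 → Primal d, Measurable v → Integrable (fun ω => ‖v (W ω)‖ ^ 2) Pr →
      Integrable (fun ω => (uf (W ω)).comp
        (p.batchD i (xf (W ω)) (β ω) - p.innerD i (xf (W ω))) (v (W ω))) Pr ∧
      ∫ ω, (uf (W ω)).comp
        (p.batchD i (xf (W ω)) (β ω) - p.innerD i (xf (W ω))) (v (W ω)) ∂Pr = 0 := by
  have := h.prob i
  have hBpos : (0 : ℝ) < B := by exact_mod_cast hB
  obtain ⟨R, hR⟩ := exists_riesz d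
  set N : 𝓧 → Z i → Primal d := fun x z => R ((uf x).comp (p.Dg i (xf x) z - p.innerD i (xf x))) with hN
  have hNm : Measurable (Function.uncurry N) := by
    have hc : Continuous fun w : StrongDual ℝ V × (Primal d →L[ℝ] V) => R (w.1.comp w.2) :=
      R.continuous.comp (by fun_prop)
    refine hc.measurable.comp ((huf.comp measurable_fst).prodMk (Measurable.sub ?_ ?_))
    · exact (h.Dg_meas i).measurable.comp ((hxf.comp measurable_fst).prodMk measurable_snd)
    · exact (h.measurable_innerD i).comp (hxf.comp measurable_fst)
  have hXae : ∀ᵐ x ∂(Pr.map W), xf x ∈ p.X := by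
    rw [ae_map_iff hW (hxf h.closed.measurableSet)]
    exact Filter.Eventually.of_forall hX
  have hCae : ∀ᵐ x ∂(Pr.map W), ‖uf x‖ ≤ C := by
    rw [ae_map_iff hW (measurableSet_le huf.norm measurable_const)]
    exact Filter.Eventually.of_forall hC
  have key := oracle_average (N := N) (s := C ^ 2 * σ₁ ^ 2) hB hW hβ hlaw hind hNm <| by
    filter_upwards [hXae, hCae] with x hx hxC
    have hsub : Integrable (fun z => p.Dg i (xf x) z - p.innerD i (xf x)) (p.P i) :=
      (h.Dg_int i _ hx).sub (integrable_const _)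
    set T : (Primal d →L[ℝ] V) →L[ℝ] Primal d :=
      (R : StrongDual ℝ (Primal d) →L[ℝ] Primal d).comp
        (ContinuousLinearMap.compL ℝ (Primal d) V ℝ (uf x)) with hT
    have hTN : ∀ z, N x z = T (p.Dg i (xf x) z - p.innerD i (xf x)) := fun z => rfl
    have hNi : Integrable (N x) (p.P i) := T.integrable_comp hsub
    have hle : ∀ z, ‖N x z‖ ^ 2 ≤ C ^ 2 * ‖p.innerD i (xf x) - p.Dg i (xf x) z‖ ^ 2 := by
      intro z
      rw [← mul_pow, norm_sub_rev (p.innerD i (xf x))]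
      simp only [hN, R.norm_map]
      refine pow_le_pow_left₀ (norm_nonneg _) ?_ 2
      exact (ContinuousLinearMap.opNorm_comp_le _ _).trans
        (mul_le_mul_of_nonneg_right hxC (norm_nonneg _))
    have hv := h.var_Dg i _ hx
    have hN2 : Integrable (fun z => ‖N x z‖ ^ 2) (p.P i) := by
      refine Integrable.mono' (hv.1.const_mul (C ^ 2))
        (hNi.1.norm.pow 2) (Filter.Eventually.of_forall fun z => ?_)
      rw [Real.norm_of_nonneg (by positivity)]
      exact hle z
    refine ⟨hNi, ?_, hN2, ?_⟩
    · have h1 := T.integral_comp_comm hsub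
      rw [integral_sub (h.Dg_int i _ hx) (integrable_const _), integral_const] at h1
      simp only [probReal_univ, one_smul] at h1
      rw [show ∫ z, p.Dg i (xf x) z ∂(p.P i) = p.innerD i (xf x) from rfl, sub_self, map_zero] at h1
      exact h1
    · calc ∫ z, ‖N x z‖ ^ 2 ∂(p.P i)
          ≤ ∫ z, C ^ 2 * ‖p.innerD i (xf x) - p.Dg i (xf x) z‖ ^ 2 ∂(p.P i) :=
            integral_mono hN2 (hv.1.const_mul _) hle
        _ ≤ _ := by
            rw [integral_const_mul]
            gcongr
            exact hv.2
  have havg : ∀ ω, (1 / B : ℝ) • ∑ j, N (W ω) (β ω j) =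
      R ((uf (W ω)).comp (p.batchD i (xf (W ω)) (β ω) - p.innerD i (xf (W ω)))) := fun ω => by
    simp only [hN, Problem.batchD, ← map_sum, ← map_smul]
    congr 1
    ext v
    simp only [smul_apply, sum_apply, ContinuousLinearMap.comp_apply, sub_apply, map_sub, map_smul,
      map_sum, Finset.sum_sub_distrib, smul_sub]
    congr 1
    rw [Finset.sum_const, Finset.card_univ, Fintype.card_fin, nsmul_eq_mul, smul_eq_mul, ← mul_assoc,
      one_div_mul_cancel hBpos.ne', one_mul]
  simp only [havg, R.norm_map] at key
  refine ⟨key.1, fun v hv hvi => ?_⟩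
  have h3 := key.2 v hv hvi
  have hR' : ∀ ℓ v, Inner.inner ℝ v (R ℓ) = ℓ v := fun ℓ v => by
    rw [real_inner_comm, hR]
  simpa only [hR'] using h3

variable [MeasurableSpace V] [BorelSpace V]

theorem measurable_batch (h : p.Assumptions b μ Cf Lf Cg σ₀ σ₁ δ) (i : Fin n) :
    Measurable fun z : Primal d × (Fin B → Z i) => p.batch i z.1 z.2 := by
  have hj : ∀ j, Measurable fun z : Primal d × (Fin B → Z i) => p.g i z.1 (z.2 j) := fun j =>
    (h.g_meas i).measurable.comp
      (measurable_fst.prodMk ((measurable_pi_apply j).comp measurable_snd))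
  exact (Finset.measurable_fun_sum _ fun j _ => hj j).const_smul (1 / B : ℝ)

/-- The norm of V need not be Euclidean, so the 1/B variance reduction is carried out after
transport by L. This costs the squared norms of L and its inverse, a constant of the space. -/
theorem value_noise (h : p.Assumptions b μ Cf Lf Cg σ₀ σ₁ δ) (L : V ≃L[ℝ] Primal k) (hB : 1 ≤ B)
    (hW : AEMeasurable W Pr) (hβ : AEMeasurable β Pr)
    (hlaw : Pr.map β = Measure.pi fun _ => p.P i) (hind : IndepFun W β Pr)
    {xf : 𝓧 → Primal d} (hxf : Measurable xf) (hX : ∀ ω, xf (W ω) ∈ p.X) :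
    (Integrable (fun ω => ‖p.batch i (xf (W ω)) (β ω) - p.inner i (xf (W ω))‖ ^ 2) Pr ∧
      ∫ ω, ‖p.batch i (xf (W ω)) (β ω) - p.inner i (xf (W ω))‖ ^ 2 ∂Pr ≤
        ‖(L.symm : Primal k →L[ℝ] V)‖ ^ 2 * (‖(L : V →L[ℝ] Primal k)‖ ^ 2 * σ₀ ^ 2 / B)) ∧
    ∀ (uf : 𝓧 → StrongDual ℝ V) (C : ℝ), Measurable uf → (∀ ω, ‖uf (W ω)‖ ≤ C) →
      Integrable (fun ω => uf (W ω) (p.batch i (xf (W ω)) (β ω) - p.inner i (xf (W ω)))) Pr ∧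
      ∫ ω, uf (W ω) (p.batch i (xf (W ω)) (β ω) - p.inner i (xf (W ω))) ∂Pr = 0 := by
  have := h.prob i
  have hBpos : (0 : ℝ) < B := by exact_mod_cast hB
  set N : 𝓧 → Z i → Primal k := fun x z => L (p.g i (xf x) z - p.inner i (xf x)) with hN
  have hNm : Measurable (Function.uncurry N) := by
    refine L.continuous.measurable.comp (Measurable.sub ?_ ?_)
    · exact (h.g_meas i).measurable.comp ((hxf.comp measurable_fst).prodMk measurable_snd)
    · exact (h.measurable_inner i).comp (hxf.comp measurable_fst)
  have hXae : ∀ᵐ x ∂(Pr.map W), xf x ∈ p.X := by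
    rw [ae_map_iff hW (hxf h.closed.measurableSet)]
    exact Filter.Eventually.of_forall hX
  have key := oracle_average (N := N) (s := ‖(L : V →L[ℝ] Primal k)‖ ^ 2 * σ₀ ^ 2) hB hW hβ hlaw hind hNm <| by
    filter_upwards [hXae] with x hx
    have hsub : Integrable (fun z => p.g i (xf x) z - p.inner i (xf x)) (p.P i) :=
      (h.g_int i _ hx).sub (integrable_const _)
    have hNi : Integrable (N x) (p.P i) := (L : V →L[ℝ] Primal k).integrable_comp hsub
    have hle : ∀ z, ‖N x z‖ ^ 2 ≤ ‖(L : V →L[ℝ] Primal k)‖ ^ 2 * ‖p.inner i (xf x) - p.g i (xf x) z‖ ^ 2 := by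
      intro z
      rw [← mul_pow, norm_sub_rev]
      exact pow_le_pow_left₀ (norm_nonneg _) ((L : V →L[ℝ] Primal k).le_opNorm _) 2
    have hv := h.var_g i _ hx
    have hN2 : Integrable (fun z => ‖N x z‖ ^ 2) (p.P i) := by
      refine Integrable.mono' (hv.1.const_mul (‖(L : V →L[ℝ] Primal k)‖ ^ 2))
        (hNi.1.norm.pow 2) (Filter.Eventually.of_forall fun z => ?_)
      rw [Real.norm_of_nonneg (by positivity)]
      exact hle z
    refine ⟨hNi, ?_, hN2, ?_⟩
    · have h1 := (L : V →L[ℝ] Primal k).integral_comp_comm hsub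
      rw [integral_sub (h.g_int i _ hx) (integrable_const _), integral_const] at h1
      simp only [probReal_univ, one_smul] at h1
      rw [show ∫ z, p.g i (xf x) z ∂(p.P i) = p.inner i (xf x) from rfl, sub_self, map_zero] at h1
      exact h1
    · calc ∫ z, ‖N x z‖ ^ 2 ∂(p.P i)
          ≤ ∫ z, ‖(L : V →L[ℝ] Primal k)‖ ^ 2 * ‖p.inner i (xf x) - p.g i (xf x) z‖ ^ 2 ∂(p.P i) :=
            integral_mono hN2 (hv.1.const_mul _) hle
        _ ≤ _ := by
            rw [integral_const_mul]
            gcongr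
            exact hv.2
  have havg : ∀ ω, (1 / B : ℝ) • ∑ j, N (W ω) (β ω j) =
      L (p.batch i (xf (W ω)) (β ω) - p.inner i (xf (W ω))) := fun ω => by
    simp only [hN, Problem.batch, ← map_sum, ← map_smul, Finset.sum_sub_distrib, smul_sub]
    congr 2
    rw [Finset.sum_const, Finset.card_univ, Fintype.card_fin, ← Nat.cast_smul_eq_nsmul ℝ, smul_smul,
      one_div_mul_cancel hBpos.ne', one_smul]
  simp only [havg] at key
  have hmeasN : AEMeasurable (fun ω => p.batch i (xf (W ω)) (β ω) - p.inner i (xf (W ω))) Pr := by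
    refine AEMeasurable.sub ?_ ((h.measurable_inner i).comp_aemeasurable (hxf.comp_aemeasurable hW))
    exact (h.measurable_batch i).comp_aemeasurable ((hxf.comp_aemeasurable hW).prodMk hβ)
  have hle : ∀ ω, ‖p.batch i (xf (W ω)) (β ω) - p.inner i (xf (W ω))‖ ^ 2 ≤
      ‖(L.symm : Primal k →L[ℝ] V)‖ ^ 2 *
        ‖L (p.batch i (xf (W ω)) (β ω) - p.inner i (xf (W ω)))‖ ^ 2 := fun ω => by
    rw [← mul_pow]
    refine pow_le_pow_left₀ (norm_nonneg _) ?_ 2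
    have := (L.symm : Primal k →L[ℝ] V).le_opNorm
      (L (p.batch i (xf (W ω)) (β ω) - p.inner i (xf (W ω))))
    simpa using this
  have hint : Integrable (fun ω => ‖p.batch i (xf (W ω)) (β ω) - p.inner i (xf (W ω))‖ ^ 2) Pr := by
    refine Integrable.mono' (key.1.1.const_mul (‖(L.symm : Primal k →L[ℝ] V)‖ ^ 2)) (hmeasN.norm.pow_const 2).aestronglyMeasurable
      (Filter.Eventually.of_forall fun ω => ?_)
    rw [Real.norm_of_nonneg (by positivity)]
    exact hle ω
  refine ⟨⟨hint, ?_⟩, fun uf C huf hC => ?_⟩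
  · refine (integral_mono hint (key.1.1.const_mul _) hle).trans ?_
    rw [integral_const_mul]
    gcongr
    exact key.1.2
  · obtain ⟨R, hR⟩ := exists_riesz k
    have hcomp : Measurable fun x => R ((uf x).comp (L.symm : Primal k →L[ℝ] V)) := by
      have hc : Continuous fun y : StrongDual ℝ V => R (y.comp (L.symm : Primal k →L[ℝ] V)) :=
        R.continuous.comp (by fun_prop)
      exact hc.measurable.comp huf
    -- The Riesz vector of u ∘ L⁻¹, paired with L of the noise, returns u of the noise.
    have h3 := key.2 (fun x => R ((uf x).comp (L.symm : Primal k →L[ℝ] V))) hcomp <| by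
      refine Integrable.of_bound
        ((hcomp.norm.pow_const 2).comp_aemeasurable hW).aestronglyMeasurable
        ((C * ‖(L.symm : Primal k →L[ℝ] V)‖) ^ 2) (Filter.Eventually.of_forall fun ω => ?_)
      rw [Real.norm_of_nonneg (by positivity), R.norm_map]
      refine pow_le_pow_left₀ (norm_nonneg _) ?_ 2
      exact (ContinuousLinearMap.opNorm_comp_le _ _).trans
        (mul_le_mul_of_nonneg_right (hC ω) (norm_nonneg _))
    simpa [hR] using h3

end Problem.Assumptions

end Noise

/-! ### Expectations of sums over the random subset. -/

section SubsetSum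

variable {n : ℕ} {c : ℝ} {S : ℕ} {Ω 𝓧 : Type*} [MeasurableSpace Ω] [MeasurableSpace 𝓧]
  {Pr : Measure Ω} {W : Ω → 𝓧} {σ : Ω → Finset (Fin n)}

theorem sum_real_singleton_eq_one {α : Type*} [Fintype α] [MeasurableSpace α]
    [MeasurableSingletonClass α] (ν : Measure α) [IsProbabilityMeasure ν] :
    ∑ a, ν.real {a} = 1 := by
  have := sum_measureReal_singleton (μ := ν) (Finset.univ : Finset α)
  rw [this, Finset.coe_univ, probReal_univ]

/-- The sampling hypothesis fixes only the law of the draw, so the cardinality is S almost surely,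
not everywhere. -/
theorem ae_card_eq (hS : S ≤ n) (hσ : AEMeasurable σ Pr)
    (hlaw : Pr.map σ = uniformOn {A : Finset (Fin n) | A.card = S}) :
    ∀ᵐ ω ∂Pr, (σ ω).card = S := by
  obtain ⟨hprob, -⟩ := uniformOn_card_real hS
  have h1 : ∀ᵐ A ∂(Pr.map σ), A ∈ {A : Finset (Fin n) | A.card = S} := by
    rw [hlaw, uniformOn]
    exact ae_cond_mem (Set.toFinite _).measurableSet
  exact ae_of_ae_map hσ h1

variable [IsProbabilityMeasure Pr]

theorem integral_subset_sum (hS : S ≤ n) (hσ : AEMeasurable σ Pr)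
    (hlaw : Pr.map σ = uniformOn {A : Finset (Fin n) | A.card = S}) (hind : IndepFun W σ Pr)
    {ε : Fin n → 𝓧 → ℝ} (hm : ∀ i, Measurable (ε i))
    (hi : ∀ i, Integrable (fun ω => ε i (W ω)) Pr) :
    Integrable (fun ω => ∑ i ∈ σ ω, ε i (W ω)) Pr ∧
      ∫ ω, ∑ i ∈ σ ω, ε i (W ω) ∂Pr = (S : ℝ) / n * ∑ i, ∫ ω, ε i (W ω) ∂Pr := by
  obtain ⟨hprob, c, -, hp⟩ := uniformOn_card_real hS
  have h1 := integral_subset hσ hlaw hind (φ := fun A w => ∑ i ∈ A, ε i w)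
    (fun A => Finset.measurable_fun_sum _ fun i _ => hm i)
    (fun A => integrable_finsetSum _ fun i _ => hi i)
  refine ⟨h1.1, h1.2.trans ?_⟩
  have h2 : ∀ A : Finset (Fin n), ∫ ω, ∑ i ∈ A, ε i (W ω) ∂Pr =
      ∑ i, (if i ∈ A then 1 else 0) * ∫ ω, ε i (W ω) ∂Pr := fun A => by
    rw [integral_finsetSum _ fun i _ => hi i]
    simp
  simp only [h2, Finset.mul_sum]
  rw [Finset.sum_comm]
  refine Finset.sum_congr rfl fun i _ => ?_
  rw [← sum_subset_mem hp (sum_real_singleton_eq_one _) i, Finset.sum_mul]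
  exact Finset.sum_congr rfl fun A _ => by ring

/-- The variance of the average over an independent random subset. -/
theorem integral_subset_norm_sq_le {k : ℕ} (hS1 : 1 ≤ S) (hS : S ≤ n) (hσ : AEMeasurable σ Pr)
    (hlaw : Pr.map σ = uniformOn {A : Finset (Fin n) | A.card = S}) (hind : IndepFun W σ Pr)
    (hW : AEMeasurable W Pr)
    {e : Fin n → 𝓧 → Primal k} (hm : ∀ i, Measurable (e i)) {D : ℝ}
    (he : ∀ ω, ∑ i, e i (W ω) = 0) (hD : ∀ ω, (1 / n : ℝ) * ∑ i, ‖e i (W ω)‖ ^ 2 ≤ D) :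
    Integrable (fun ω => ‖(1 / S : ℝ) • ∑ i ∈ σ ω, e i (W ω)‖ ^ 2) Pr ∧
      ∫ ω, ‖(1 / S : ℝ) • ∑ i ∈ σ ω, e i (W ω)‖ ^ 2 ∂Pr ≤ D / S := by
  obtain ⟨hprob, c, hc, hp⟩ := uniformOn_card_real hS
  have hSpos : (0 : ℝ) < S := by exact_mod_cast hS1
  have hn : (0 : ℝ) < n := by exact_mod_cast (hS1.trans hS)
  have hsum : ∀ A : Finset (Fin n), Measurable fun w => ‖∑ i ∈ A, e i w‖ ^ 2 := fun A =>
    (Finset.measurable_fun_sum _ fun i _ => hm i).norm.pow_const 2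
  -- A crude bound, used only for integrability.
  have hbd : ∀ (A : Finset (Fin n)) ω, ‖∑ i ∈ A, e i (W ω)‖ ^ 2 ≤ n * (n * D) := by
    intro A ω
    calc ‖∑ i ∈ A, e i (W ω)‖ ^ 2 ≤ (∑ i ∈ A, ‖e i (W ω)‖) ^ 2 :=
          pow_le_pow_left₀ (norm_nonneg _) (norm_sum_le _ _) 2
      _ ≤ (∑ i, ‖e i (W ω)‖) ^ 2 := by
          refine pow_le_pow_left₀ (Finset.sum_nonneg fun _ _ => norm_nonneg _) ?_ 2
          exact Finset.sum_le_sum_of_subset_of_nonneg (Finset.subset_univ A)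
            fun _ _ _ => norm_nonneg _
      _ ≤ n * ∑ i, ‖e i (W ω)‖ ^ 2 := by
          have := sq_sum_le_card_mul_sum_sq (s := (Finset.univ : Finset (Fin n)))
            (f := fun i => ‖e i (W ω)‖)
          simpa using this
      _ ≤ n * (n * D) := by
          have := hD ω
          rw [one_div, inv_mul_le_iff₀ hn] at this
          gcongr
  have hint : ∀ A : Finset (Fin n), Integrable (fun ω => ‖∑ i ∈ A, e i (W ω)‖ ^ 2) Pr := fun A =>
    Integrable.of_bound ((hsum A).comp_aemeasurable hW).aestronglyMeasurable (n * (n * D))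
      (Filter.Eventually.of_forall fun ω => by
        rw [Real.norm_of_nonneg (by positivity)]; exact hbd A ω)
  have h1 := integral_subset hσ hlaw hind (φ := fun A w => ‖∑ i ∈ A, e i w‖ ^ 2) hsum hint
  have hsm : ∀ ω, ‖(1 / S : ℝ) • ∑ i ∈ σ ω, e i (W ω)‖ ^ 2 =
      (1 / S : ℝ) ^ 2 * ‖∑ i ∈ σ ω, e i (W ω)‖ ^ 2 := fun ω => by
    rw [norm_smul, mul_pow, Real.norm_eq_abs, sq_abs]
  simp only [hsm]
  refine ⟨h1.1.const_mul _, ?_⟩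
  rw [integral_const_mul, h1.2]
  set pA := fun A : Finset (Fin n) => (uniformOn {A : Finset (Fin n) | A.card = S}).real {A} with hpA
  have h3 : ∑ A, pA A * ∫ ω, ‖∑ i ∈ A, e i (W ω)‖ ^ 2 ∂Pr =
      ∫ ω, ∑ A, pA A * ‖∑ i ∈ A, e i (W ω)‖ ^ 2 ∂Pr := by
    rw [integral_finsetSum _ fun A _ => (hint A).const_mul _]
    simp only [integral_const_mul]
  have h4 : ∫ ω, ∑ A, pA A * ‖∑ i ∈ A, e i (W ω)‖ ^ 2 ∂Pr ≤ ∫ _ω, (S : ℝ) * D ∂Pr := by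
    refine integral_mono (integrable_finsetSum _ fun A _ => (hint A).const_mul _)
      (integrable_const _) fun ω => ?_
    refine (sum_subset_norm_sq_le hc hp (sum_real_singleton_eq_one _) _ (he ω)).trans ?_
    have := mul_le_mul_of_nonneg_left (hD ω) hSpos.le
    refine le_trans (le_of_eq ?_) this
    ring
  rw [integral_const, probReal_univ, one_smul] at h4
  calc (1 / S : ℝ) ^ 2 * ∑ A, pA A * ∫ ω, ‖∑ i ∈ A, e i (W ω)‖ ^ 2 ∂Pr
      ≤ (1 / S : ℝ) ^ 2 * (S * D) := by
        rw [h3]; gcongr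
    _ = D / S := by field_simp

end SubsetSum

/-! ### The randomness of one iteration. -/

section Draws

variable {V : Type u} [NormedAddCommGroup V] [NormedSpace ℝ V] {d n : ℕ}
  {Z : Fin n → Type w} [∀ i, MeasurableSpace (Z i)] {p : Problem V d n Z}
  {Ω : Type v} {𝓧 : Type*} [MeasurableSpace Ω] [MeasurableSpace 𝓧]
  {Pr : Measure Ω} [IsProbabilityMeasure Pr] {S B : ℕ} {H : Ω → 𝓧} {ζ : Ω → Draw n B Z}

/-- The joint independence structure of one iteration. -/
theorem draw_structure (hprob : ∀ i, IsProbabilityMeasure (p.P i)) (hS : S ≤ n)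
    (hH : AEMeasurable H Pr) (hζ : HasLaw ζ (p.drawLaw S B) Pr) (hind : IndepFun H ζ Pr) :
    (Pr.map (fun ω => (ζ ω).1) = uniformOn {A : Finset (Fin n) | A.card = S}) ∧
    (∀ i, Pr.map (fun ω => (ζ ω).2.1 i) = Measure.pi fun _ => p.P i) ∧
    (∀ i, Pr.map (fun ω => (ζ ω).2.2 i) = Measure.pi fun _ => p.P i) ∧
    IndepFun H (fun ω => (ζ ω).2.1) Pr ∧
    IndepFun (fun ω => (H ω, (ζ ω).2.1)) (fun ω => (ζ ω).2.2) Pr ∧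
    IndepFun (fun ω => ((H ω, (ζ ω).2.1), (ζ ω).2.2)) (fun ω => (ζ ω).1) Pr := by
  obtain ⟨hUp, -⟩ := uniformOn_card_real hS
  have hζm := hζ.aemeasurable
  have hσm : AEMeasurable (fun ω => (ζ ω).1) Pr := measurable_fst.comp_aemeasurable hζm
  have hbbm : AEMeasurable (fun ω => (ζ ω).2) Pr := measurable_snd.comp_aemeasurable hζm
  have hbm : AEMeasurable (fun ω => (ζ ω).2.1) Pr := measurable_fst.comp_aemeasurable hbbm
  have hcm : AEMeasurable (fun ω => (ζ ω).2.2) Pr := measurable_snd.comp_aemeasurable hbbm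
  have hl := hζ.map_eq
  rw [Problem.drawLaw] at hl
  set PB : Measure (∀ i, Fin B → Z i) := Measure.pi fun i => Measure.pi fun _ : Fin B => p.P i with hPB
  have lσ : Pr.map (fun ω => (ζ ω).1) = uniformOn {A : Finset (Fin n) | A.card = S} := by
    have := congrArg (Measure.map Prod.fst) hl
    rwa [AEMeasurable.map_map_of_aemeasurable measurable_fst.aemeasurable hζm,
      Measure.map_fst_prod, measure_univ, one_smul] at this
  have lbb : Pr.map (fun ω => (ζ ω).2) = PB.prod PB := by
    have := congrArg (Measure.map Prod.snd) hl
    rwa [AEMeasurable.map_map_of_aemeasurable measurable_snd.aemeasurable hζm,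
      Measure.map_snd_prod, measure_univ, one_smul] at this
  have lb : Pr.map (fun ω => (ζ ω).2.1) = PB := by
    have := congrArg (Measure.map Prod.fst) lbb
    rwa [AEMeasurable.map_map_of_aemeasurable measurable_fst.aemeasurable hbbm,
      Measure.map_fst_prod, measure_univ, one_smul] at this
  have lc : Pr.map (fun ω => (ζ ω).2.2) = PB := by
    have := congrArg (Measure.map Prod.snd) lbb
    rwa [AEMeasurable.map_map_of_aemeasurable measurable_snd.aemeasurable hbbm,
      Measure.map_snd_prod, measure_univ, one_smul] at this
  have iσ : IndepFun (fun ω => (ζ ω).1) (fun ω => (ζ ω).2) Pr := by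
    rw [indepFun_iff_map_prod_eq_prod_map_map hσm hbbm, lσ, lbb]
    exact hl
  have ib : IndepFun (fun ω => (ζ ω).2.1) (fun ω => (ζ ω).2.2) Pr := by
    rw [indepFun_iff_map_prod_eq_prod_map_map hbm hcm, lb, lc]
    exact lbb
  have hpi : ∀ i, PB.map (Function.eval i) = Measure.pi fun _ => p.P i := fun i =>
    (measurePreserving_eval (fun i => Measure.pi fun _ : Fin B => p.P i) i).map_eq
  refine ⟨lσ, fun i => ?_, fun i => ?_, ?_, ?_, ?_⟩
  · rw [← hpi i, ← lb, AEMeasurable.map_map_of_aemeasurable (measurable_pi_apply i).aemeasurable hbm]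
    rfl
  · rw [← hpi i, ← lc, AEMeasurable.map_map_of_aemeasurable (measurable_pi_apply i).aemeasurable hcm]
    rfl
  · exact hind.comp measurable_id (measurable_fst.comp measurable_snd)
  · exact indepFun_prodMk_left hH hbm hcm (hind.comp measurable_id measurable_snd) ib
  -- The subset comes last: it is independent of the history together with both families of batches.
  · have i2 := indepFun_prodMk_left hH hbbm hσm (hind.comp measurable_id measurable_swap) iσ.symm
    exact i2.comp (φ := fun z => ((z.1, z.2.1), z.2.2))
      ((measurable_fst.prodMk (measurable_fst.comp measurable_snd)).prodMk
        (measurable_snd.comp measurable_snd)) measurable_id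

end Draws

theorem norm_neg_sub_sq_le {E : Type*} [SeminormedAddCommGroup E] (a c : E) :
    ‖-a - c‖ ^ 2 ≤ 2 * ‖a‖ ^ 2 + 2 * ‖c‖ ^ 2 := by
  have h : ‖-a - c‖ ≤ ‖a‖ + ‖c‖ := by simpa using norm_sub_le (-a) c
  refine (pow_le_pow_left₀ (norm_nonneg _) h 2).trans ?_
  linarith [add_sq_le (a := ‖a‖) (b := ‖c‖)]

/-! ### Conditional mean and variance of the estimators. -/

section ExpectedNoise

variable {V : Type u} [NormedAddCommGroup V] [NormedSpace ℝ V] {d n m : ℕ}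
  {Z : Fin n → Type w} [∀ i, MeasurableSpace (Z i)] {p : Problem V d n Z}
  {b : Module.Basis (Fin m) ℝ V} {μ Cf Lf Cg σ₀ σ₁ δ : ℝ}
  [FiniteDimensional ℝ V]
  {Ω : Type v} {𝓧 : Type*} [MeasurableSpace Ω] [MeasurableSpace 𝓧]
  {Pr : Measure Ω} [IsProbabilityMeasure Pr] {S B k : ℕ} {W : Ω → 𝓧}

namespace Problem.Assumptions

/-- Conditional mean and variance of the stochastic gradient: sampling of blocks and of inner
batches, with the dual blocks `yf` independent of both. -/
theorem expected_grad_noise (h : p.Assumptions b μ Cf Lf Cg σ₀ σ₁ δ) (hCf : 0 ≤ Cf) (hB : 1 ≤ B)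
    (hS1 : 1 ≤ S) (hS : S ≤ n) {ζ : Ω → Draw n B Z} (hζ : AEMeasurable ζ Pr)
    (hW : AEMeasurable W Pr)
    (lσ : Pr.map (fun ω => (ζ ω).1) = uniformOn {A : Finset (Fin n) | A.card = S})
    (lc : ∀ i, Pr.map (fun ω => (ζ ω).2.2 i) = Measure.pi fun _ => p.P i)
    (ic : IndepFun W (fun ω => (ζ ω).2.2) Pr)
    (iσ : IndepFun (fun ω => (W ω, (ζ ω).2.2)) (fun ω => (ζ ω).1) Pr)
    {xf : 𝓧 → Primal d} (hxf : Measurable xf) (hX : ∀ ω, xf (W ω) ∈ p.X)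
    {yf : 𝓧 → Fin n → StrongDual ℝ V} (hyf : Measurable yf)
    (hy : ∀ ω i, yf (W ω) i ∈ conjDom (p.f i)) {xs : Primal d}
    (hA : Integrable (fun ω => ‖xf (W ω) - xs‖ ^ 2) Pr) :
    ∃ lin sq : Ω → ℝ, Integrable lin Pr ∧ ∫ ω, lin ω ∂Pr = 0 ∧ Integrable sq Pr ∧
      ∫ ω, sq ω ∂Pr ≤ 2 * (δ ^ 2 / S + Cf ^ 2 * σ₁ ^ 2 / B) ∧
      ∀ᵐ ω ∂Pr,
        ((1 / n : ℝ) • ∑ i, (yf (W ω) i).comp (p.innerD i (xf (W ω))) -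
          p.gradEst S (xf (W ω)) (yf (W ω)) (ζ ω)) (xf (W ω) - xs) = lin ω ∧
        ‖(1 / n : ℝ) • ∑ i, (yf (W ω) i).comp (p.innerD i (xf (W ω))) -
          p.gradEst S (xf (W ω)) (yf (W ω)) (ζ ω)‖ ^ 2 ≤ sq ω := by
  have hSpos : (0 : ℝ) < S := by exact_mod_cast hS1
  have hn : (0 : ℝ) < n := by exact_mod_cast (hS1.trans hS)
  have hσm : AEMeasurable (fun ω => (ζ ω).1) Pr := measurable_fst.comp_aemeasurable hζ
  have hcm : AEMeasurable (fun ω => (ζ ω).2.2) Pr :=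
    (measurable_snd.comp measurable_snd).comp_aemeasurable hζ
  obtain ⟨R, hR⟩ := exists_riesz d
  have hyi : ∀ i, Measurable fun w => yf w i := fun i => (measurable_pi_apply i).comp hyf
  have hci : ∀ i, Measurable fun w => (yf w i).comp (p.innerD i (xf w)) := fun i => by
    have hc : Continuous fun w : StrongDual ℝ V × (Primal d →L[ℝ] V) => w.1.comp w.2 := by fun_prop
    exact hc.measurable.comp ((hyi i).prodMk ((h.measurable_innerD i).comp hxf))
  set Gb : 𝓧 → StrongDual ℝ (Primal d) := fun w =>
    (1 / n : ℝ) • ∑ i, (yf w i).comp (p.innerD i (xf w)) with hGb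
  have hGbm : Measurable Gb := (Finset.measurable_fun_sum _ fun i _ => hci i).const_smul (1 / n : ℝ)
  -- Deviation of a block gradient from the mean over blocks; these sum to zero, as the subset
  -- variance bound requires.
  set e : Fin n → 𝓧 → StrongDual ℝ (Primal d) := fun i w =>
    (yf w i).comp (p.innerD i (xf w)) - Gb w with he
  have hem : ∀ i, Measurable (e i) := fun i => (hci i).sub hGbm
  have hesum : ∀ w, ∑ i, e i w = 0 := fun w => by
    simp only [he, Finset.sum_sub_distrib, Finset.sum_const, Finset.card_univ, Fintype.card_fin]
    rw [← Nat.cast_smul_eq_nsmul ℝ, hGb, smul_smul, mul_one_div_cancel hn.ne', one_smul, sub_self]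
  have hevar : ∀ ω, (1 / n : ℝ) * ∑ i, ‖e i (W ω)‖ ^ 2 ≤ δ ^ 2 := fun ω =>
    h.var_comp _ (hX ω) _ (hy ω)
  have iWσ : IndepFun W (fun ω => (ζ ω).1) Pr := iσ.comp measurable_fst measurable_id
  have hbl := integral_subset_norm_sq_le hS1 hS hσm lσ iWσ hW (e := fun i w => R (e i w))
    (fun i => R.continuous.measurable.comp (hem i))
    (fun ω => by rw [← map_sum, hesum, map_zero])
    (fun ω => by simpa only [R.norm_map] using hevar ω)
  simp only [← map_sum, ← map_smul, R.norm_map] at hbl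
  have hxm : Measurable fun w => xf w - xs := hxf.sub_const xs
  have hdn := fun i => h.deriv_noise (i := i) (C := Cf) hB hW
    ((measurable_pi_apply i).comp_aemeasurable hcm) (lc i)
    (ic.comp measurable_id (measurable_pi_apply i)) hxf hX (hyi i)
    (fun ω => norm_le_of_mem_conjDom hCf (h.outer i).lipschitz (hy ω i))
  -- Batch error of a block gradient; the gradient error is minus the sampled averages of `e` and
  -- `K`.
  set K : Fin n → 𝓧 × (∀ i, Fin B → Z i) → StrongDual ℝ (Primal d) := fun i w =>
    (yf w.1 i).comp (p.batchD i (xf w.1) (w.2 i) - p.innerD i (xf w.1)) with hK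
  have hKm : ∀ i, Measurable (K i) := fun i => by
    have hc : Continuous fun w : StrongDual ℝ V × (Primal d →L[ℝ] V) => w.1.comp w.2 := by fun_prop
    refine hc.measurable.comp (((hyi i).comp measurable_fst).prodMk (Measurable.sub ?_ ?_))
    · exact (h.measurable_batchD i).comp ((hxf.comp measurable_fst).prodMk
        ((measurable_pi_apply i).comp measurable_snd))
    · exact (h.measurable_innerD i).comp (hxf.comp measurable_fst)
  have happ : Continuous fun w : StrongDual ℝ (Primal d) × Primal d => w.1 w.2 := by fun_prop
  have heint : ∀ i, Integrable (fun ω => e i (W ω) (xf (W ω) - xs)) Pr := fun i => by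
    have hm : Measurable fun w => e i w (xf w - xs) := happ.measurable.comp ((hem i).prodMk hxm)
    refine Integrable.mono' (hA.add (integrable_const (n * δ ^ 2)))
      (hm.comp_aemeasurable hW).aestronglyMeasurable (Filter.Eventually.of_forall fun ω => ?_)
    refine ((e i (W ω)).le_opNorm _).trans ?_
    have h1 := hevar ω
    rw [one_div, inv_mul_le_iff₀ hn] at h1
    have h2 : ‖e i (W ω)‖ ^ 2 ≤ ∑ j, ‖e j (W ω)‖ ^ 2 :=
      Finset.single_le_sum (f := fun j => ‖e j (W ω)‖ ^ 2) (fun j _ => sq_nonneg _) (Finset.mem_univ i)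
    simp only [Pi.add_apply]
    nlinarith [sq_nonneg (‖e i (W ω)‖ - ‖xf (W ω) - xs‖), sq_nonneg ‖e i (W ω)‖,
      sq_nonneg ‖xf (W ω) - xs‖]
  have hlin1 := integral_subset_sum hS hσm lσ iWσ (ε := fun i w => e i w (xf w - xs))
    (fun i => happ.measurable.comp ((hem i).prodMk hxm)) heint
  have hlin2 := integral_subset_sum hS hσm lσ iσ (ε := fun i w => K i w (xf w.1 - xs))
    (fun i => happ.measurable.comp ((hKm i).prodMk (hxm.comp measurable_fst)))
    (fun i => ((hdn i).2 _ hxm hA).1)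
  have hsq2 := integral_subset_sum hS hσm lσ iσ (ε := fun i w => ‖K i w‖ ^ 2)
    (fun i => (hKm i).norm.pow_const 2) (fun i => (hdn i).1.1)
  refine ⟨fun ω => -(1 / S : ℝ) * ∑ i ∈ (ζ ω).1, e i (W ω) (xf (W ω) - xs) +
      -(1 / S : ℝ) * ∑ i ∈ (ζ ω).1, K i (W ω, (ζ ω).2.2) (xf (W ω) - xs),
    fun ω => 2 * ‖(1 / S : ℝ) • ∑ i ∈ (ζ ω).1, e i (W ω)‖ ^ 2 +
      2 / S * ∑ i ∈ (ζ ω).1, ‖K i (W ω, (ζ ω).2.2)‖ ^ 2,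
    (hlin1.1.const_mul _).add (hlin2.1.const_mul _), ?_,
    (hbl.1.const_mul _).add (hsq2.1.const_mul _), ?_, ?_⟩
  · rw [integral_add (hlin1.1.const_mul _) (hlin2.1.const_mul _), integral_const_mul,
      integral_const_mul, hlin1.2, hlin2.2, ← integral_finsetSum _ fun i _ => heint i]
    have h1 : ∀ ω, ∑ i, e i (W ω) (xf (W ω) - xs) = 0 := fun ω => by
      rw [← sum_apply, hesum, zero_apply]
    have h2 : ∀ i, ∫ ω, K i (W ω, (ζ ω).2.2) (xf (W ω) - xs) ∂Pr = 0 := fun i =>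
      ((hdn i).2 _ hxm hA).2
    simp only [h1, h2, integral_zero, Finset.sum_const_zero, mul_zero, add_zero]
  · rw [integral_add (hbl.1.const_mul _) (hsq2.1.const_mul _), integral_const_mul,
      integral_const_mul, hsq2.2, mul_add]
    refine add_le_add (mul_le_mul_of_nonneg_left hbl.2 zero_le_two) ?_
    calc 2 / (S : ℝ) * ((S : ℝ) / n * ∑ i, ∫ ω, ‖K i (W ω, (ζ ω).2.2)‖ ^ 2 ∂Pr)
        ≤ 2 / (S : ℝ) * ((S : ℝ) / n * ∑ _i : Fin n, Cf ^ 2 * σ₁ ^ 2 / B) := by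
          gcongr with i
          exact (hdn i).1.2
      _ = 2 * (Cf ^ 2 * σ₁ ^ 2 / B) := by
          rw [Finset.sum_const, Finset.card_univ, Fintype.card_fin, nsmul_eq_mul]
          field_simp
  · filter_upwards [ae_card_eq hS hσm lσ] with ω hcard
    have hdec : Gb (W ω) - p.gradEst S (xf (W ω)) (yf (W ω)) (ζ ω) =
        -((1 / S : ℝ) • ∑ i ∈ (ζ ω).1, e i (W ω)) -
          (1 / S : ℝ) • ∑ i ∈ (ζ ω).1, K i (W ω, (ζ ω).2.2) := by
      have h1 : (1 / S : ℝ) • ∑ i ∈ (ζ ω).1, e i (W ω) =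
          (1 / S : ℝ) • ∑ i ∈ (ζ ω).1, (yf (W ω) i).comp (p.innerD i (xf (W ω))) - Gb (W ω) := by
        simp only [he, Finset.sum_sub_distrib, Finset.sum_const, hcard]
        rw [smul_sub, ← Nat.cast_smul_eq_nsmul ℝ, smul_smul, one_div_mul_cancel hSpos.ne', one_smul]
      have h2 : (1 / S : ℝ) • ∑ i ∈ (ζ ω).1, K i (W ω, (ζ ω).2.2) =
          p.gradEst S (xf (W ω)) (yf (W ω)) (ζ ω) -
            (1 / S : ℝ) • ∑ i ∈ (ζ ω).1, (yf (W ω) i).comp (p.innerD i (xf (W ω))) := by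
        simp only [hK, Problem.gradEst, ContinuousLinearMap.comp_sub, Finset.sum_sub_distrib, smul_sub]
      rw [h1, h2]; abel
    change (Gb (W ω) - _) _ = _ ∧ ‖Gb (W ω) - _‖ ^ 2 ≤ _
    rw [hdec]
    constructor
    · simp only [sub_apply, neg_apply, smul_apply, sum_apply, smul_eq_mul]
      ring
    -- Cauchy–Schwarz, not independence across blocks: the batch part is reduced by 1/B only, which
    -- is why 1/(μB) enters M.
    · have h3 : ‖(1 / S : ℝ) • ∑ i ∈ (ζ ω).1, K i (W ω, (ζ ω).2.2)‖ ^ 2 ≤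
          1 / S * ∑ i ∈ (ζ ω).1, ‖K i (W ω, (ζ ω).2.2)‖ ^ 2 := by
        rw [norm_smul, mul_pow, Real.norm_of_nonneg (by positivity)]
        have h4 : ‖∑ i ∈ (ζ ω).1, K i (W ω, (ζ ω).2.2)‖ ^ 2 ≤
            S * ∑ i ∈ (ζ ω).1, ‖K i (W ω, (ζ ω).2.2)‖ ^ 2 := by
          refine (pow_le_pow_left₀ (norm_nonneg _) (norm_sum_le _ _) 2).trans ?_
          have := sq_sum_le_card_mul_sum_sq (s := (ζ ω).1) (f := fun i => ‖K i (W ω, (ζ ω).2.2)‖)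
          rwa [hcard] at this
        calc (1 / S : ℝ) ^ 2 * ‖∑ i ∈ (ζ ω).1, K i (W ω, (ζ ω).2.2)‖ ^ 2
            ≤ (1 / S : ℝ) ^ 2 * (S * ∑ i ∈ (ζ ω).1, ‖K i (W ω, (ζ ω).2.2)‖ ^ 2) := by gcongr
          _ = _ := by field_simp
      refine (norm_neg_sub_sq_le _ _).trans ?_
      have h7 : 2 / (S : ℝ) * ∑ i ∈ (ζ ω).1, ‖K i (W ω, (ζ ω).2.2)‖ ^ 2 =
          2 * (1 / S * ∑ i ∈ (ζ ω).1, ‖K i (W ω, (ζ ω).2.2)‖ ^ 2) := by ring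
      rw [h7]
      linarith

variable [MeasurableSpace V] [BorelSpace V]

/-- Conditional mean and variance of the extrapolated value estimates. -/
theorem expected_value_noise (h : p.Assumptions b μ Cf Lf Cg σ₀ σ₁ δ) (L : V ≃L[ℝ] Primal k)
    (hn : 0 < n) (hB : 1 ≤ B) {β : Ω → ∀ i, Fin B → Z i} (hβ : AEMeasurable β Pr)
    (hW : AEMeasurable W Pr)
    (lb : ∀ i, Pr.map (fun ω => β ω i) = Measure.pi fun _ => p.P i)
    (ib : IndepFun W β Pr)
    {xf xpf : 𝓧 → Primal d} (hxf : Measurable xf) (hX : ∀ ω, xf (W ω) ∈ p.X)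
    (hxpf : Measurable xpf) (hXp : ∀ ω, xpf (W ω) ∈ p.X)
    {uf : 𝓧 → Fin n → StrongDual ℝ V} (huf : Measurable uf) {C : ℝ}
    (hu : ∀ ω i, ‖uf (W ω) i‖ ≤ C) {θ a : ℝ} (hθ : 0 ≤ θ) (hθ1 : θ ≤ 1) (ha : 0 < a) :
    ∃ lin sq : Ω → ℝ, Integrable lin Pr ∧ ∫ ω, lin ω ∂Pr = 0 ∧ Integrable sq Pr ∧
      ∫ ω, sq ω ∂Pr ≤ 10 * (‖(L.symm : Primal k →L[ℝ] V)‖ ^ 2 *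
        (‖(L : V →L[ℝ] Primal k)‖ ^ 2 * σ₀ ^ 2 / B)) / a ∧
      ∀ ω,
        (1 / n : ℝ) * ∑ i, uf (W ω) i (p.extrap θ i (xpf (W ω)) (xf (W ω)) (β ω i) -
          ((1 + θ) • p.inner i (xf (W ω)) - θ • p.inner i (xpf (W ω)))) = lin ω ∧
        (1 / n : ℝ) * ∑ i, ‖p.extrap θ i (xpf (W ω)) (xf (W ω)) (β ω i) -
          ((1 + θ) • p.inner i (xf (W ω)) - θ • p.inner i (xpf (W ω)))‖ ^ 2 / a ≤ sq ω := by
  have hn' : (0 : ℝ) < n := by exact_mod_cast hn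
  have hx := fun i => h.value_noise (i := i) L hB hW
    ((measurable_pi_apply i).comp_aemeasurable hβ) (lb i)
    (ib.comp measurable_id (measurable_pi_apply i)) hxf hX
  have hxp := fun i => h.value_noise (i := i) L hB hW
    ((measurable_pi_apply i).comp_aemeasurable hβ) (lb i)
    (ib.comp measurable_id (measurable_pi_apply i)) hxpf hXp
  have hui : ∀ i, Measurable fun w => uf w i := fun i => (measurable_pi_apply i).comp huf
  set Nx : Fin n → Ω → V := fun i ω => p.batch i (xf (W ω)) (β ω i) - p.inner i (xf (W ω)) with hNx
  set Np : Fin n → Ω → V := fun i ω => p.batch i (xpf (W ω)) (β ω i) - p.inner i (xpf (W ω)) with hNp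
  have hux : ∀ i, Integrable (fun ω => uf (W ω) i (Nx i ω)) Pr ∧
      ∫ ω, uf (W ω) i (Nx i ω) ∂Pr = 0 := fun i => (hx i).2 _ C (hui i) fun ω => hu ω i
  have hup : ∀ i, Integrable (fun ω => uf (W ω) i (Np i ω)) Pr ∧
      ∫ ω, uf (W ω) i (Np i ω) ∂Pr = 0 := fun i => (hxp i).2 _ C (hui i) fun ω => hu ω i
  set s := ‖(L.symm : Primal k →L[ℝ] V)‖ ^ 2 * (‖(L : V →L[ℝ] Primal k)‖ ^ 2 * σ₀ ^ 2 / B) with hs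
  have hsx : ∀ i, Integrable (fun ω => ‖Nx i ω‖ ^ 2) Pr ∧ ∫ ω, ‖Nx i ω‖ ^ 2 ∂Pr ≤ s :=
    fun i => (hx i).1
  have hsp : ∀ i, Integrable (fun ω => ‖Np i ω‖ ^ 2) Pr ∧ ∫ ω, ‖Np i ω‖ ^ 2 ∂Pr ≤ s :=
    fun i => (hxp i).1
  have hdec : ∀ i ω, p.extrap θ i (xpf (W ω)) (xf (W ω)) (β ω i) -
      ((1 + θ) • p.inner i (xf (W ω)) - θ • p.inner i (xpf (W ω))) =
      (1 + θ) • Nx i ω - θ • Np i ω := fun i ω => by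
    simp only [Problem.extrap, hNx, hNp]; module
  have hi1 : ∀ i, Integrable (fun ω => (1 + θ) * uf (W ω) i (Nx i ω) - θ * uf (W ω) i (Np i ω)) Pr :=
    fun i => ((hux i).1.const_mul _).sub ((hup i).1.const_mul _)
  have hi2 : ∀ i, Integrable (fun ω => (8 * ‖Nx i ω‖ ^ 2 + 2 * ‖Np i ω‖ ^ 2) / a) Pr :=
    fun i => (((hsx i).1.const_mul _).add ((hsp i).1.const_mul _)).div_const _
  refine ⟨fun ω => (1 / n : ℝ) * ∑ i, ((1 + θ) * uf (W ω) i (Nx i ω) - θ * uf (W ω) i (Np i ω)),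
    fun ω => (1 / n : ℝ) * ∑ i, (8 * ‖Nx i ω‖ ^ 2 + 2 * ‖Np i ω‖ ^ 2) / a,
    (integrable_finsetSum _ fun i _ => hi1 i).const_mul _, ?_,
    (integrable_finsetSum _ fun i _ => hi2 i).const_mul _, ?_, fun ω => ⟨?_, ?_⟩⟩
  · rw [integral_const_mul, integral_finsetSum _ fun i _ => hi1 i]
    have : ∀ i, ∫ ω, ((1 + θ) * uf (W ω) i (Nx i ω) - θ * uf (W ω) i (Np i ω)) ∂Pr = 0 := fun i => by
      rw [integral_sub ((hux i).1.const_mul _) ((hup i).1.const_mul _), integral_const_mul,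
        integral_const_mul, (hux i).2, (hup i).2]
      ring
    simp [this]
  · rw [integral_const_mul, integral_finsetSum _ fun i _ => hi2 i]
    have : ∀ i, ∫ ω, (8 * ‖Nx i ω‖ ^ 2 + 2 * ‖Np i ω‖ ^ 2) / a ∂Pr ≤ 10 * s / a := fun i => by
      rw [integral_div, integral_add ((hsx i).1.const_mul _) ((hsp i).1.const_mul _),
        integral_const_mul, integral_const_mul]
      have h1 := (hsx i).2
      have h2 := (hsp i).2
      gcongr
      linarith
    calc (1 / n : ℝ) * ∑ i, ∫ ω, (8 * ‖Nx i ω‖ ^ 2 + 2 * ‖Np i ω‖ ^ 2) / a ∂Pr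
        ≤ (1 / n : ℝ) * ∑ _i : Fin n, 10 * s / a := by gcongr with i; exact this i
      _ = 10 * s / a := by
        rw [Finset.sum_const, Finset.card_univ, Fintype.card_fin, nsmul_eq_mul]
        field_simp
  · simp only [hdec, map_sub, map_smul, smul_eq_mul]
  · simp only [hdec]
    gcongr with i
    -- Both points are evaluated on the same batch, so their errors are correlated and the square is
    -- bounded by 8 and 2 times the separate squares, whence the factor 10.
    have h1 : ‖(1 + θ) • Nx i ω - θ • Np i ω‖ ≤ 2 * ‖Nx i ω‖ + ‖Np i ω‖ := by
      refine (norm_sub_le _ _).trans ?_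
      rw [norm_smul, norm_smul, Real.norm_of_nonneg hθ, Real.norm_of_nonneg (by linarith)]
      have h2 := mul_le_mul_of_nonneg_right hθ1 (norm_nonneg (Nx i ω))
      have h3 := mul_le_mul_of_nonneg_right hθ1 (norm_nonneg (Np i ω))
      linarith
    nlinarith [norm_nonneg ((1 + θ) • Nx i ω - θ • Np i ω), sq_nonneg (2 * ‖Nx i ω‖ - ‖Np i ω‖)]

end Problem.Assumptions

end ExpectedNoise

/-! ### Expected decrease in one iteration. -/

/-- The state of the algorithm: previous and current primal iterates, dual blocks, subgradients. -/
abbrev State (V : Type u) [NormedAddCommGroup V] [NormedSpace ℝ V] (d n : ℕ) : Type u :=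
  Primal d × Primal d × (Fin n → StrongDual ℝ V) × (Fin n → V)

section Transition

variable {V : Type u} [NormedAddCommGroup V] [NormedSpace ℝ V] {d n m : ℕ}
  {Z : Fin n → Type w} [∀ i, MeasurableSpace (Z i)] {p : Problem V d n Z}
  {b : Module.Basis (Fin m) ℝ V} {μ Cf Lf Cg σ₀ σ₁ δ : ℝ} {S B k : ℕ}

/-- The dual steps of all blocks, whether or not they are sampled. -/
noncomputable def Problem.fullDual (p : Problem V d n Z) (T : Fin n → V × V → StrongDual ℝ V × V) (θ : ℝ)
    (s : State V d n) (β : ∀ i, Fin B → Z i) (i : Fin n) : StrongDual ℝ V × V :=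
  T i (p.extrap θ i s.1 s.2.1 (β i), s.2.2.2 i)

/-- `T` performs the dual steps, with the three-point inequality as its guarantee. -/
def Problem.IsDualStep (p : Problem V d n Z) (ψ : Fin n → DGF V) (τ ρ : ℝ)
    (T : Fin n → V × V → StrongDual ℝ V × V) : Prop :=
  ∀ i (gt q : V) (y : StrongDual ℝ V), y ∈ conjDom (p.f i) → (ψ i).IsSubgrad (p.f i) y q →
    (T i (gt, q)).1 ∈ conjDom (p.f i) ∧ (ψ i).IsSubgrad (p.f i) (T i (gt, q)).1 (T i (gt, q)).2 ∧
    ∀ a ∈ conjDom (p.f i), (a - (T i (gt, q)).1) gt - conj (p.f i) a + conj (p.f i) (T i (gt, q)).1 ≤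
      τ * bregman ((ψ i).val (p.f i)) a y q - τ * bregman ((ψ i).val (p.f i)) (T i (gt, q)).1 y q
        - (τ + ρ) * bregman ((ψ i).val (p.f i)) a (T i (gt, q)).1 (T i (gt, q)).2

/-- States that the algorithm may visit. -/
def Problem.Feasible (p : Problem V d n Z) (ψ : Fin n → DGF V) (s : State V d n) : Prop :=
  s.1 ∈ p.X ∧ s.2.1 ∈ p.X ∧
    ∀ i, s.2.2.1 i ∈ conjDom (p.f i) ∧ (ψ i).IsSubgrad (p.f i) (s.2.2.1 i) (s.2.2.2 i)

variable [FiniteDimensional ℝ V] [MeasurableSpace V] [BorelSpace V]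

theorem Problem.Assumptions.measurable_fullDual (h : p.Assumptions b μ Cf Lf Cg σ₀ σ₁ δ)
    {T : Fin n → V × V → StrongDual ℝ V × V} (hT : ∀ i, Measurable (T i)) (θ : ℝ) (i : Fin n) :
    Measurable fun z : State V d n × (∀ i, Fin B → Z i) => p.fullDual T θ z.1 z.2 i := by
  refine (hT i).comp (Measurable.prodMk ?_ ?_)
  · have h1 : Measurable fun z : State V d n × (∀ i, Fin B → Z i) => p.batch i z.1.2.1 (z.2 i) :=
      (h.measurable_batch i).comp ((measurable_fst.comp (measurable_snd.comp measurable_fst)).prodMk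
        ((measurable_pi_apply i).comp measurable_snd))
    have h2 : Measurable fun z : State V d n × (∀ i, Fin B → Z i) => p.batch i z.1.1 (z.2 i) :=
      (h.measurable_batch i).comp ((measurable_fst.comp measurable_fst).prodMk
        ((measurable_pi_apply i).comp measurable_snd))
    exact h1.add ((h1.sub h2).const_smul θ)
  · exact (measurable_pi_apply i).comp (measurable_snd.comp (measurable_snd.comp
      (measurable_snd.comp measurable_fst)))

variable {Ω : Type v} [MeasurableSpace Ω] {Pr : Measure Ω} [IsProbabilityMeasure Pr]

set_option maxHeartbeats 1000000 in
/-- The expected decrease in one iteration. -/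
theorem Problem.Assumptions.expected_step (h : p.Assumptions b μ Cf Lf Cg σ₀ σ₁ δ) (hμ : 0 ≤ μ)
    (hCf : 0 ≤ Cf) (hB : 1 ≤ B) (hS1 : 1 ≤ S) (hS : S ≤ n) (L : V ≃L[ℝ] Primal k)
    {ψ : Fin n → DGF V} {T : Fin n → V × V → StrongDual ℝ V × V} (hTm : ∀ i, Measurable (T i))
    {τ ρ κ θ η k₁ k₂ : ℝ} (hτ : 0 < τ) (hρ : 0 < ρ) (hκ : 0 < κ) (hθ : 0 ≤ θ) (hθ1 : θ ≤ 1)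
    (hη : 0 < η) (hη1 : 2 * Cg ^ 2 / (ρ * κ) ≤ η / 16) (hη2 : Cf * k₁ ≤ η / 8)
    (hT : p.IsDualStep ψ τ ρ T)
    (hlow : ∀ i, ∀ y ∈ conjDom (p.f i), ∀ a ∈ conjDom (p.f i), ∀ q, (ψ i).IsSubgrad (p.f i) y q →
      κ / 2 * ‖a - y‖ ^ 2 ≤ bregman ((ψ i).val (p.f i)) a y q)
    {xs : Primal d} (hxs : p.IsMinimizer xs) {D : Fin n → StrongDual ℝ V × V → ℝ}
    (hDm : ∀ i, Measurable (D i))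
    (hD : ∀ i, ∀ y ∈ conjDom (p.f i), ∀ q, (ψ i).IsSubgrad (p.f i) y q →
      bregman ((ψ i).val (p.f i)) (fderiv ℝ (p.f i) (p.inner i xs)) y q = D i (y, q))
    (hcurv : ∀ i, ∀ x ∈ p.X, ∀ x' ∈ p.X,
      ‖p.inner i x' - p.inner i x - p.innerD i x (x' - x)‖ ≤ k₁ * ‖x' - x‖ ^ 2 + k₂)
    {H H' : Ω → State V d n} {ζ : Ω → Draw n B Z} (hH : AEMeasurable H Pr)
    (hH' : AEMeasurable H' Pr) (hζ : HasLaw ζ (p.drawLaw S B) Pr) (hind : IndepFun H ζ Pr)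
    (hfeas : ∀ ω, p.Feasible ψ (H ω)) (hprev : ∀ ω, (H' ω).1 = (H ω).2.1)
    (hx' : ∀ ω, (H' ω).2.1 ∈ p.X)
    (hmin : ∀ ω, IsMinOn (fun x => ((p.gradEst S (H ω).2.1
      (fun i => (p.fullDual T θ (H ω) (ζ ω).2.1 i).1) (ζ ω) x
      + η / 2 * ‖x - (H ω).2.1‖ ^ 2 : ℝ) : EReal) + p.r x) p.X (H' ω).2.1)
    (hdual : ∀ ω i, ((H' ω).2.2.1 i, (H' ω).2.2.2 i) =
      if i ∈ (ζ ω).1 then p.fullDual T θ (H ω) (ζ ω).2.1 i else ((H ω).2.2.1 i, (H ω).2.2.2 i))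
    (hA : Integrable (fun ω => ‖(H ω).2.1 - xs‖ ^ 2) Pr)
    (hd : Integrable (fun ω => ‖(H ω).2.1 - (H ω).1‖ ^ 2) Pr)
    (hU : ∀ i, Integrable (fun ω => D i ((H ω).2.2.1 i, (H ω).2.2.2 i)) Pr) :
    Integrable (fun ω => ‖(H' ω).2.1 - xs‖ ^ 2) Pr ∧
    Integrable (fun ω => ‖(H' ω).2.1 - (H' ω).1‖ ^ 2) Pr ∧
    (∀ i, Integrable (fun ω => D i ((H' ω).2.2.1 i, (H' ω).2.2.2 i)) Pr) ∧
    (η + μ) / 2 * ∫ ω, ‖(H' ω).2.1 - xs‖ ^ 2 ∂Pr + η / 8 * ∫ ω, ‖(H' ω).2.1 - (H' ω).1‖ ^ 2 ∂Pr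
      + (τ + ρ / 2) * (n / S) * ((1 / n : ℝ) * ∑ i, ∫ ω, D i ((H' ω).2.2.1 i, (H' ω).2.2.2 i) ∂Pr) ≤
    η / 2 * ∫ ω, ‖(H ω).2.1 - xs‖ ^ 2 ∂Pr + η / 16 * ∫ ω, ‖(H ω).2.1 - (H ω).1‖ ^ 2 ∂Pr
      + (τ + (τ + ρ / 2) * (n / S - 1)) *
        ((1 / n : ℝ) * ∑ i, ∫ ω, D i ((H ω).2.2.1 i, (H ω).2.2.2 i) ∂Pr)
      + (10 * (‖(L.symm : Primal k →L[ℝ] V)‖ ^ 2 * (‖(L : V →L[ℝ] Primal k)‖ ^ 2 * σ₀ ^ 2 / B)) /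
          (2 * τ * κ)
        + 2 / η * (2 * (δ ^ 2 / S + Cf ^ 2 * σ₁ ^ 2 / B)) + Cf * k₂) := by
  have hSpos : (0 : ℝ) < S := by exact_mod_cast hS1
  have hn0 : 0 < n := hS1.trans hS
  have hn : (0 : ℝ) < n := by exact_mod_cast hn0
  have hζm := hζ.aemeasurable
  have hβm : AEMeasurable (fun ω => (ζ ω).2.1) Pr :=
    (measurable_fst.comp measurable_snd).comp_aemeasurable hζm
  have hcm : AEMeasurable (fun ω => (ζ ω).2.2) Pr :=
    (measurable_snd.comp measurable_snd).comp_aemeasurable hζm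
  have hσm : AEMeasurable (fun ω => (ζ ω).1) Pr := measurable_fst.comp_aemeasurable hζm
  obtain ⟨lσ, lb, lc, ib, ic, iσ⟩ := draw_structure h.prob hS hH hζ hind
  set ys : Fin n → StrongDual ℝ V := fun i => fderiv ℝ (p.f i) (p.inner i xs) with hys
  have hysd : ∀ i, ys i ∈ conjDom (p.f i) := fun i => (h.outer i).fderiv_mem_conjDom _
  have hfull : ∀ ω i, _ := fun ω i => hT i (p.extrap θ i (H ω).1 (H ω).2.1 ((ζ ω).2.1 i))
    ((H ω).2.2.2 i) ((H ω).2.2.1 i) ((hfeas ω).2.2 i).1 ((hfeas ω).2.2 i).2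
  have hfm := fun i => h.measurable_fullDual (B := B) hTm θ i
  -- The multiplier y - y_* is a function of the past state only and has norm at most 2Cf.
  obtain ⟨lin₁, sq₁, hl₁, hl₁0, hq₁, hq₁le, hb₁⟩ := h.expected_value_noise L hn0 hB hβm hH lb ib
    (xf := fun s => s.2.1) (xpf := fun s => s.1) (uf := fun s i => s.2.2.1 i - ys i) (C := 2 * Cf)
    (measurable_fst.comp measurable_snd) (fun ω => (hfeas ω).2.1) measurable_fst
    (fun ω => (hfeas ω).1)
    (measurable_pi_lambda _ fun i => ((measurable_pi_apply i).comp (measurable_fst.comp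
      (measurable_snd.comp measurable_snd))).sub_const _)
    (fun ω i => by
      have h1 := norm_le_of_mem_conjDom hCf (h.outer i).lipschitz ((hfeas ω).2.2 i).1
      have h2 := norm_le_of_mem_conjDom hCf (h.outer i).lipschitz (hysd i)
      exact (norm_sub_le _ _).trans (by linarith)) hθ hθ1 (by positivity : 0 < 2 * τ * κ)
  -- The conditioning variable is the state together with the value batches, which determines all
  -- virtual dual blocks.
  obtain ⟨lin₂, sq₂, hl₂, hl₂0, hq₂, hq₂le, hb₂⟩ := h.expected_grad_noise hCf hB hS1 hS hζm
    (hH.prodMk hβm) lσ lc ic iσ (xf := fun w => w.1.2.1)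
    (yf := fun w i => (p.fullDual T θ w.1 w.2 i).1) (xs := xs)
    (measurable_fst.comp (measurable_snd.comp measurable_fst)) (fun ω => (hfeas ω).2.1)
    (measurable_pi_lambda _ fun i => measurable_fst.comp (hfm i)) (fun ω i => (hfull ω i).1) hA
  set U : Fin n → Ω → ℝ := fun i ω => D i ((H ω).2.2.1 i, (H ω).2.2.2 i) with hUdef
  set Ub : Fin n → Ω → ℝ := fun i ω => D i (p.fullDual T θ (H ω) (ζ ω).2.1 i) with hUb
  set U' : Fin n → Ω → ℝ := fun i ω => D i ((H' ω).2.2.1 i, (H' ω).2.2.2 i) with hU'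
  have hUbeq : ∀ i ω, bregman ((ψ i).val (p.f i)) (ys i) (p.fullDual T θ (H ω) (ζ ω).2.1 i).1
      (p.fullDual T θ (H ω) (ζ ω).2.1 i).2 = Ub i ω := fun i ω =>
    hD i _ (hfull ω i).1 _ (hfull ω i).2.1
  have hUeq : ∀ i ω, bregman ((ψ i).val (p.f i)) (ys i) ((H ω).2.2.1 i) ((H ω).2.2.2 i) = U i ω :=
    fun i ω => hD i _ ((hfeas ω).2.2 i).1 _ ((hfeas ω).2.2 i).2
  have hUb0 : ∀ i ω, 0 ≤ Ub i ω := fun i ω => by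
    rw [← hUbeq]
    exact le_trans (by positivity) (hlow i _ (hfull ω i).1 _ (hysd i) _ (hfull ω i).2.1)
  set A' : Ω → ℝ := fun ω => ‖(H' ω).2.1 - xs‖ ^ 2 with hA'
  set d' : Ω → ℝ := fun ω => ‖(H' ω).2.1 - (H' ω).1‖ ^ 2 with hd'
  set rhs : Ω → ℝ := fun ω => η / 2 * ‖(H ω).2.1 - xs‖ ^ 2 + η / 16 * ‖(H ω).2.1 - (H ω).1‖ ^ 2 +
    τ * ((1 / n : ℝ) * ∑ i, U i ω) + lin₁ ω + sq₁ ω + lin₂ ω + 2 / η * sq₂ ω + Cf * k₂ with hrhs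
  have hpath : ∀ᵐ ω ∂Pr, (η + μ) / 2 * A' ω + η / 8 * d' ω +
      (τ + ρ / 2) * ((1 / n : ℝ) * ∑ i, Ub i ω) ≤ rhs ω := by
    filter_upwards [hb₂] with ω h2
    have h1 := hb₁ ω
    have hstep := h.one_step hμ hCf hxs (hfeas ω).1 (hfeas ω).2.1 (hx' ω)
      (y := fun i => (H ω).2.2.1 i) (yb := fun i => (p.fullDual T θ (H ω) (ζ ω).2.1 i).1)
      (fun i => (hfull ω i).1)
      (gt := fun i => p.extrap θ i (H ω).1 (H ω).2.1 ((ζ ω).2.1 i))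
      (U := fun i => U i ω) (Ub := fun i => Ub i ω)
      (R := fun i => bregman ((ψ i).val (p.f i)) (p.fullDual T θ (H ω) (ζ ω).2.1 i).1
        ((H ω).2.2.1 i) ((H ω).2.2.2 i)) hτ hρ hκ hθ hθ1 hη hη1 hη2 (ys := ys) (fun i => rfl)
      (fun i => by
        rw [← hUbeq, ← hUeq]
        exact (hfull ω i).2.2 _ (hysd i))
      (fun i => by
        rw [← hUbeq]
        exact hlow i _ (hfull ω i).1 _ (hysd i) _ (hfull ω i).2.1)
      (fun i => hlow i _ ((hfeas ω).2.2 i).1 _ (hfull ω i).1 _ ((hfeas ω).2.2 i).2)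
      (fun i => hcurv i _ (hfeas ω).2.1 _ (hx' ω)) hn0 rfl (hmin ω)
    have h3 := mul_le_mul_of_nonneg_left h2.2 (by positivity : 0 ≤ 2 / η)
    have h4 := h1.1
    have h5 := h2.1
    beta_reduce at h4 h5 h3 hstep h1
    rw [h4, h5] at hstep
    simp only [hrhs, hA', hd', hprev]
    linarith [h1.2]
  have hrhsi : Integrable rhs Pr :=
    (((((((hA.const_mul _).add (hd.const_mul _)).add
      (((integrable_finsetSum _ fun i _ => hU i).const_mul _).const_mul _)).add hl₁).add hq₁).add
      hl₂).add (hq₂.const_mul _)).add (integrable_const _)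
  have hrhsint : ∫ ω, rhs ω ∂Pr = η / 2 * ∫ ω, ‖(H ω).2.1 - xs‖ ^ 2 ∂Pr +
      η / 16 * ∫ ω, ‖(H ω).2.1 - (H ω).1‖ ^ 2 ∂Pr + τ * ((1 / n : ℝ) * ∑ i, ∫ ω, U i ω ∂Pr) +
      ∫ ω, sq₁ ω ∂Pr + 2 / η * ∫ ω, sq₂ ω ∂Pr + Cf * k₂ := by
    have i1 := (hA.const_mul (η / 2))
    have i2 := i1.add (hd.const_mul (η / 16))
    have i3 := i2.add (((integrable_finsetSum Finset.univ fun i _ => hU i).const_mul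
      (1 / n : ℝ)).const_mul τ)
    have i4 := i3.add hl₁
    have i5 := i4.add hq₁
    have i6 := i5.add hl₂
    have i7 := i6.add (hq₂.const_mul (2 / η))
    have e := integral_add i7 (integrable_const (μ := Pr) (Cf * k₂))
    rw [integral_add' i6 (hq₂.const_mul (2 / η)), integral_add' i5 hl₂, integral_add' i4 hq₁,
      integral_add' i3 hl₁, integral_add' i2 (((integrable_finsetSum Finset.univ fun i _ =>
        hU i).const_mul (1 / n : ℝ)).const_mul τ), integral_add' i1 (hd.const_mul (η / 16)),
      integral_const_mul, integral_const_mul, integral_const_mul, integral_const_mul,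
      integral_const_mul, integral_finsetSum _ fun i _ => hU i, hl₁0, hl₂0, integral_const,
      probReal_univ, one_smul, add_zero, add_zero] at e
    exact e
  have hUbm : ∀ i, AEMeasurable (Ub i) Pr := fun i =>
    ((hDm i).comp (hfm i)).comp_aemeasurable (hH.prodMk hβm)
  have hxm : AEMeasurable (fun ω => (H' ω).2.1) Pr :=
    (measurable_fst.comp measurable_snd).comp_aemeasurable hH'
  have hA'm : AEMeasurable A' Pr := (hxm.sub_const xs).norm.pow_const 2
  have hd'm : AEMeasurable d' Pr :=
    (hxm.sub (measurable_fst.comp_aemeasurable hH')).norm.pow_const 2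
  have hA'0 : ∀ ω, 0 ≤ A' ω := fun ω => sq_nonneg _
  have hd'0 : ∀ ω, 0 ≤ d' ω := fun ω => sq_nonneg _
  have hsum0 : ∀ ω, 0 ≤ (1 / n : ℝ) * ∑ i, Ub i ω := fun ω =>
    mul_nonneg (by positivity) (Finset.sum_nonneg fun i _ => hUb0 i ω)
  -- All terms on the left of the pathwise inequality are nonnegative, so its integrable right side
  -- dominates each of them.
  have hA'i : Integrable A' Pr := by
    refine Integrable.mono' (hrhsi.const_mul (2 / η)) hA'm.aestronglyMeasurable ?_
    filter_upwards [hpath] with ω hω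
    rw [Real.norm_of_nonneg (hA'0 ω), div_mul_eq_mul_div, le_div_iff₀ hη]
    have := mul_nonneg (by linarith : 0 ≤ τ + ρ / 2) (hsum0 ω)
    have := mul_nonneg hη.le (hd'0 ω)
    have := mul_nonneg hμ (hA'0 ω)
    linarith
  have hd'i : Integrable d' Pr := by
    refine Integrable.mono' (hrhsi.const_mul (8 / η)) hd'm.aestronglyMeasurable ?_
    filter_upwards [hpath] with ω hω
    rw [Real.norm_of_nonneg (hd'0 ω), div_mul_eq_mul_div, le_div_iff₀ hη]
    have := mul_nonneg (by linarith : 0 ≤ τ + ρ / 2) (hsum0 ω)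
    have := mul_nonneg hη.le (hA'0 ω)
    have := mul_nonneg hμ (hA'0 ω)
    linarith
  have hUbi : ∀ i, Integrable (Ub i) Pr := fun i => by
    refine Integrable.mono' (hrhsi.const_mul (n / τ)) (hUbm i).aestronglyMeasurable ?_
    filter_upwards [hpath] with ω hω
    have h1 : Ub i ω ≤ ∑ j, Ub j ω :=
      Finset.single_le_sum (f := fun j => Ub j ω) (fun j _ => hUb0 j ω) (Finset.mem_univ i)
    rw [Real.norm_of_nonneg (hUb0 i ω), div_mul_eq_mul_div, le_div_iff₀ hτ]
    have h2 : 0 ≤ (η + μ) / 2 * A' ω := mul_nonneg (by linarith) (hA'0 ω)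
    have h3 : 0 ≤ η / 8 * d' ω := mul_nonneg (by linarith) (hd'0 ω)
    have h4 := mul_nonneg hρ.le (hsum0 ω)
    have h5 : τ * ((1 / n : ℝ) * ∑ i, Ub i ω) ≤ rhs ω := by linarith
    have h6 := mul_le_mul_of_nonneg_left h5 hn.le
    have h7 : (n : ℝ) * (τ * ((1 / n : ℝ) * ∑ i, Ub i ω)) = (∑ i, Ub i ω) * τ := by field_simp
    rw [h7] at h6
    exact (mul_le_mul_of_nonneg_right h1 hτ.le).trans h6
  have hU'eq : ∀ i ω, U' i ω = if i ∈ (ζ ω).1 then Ub i ω else U i ω := fun i ω => by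
    simp only [hU', hUb, hUdef, hdual]
    split_ifs <;> rfl
  have hU'i : ∀ i, Integrable (U' i) Pr := fun i => by
    have hm : AEMeasurable (U' i) Pr := (hDm i).comp_aemeasurable
      (((measurable_pi_apply i).comp (measurable_fst.comp
        (measurable_snd.comp measurable_snd))).prodMk ((measurable_pi_apply i).comp
          (measurable_snd.comp (measurable_snd.comp measurable_snd))) |>.comp_aemeasurable hH')
    refine Integrable.mono' ((hUbi i).norm.add (hU i).norm) hm.aestronglyMeasurable
      (Filter.Eventually.of_forall fun ω => ?_)
    rw [hU'eq, Pi.add_apply]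
    split_ifs
    · exact le_add_of_nonneg_right (norm_nonneg _)
    · exact le_add_of_nonneg_left (norm_nonneg _)
  -- The subset is independent of the old and the virtual divergences, so each block is replaced
  -- with probability S/n.
  have hswap : ∑ i, ∫ ω, U' i ω ∂Pr = (1 - (S : ℝ) / n) * ∑ i, ∫ ω, U i ω ∂Pr +
      (S : ℝ) / n * ∑ i, ∫ ω, Ub i ω ∂Pr := by
    have h1 := integral_subset_sum hS hσm lσ
      (iσ.comp (φ := Prod.fst) measurable_fst measurable_id)
      (ε := fun i w => D i (p.fullDual T θ w.1 w.2 i) - D i (w.1.2.2.1 i, w.1.2.2.2 i))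
      (fun i => ((hDm i).comp (hfm i)).sub ((hDm i).comp (((measurable_pi_apply i).comp
        (measurable_fst.comp (measurable_snd.comp (measurable_snd.comp measurable_fst)))).prodMk
        ((measurable_pi_apply i).comp (measurable_snd.comp (measurable_snd.comp
          (measurable_snd.comp measurable_fst)))))))
      (fun i => (hUbi i).sub (hU i))
    have h2 : ∀ ω, ∑ i, U' i ω = ∑ i, U i ω + ∑ i ∈ (ζ ω).1, (Ub i ω - U i ω) := fun ω => by
      have h3 : ∑ i ∈ (ζ ω).1, (Ub i ω - U i ω) =
          ∑ i, if i ∈ (ζ ω).1 then (Ub i ω - U i ω) else 0 := by simp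
      rw [h3, ← Finset.sum_add_distrib]
      refine Finset.sum_congr rfl fun i _ => ?_
      rw [hU'eq]
      split_ifs <;> ring
    have h4 : ∫ ω, ∑ i ∈ (ζ ω).1, (Ub i ω - U i ω) ∂Pr =
        (S : ℝ) / n * ∑ i, ∫ ω, (Ub i ω - U i ω) ∂Pr := h1.2
    have h4i : Integrable (fun ω => ∑ i ∈ (ζ ω).1, (Ub i ω - U i ω)) Pr := h1.1
    have h5 : ∑ i, ∫ ω, U' i ω ∂Pr =
        ∫ ω, (∑ i, U i ω + ∑ i ∈ (ζ ω).1, (Ub i ω - U i ω)) ∂Pr := by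
      rw [← integral_finsetSum _ fun i _ => hU'i i]
      exact integral_congr_ae (Filter.Eventually.of_forall h2)
    rw [h5, integral_add (integrable_finsetSum _ fun i _ => hU i) h4i, h4,
      integral_finsetSum _ fun i _ => hU i]
    rw [Finset.sum_congr rfl fun i _ => integral_sub (hUbi i) (hU i), Finset.sum_sub_distrib]
    ring
  refine ⟨hA'i, hd'i, hU'i, ?_⟩
  have hmain : (η + μ) / 2 * ∫ ω, A' ω ∂Pr + η / 8 * ∫ ω, d' ω ∂Pr +
      (τ + ρ / 2) * ((1 / n : ℝ) * ∑ i, ∫ ω, Ub i ω ∂Pr) ≤ ∫ ω, rhs ω ∂Pr := by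
    have i1 := hA'i.const_mul ((η + μ) / 2)
    have i2 := i1.add (hd'i.const_mul (η / 8))
    have i3 := ((integrable_finsetSum Finset.univ fun i _ => hUbi i).const_mul
      (1 / n : ℝ)).const_mul (τ + ρ / 2)
    have e := integral_mono_ae (i2.add i3) hrhsi hpath
    rw [integral_add' i2 i3, integral_add' i1 (hd'i.const_mul (η / 8)), integral_const_mul,
      integral_const_mul, integral_const_mul, integral_const_mul,
      integral_finsetSum _ fun i _ => hUbi i] at e
    exact e
  rw [hrhsint] at hmain
  rw [hswap]
  have h6 := mul_le_mul_of_nonneg_left hq₂le (by positivity : 0 ≤ 2 / η)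
  -- Weighting by n/S cancels the update probability and recovers the virtual divergences of the
  -- pathwise bound.
  have h7 : (τ + ρ / 2) * (n / S) * ((1 / n : ℝ) * ((1 - (S : ℝ) / n) * ∑ i, ∫ ω, U i ω ∂Pr +
      (S : ℝ) / n * ∑ i, ∫ ω, Ub i ω ∂Pr)) =
      (τ + ρ / 2) * (n / S - 1) * ((1 / n : ℝ) * ∑ i, ∫ ω, U i ω ∂Pr) +
      (τ + ρ / 2) * ((1 / n : ℝ) * ∑ i, ∫ ω, Ub i ω ∂Pr) := by
    field_simp
  rw [h7]
  linarith

end Transition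

/-! ### The run as a measurable recursion driven by the draws. -/

section Run

variable {V : Type u} [NormedAddCommGroup V] [NormedSpace ℝ V] {d n m : ℕ}
  {Z : Fin n → Type w} [∀ i, MeasurableSpace (Z i)] {p : Problem V d n Z}
  {b : Module.Basis (Fin m) ℝ V} {μ Cf Lf Cg σ₀ σ₁ δ : ℝ} {S B k : ℕ}

/-- `T` computes the outcome of every dual update of the algorithm. -/
def Problem.ComputesDual (p : Problem V d n Z) (ψ : Fin n → DGF V) (τ : ℝ)
    (T : Fin n → V × V → StrongDual ℝ V × V) : Prop :=
  ∀ i (gt q : V) (y : StrongDual ℝ V), y ∈ conjDom (p.f i) → (ψ i).IsSubgrad (p.f i) y q →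
    ∀ y' q', y' ∈ conjDom (p.f i) →
      IsMaxOn (fun a => a gt - conj (p.f i) a - τ * bregman ((ψ i).val (p.f i)) a y q)
        (conjDom (p.f i)) y' →
      (ψ i).NextSubgrad τ gt q y' q' → y' = (T i (gt, q)).1 ∧ q' = (T i (gt, q)).2

/-- The transition map of the algorithm. -/
noncomputable def Problem.transition (p : Problem V d n Z) (T : Fin n → V × V → StrongDual ℝ V × V)
    (Pm : StrongDual ℝ (Primal d) × Primal d → Primal d) (S : ℕ) (θ : ℝ)
    (z : State V d n × Draw n B Z) : State V d n :=
  (z.1.2.1, Pm (p.gradEst S z.1.2.1 (fun i => (p.fullDual T θ z.1 z.2.2.1 i).1) z.2, z.1.2.1),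
    (fun i => if i ∈ z.2.1 then (p.fullDual T θ z.1 z.2.2.1 i).1 else z.1.2.2.1 i),
    fun i => if i ∈ z.2.1 then (p.fullDual T θ z.1 z.2.2.1 i).2 else z.1.2.2.2 i)

theorem Problem.Assumptions.measurable_transition [FiniteDimensional ℝ V] [MeasurableSpace V]
    [BorelSpace V] (h : p.Assumptions b μ Cf Lf Cg σ₀ σ₁ δ)
    {T : Fin n → V × V → StrongDual ℝ V × V} (hT : ∀ i, Measurable (T i))
    {Pm : StrongDual ℝ (Primal d) × Primal d → Primal d} (hPm : Continuous Pm) (θ : ℝ) :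
    Measurable (p.transition (B := B) T Pm S θ) := by
  have hx : Measurable fun z : State V d n × Draw n B Z => z.1.2.1 :=
    measurable_fst.comp (measurable_snd.comp measurable_fst)
  have hfull : ∀ i, Measurable fun z : State V d n × Draw n B Z => p.fullDual T θ z.1 z.2.2.1 i :=
    fun i => (h.measurable_fullDual hT θ i).comp (measurable_fst.prodMk
      (measurable_fst.comp (measurable_snd.comp measurable_snd)))
  have hmem : ∀ i, MeasurableSet {z : State V d n × Draw n B Z | i ∈ z.2.1} := fun i =>
    (measurable_fst.comp measurable_snd) (MeasurableSet.of_discrete (s := {A : Finset (Fin n) | i ∈ A}))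
  refine hx.prodMk (Measurable.prodMk ?_ (Measurable.prodMk ?_ ?_))
  · refine hPm.measurable.comp (Measurable.prodMk ?_ hx)
    have hcomp : ∀ i, Measurable fun z : State V d n × Draw n B Z =>
        (p.fullDual T θ z.1 z.2.2.1 i).1.comp (p.batchD i z.1.2.1 (z.2.2.2 i)) := fun i => by
      have hc : Continuous fun w : StrongDual ℝ V × (Primal d →L[ℝ] V) => w.1.comp w.2 := by fun_prop
      exact hc.measurable.comp ((measurable_fst.comp (hfull i)).prodMk
        ((h.measurable_batchD i).comp (hx.prodMk ((measurable_pi_apply i).comp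
          (measurable_snd.comp (measurable_snd.comp measurable_snd))))))
    -- The sum over the random subset becomes a fixed finite sum of truncated terms.
    have hite : ∀ i, Measurable fun z : State V d n × Draw n B Z => if i ∈ z.2.1 then
        (p.fullDual T θ z.1 z.2.2.1 i).1.comp (p.batchD i z.1.2.1 (z.2.2.2 i)) else 0 :=
      fun i => Measurable.ite (hmem i) (hcomp i) measurable_const
    have hsum := (Finset.measurable_fun_sum Finset.univ fun i _ => hite i).const_smul (1 / S : ℝ)
    convert hsum using 2 with z
    simp [Problem.gradEst]
  · exact measurable_pi_lambda _ fun i => Measurable.ite (hmem i) (measurable_fst.comp (hfull i))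
      ((measurable_pi_apply i).comp (measurable_fst.comp
        (measurable_snd.comp (measurable_snd.comp measurable_fst))))
  · exact measurable_pi_lambda _ fun i => Measurable.ite (hmem i) (measurable_snd.comp (hfull i))
      ((measurable_pi_apply i).comp (measurable_snd.comp
        (measurable_snd.comp (measurable_snd.comp measurable_fst))))

variable {Ω : Type v} {ψ : Fin n → DGF V} {θ η τ ρ : ℝ} {x₀ : Primal d}
  {y₀ : Fin n → StrongDual ℝ V} {q₀ : Fin n → V} {ξ : ℕ → Ω → Draw n B Z} {X : ℕ → Ω → Primal d}
  {Y : ℕ → Ω → Fin n → StrongDual ℝ V} {Q : ℕ → Ω → Fin n → V}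

namespace Problem.IsALEXR

/-- Feasibility of the dual pair and the formula for its update need each other: uniqueness of the
dual step requires a feasible pair, and the step then returns one. Induction on time closes the
loop. -/
theorem dual_eq (hrun : p.IsALEXR ψ S B θ η τ x₀ y₀ q₀ ξ X Y Q)
    {T : Fin n → V × V → StrongDual ℝ V × V} (hT : p.IsDualStep ψ τ ρ T)
    (hTu : p.ComputesDual ψ τ T) (t : ℕ) (ω : Ω) :
    p.Feasible ψ (X (t - 1) ω, X t ω, Y t ω, Q t ω) ∧ ∀ i, (Y (t + 1) ω i, Q (t + 1) ω i) =
      if i ∈ (ξ t ω).1 then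
        p.fullDual T θ (X (t - 1) ω, X t ω, Y t ω, Q t ω) (ξ t ω).2.1 i
      else (Y t ω i, Q t ω i) := by
  have hX : ∀ t, X t ω ∈ p.X := fun t => by
    cases t with
    | zero => rw [hrun.x_init.2]; exact hrun.x_init.1
    | succ t => exact (hrun.primal t ω).1
  have hstep : ∀ t, (∀ i, Y t ω i ∈ conjDom (p.f i) ∧ (ψ i).IsSubgrad (p.f i) (Y t ω i) (Q t ω i)) →
      ∀ i, (Y (t + 1) ω i, Q (t + 1) ω i) =
      if i ∈ (ξ t ω).1 then
        p.fullDual T θ (X (t - 1) ω, X t ω, Y t ω, Q t ω) (ξ t ω).2.1 i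
      else (Y t ω i, Q t ω i) := by
    intro t hf i
    split_ifs with hi
    · obtain ⟨h1, h2, h3⟩ := hrun.dual t ω i hi
      obtain ⟨h4, h5⟩ := hTu i _ _ _ (hf i).1 (hf i).2 _ _ h1 h2 h3
      exact Prod.ext h4 h5
    · obtain ⟨h4, h5⟩ := hrun.dual_idle t ω i hi
      exact Prod.ext h4 h5
  have hf : ∀ t, ∀ i, Y t ω i ∈ conjDom (p.f i) ∧ (ψ i).IsSubgrad (p.f i) (Y t ω i) (Q t ω i) := by
    intro t
    induction t with
    | zero =>
      intro i
      rw [hrun.y_init.2, hrun.q_init.2]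
      exact ⟨hrun.y_init.1 i, hrun.q_init.1 i⟩
    | succ t ih =>
      intro i
      have h1 := hstep t ih i
      split_ifs at h1 with hi
      · have h2 := hT i (p.extrap θ i (X (t - 1) ω) (X t ω) ((ξ t ω).2.1 i)) (Q t ω i) (Y t ω i)
          (ih i).1 (ih i).2
        have h3 := congrArg Prod.fst h1
        have h4 := congrArg Prod.snd h1
        dsimp only at h3 h4
        rw [h3, h4]
        exact ⟨h2.1, h2.2.1⟩
      · have h3 := congrArg Prod.fst h1
        have h4 := congrArg Prod.snd h1
        dsimp only at h3 h4
        rw [h3, h4]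
        exact ih i
  exact ⟨⟨hX _, hX _, hf t⟩, hstep t (hf t)⟩

/-- The estimator reads sampled blocks only, and on these the actual and virtual updates agree. -/
theorem gradEst_eq (hrun : p.IsALEXR ψ S B θ η τ x₀ y₀ q₀ ξ X Y Q)
    {T : Fin n → V × V → StrongDual ℝ V × V} (hT : p.IsDualStep ψ τ ρ T)
    (hTu : p.ComputesDual ψ τ T) (t : ℕ) (ω : Ω) :
    p.gradEst S (X t ω) (Y (t + 1) ω) (ξ t ω) = p.gradEst S (X t ω)
      (fun i => (p.fullDual T θ (X (t - 1) ω, X t ω, Y t ω, Q t ω) (ξ t ω).2.1 i).1) (ξ t ω) := by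
  simp only [Problem.gradEst]
  congr 1
  refine Finset.sum_congr rfl fun i hi => ?_
  have h1 := (hrun.dual_eq hT hTu t ω).2 i
  rw [if_pos hi] at h1
  have h2 := congrArg Prod.fst h1
  dsimp only at h2
  rw [h2]

theorem transition_eq (hrun : p.IsALEXR ψ S B θ η τ x₀ y₀ q₀ ξ X Y Q)
    {T : Fin n → V × V → StrongDual ℝ V × V} (hT : p.IsDualStep ψ τ ρ T)
    (hTu : p.ComputesDual ψ τ T) {Pm : StrongDual ℝ (Primal d) × Primal d → Primal d}
    (hPm : ∀ ℓ x x', x' ∈ p.X →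
      IsMinOn (fun u => ((ℓ u + η / 2 * ‖u - x‖ ^ 2 : ℝ) : EReal) + p.r u) p.X x' → x' = Pm (ℓ, x))
    (t : ℕ) (ω : Ω) :
    ((X t ω, X (t + 1) ω, Y (t + 1) ω, Q (t + 1) ω) : State V d n) =
      p.transition T Pm S θ ((X (t - 1) ω, X t ω, Y t ω, Q t ω), ξ t ω) := by
  have h1 := (hrun.dual_eq hT hTu t ω).2
  have h2 := hPm _ _ _ (hrun.primal t ω).1 (hrun.primal t ω).2
  rw [hrun.gradEst_eq hT hTu t ω] at h2
  simp only [Problem.transition]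
  refine Prod.ext rfl (Prod.ext h2 (Prod.ext (funext fun i => ?_) (funext fun i => ?_)))
  · have h3 := congrArg Prod.fst (h1 i)
    dsimp only at h3 ⊢
    rw [h3]
    split_ifs <;> rfl
  · have h3 := congrArg Prod.snd (h1 i)
    dsimp only at h3 ⊢
    rw [h3]
    split_ifs <;> rfl

variable [FiniteDimensional ℝ V] [MeasurableSpace V] [BorelSpace V] [MeasurableSpace Ω]
  {Pr : Measure Ω}

/-- The state before an iteration is a random variable independent of the iteration's draws. -/
theorem state_indep (hrun : p.IsALEXR ψ S B θ η τ x₀ y₀ q₀ ξ X Y Q)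
    (h : p.Assumptions b μ Cf Lf Cg σ₀ σ₁ δ) (hs : p.IsSampling S B Pr ξ)
    {T : Fin n → V × V → StrongDual ℝ V × V} (hTm : ∀ i, Measurable (T i))
    (hT : p.IsDualStep ψ τ ρ T)
    (hTu : p.ComputesDual ψ τ T) {Pm : StrongDual ℝ (Primal d) × Primal d → Primal d}
    (hPc : Continuous Pm) (hPm : ∀ ℓ x x', x' ∈ p.X →
      IsMinOn (fun u => ((ℓ u + η / 2 * ‖u - x‖ ^ 2 : ℝ) : EReal) + p.r u) p.X x' → x' = Pm (ℓ, x))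
    (t : ℕ) :
    AEMeasurable (fun ω => ((X (t - 1) ω, X t ω, Y t ω, Q t ω) : State V d n)) Pr ∧
    IndepFun (fun ω => ((X (t - 1) ω, X t ω, Y t ω, Q t ω) : State V d n)) (ξ t) Pr := by
  have hξ : ∀ t, AEMeasurable (ξ t) Pr := fun t => (hs.law t).aemeasurable
  -- The state before iteration t uses the draws 0, …, t-1 only; at t = 0 truncated subtraction
  -- makes the previous iterate x₀.
  have hhist : ∀ t, ∃ Φ : ((i : Finset.range t) → Draw n B Z) → State V d n, Measurable Φ ∧
      ∀ ω, ((X (t - 1) ω, X t ω, Y t ω, Q t ω) : State V d n) = Φ fun i => ξ i ω := by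
    intro t
    induction t with
    | zero =>
      refine ⟨fun _ => (x₀, x₀, y₀, q₀), measurable_const, fun ω => ?_⟩
      rw [hrun.x_init.2, hrun.y_init.2, hrun.q_init.2]
    | succ t ih =>
      obtain ⟨Φ, hΦ, he⟩ := ih
      refine ⟨fun hh => p.transition T Pm S θ
        (Φ fun i => hh ⟨i, Finset.range_subset_range.2 (Nat.le_succ t) i.2⟩,
          hh ⟨t, Finset.self_mem_range_succ t⟩), ?_, fun ω => ?_⟩
      · refine (h.measurable_transition hTm hPc θ).comp (Measurable.prodMk (hΦ.comp ?_)
          (measurable_pi_apply _))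
        exact measurable_pi_lambda _ fun i => measurable_pi_apply _
      · rw [Nat.add_sub_cancel, hrun.transition_eq hT hTu hPm t ω, he ω]
  obtain ⟨Φ, hΦ, he⟩ := hhist t
  have hfun : (fun ω => ((X (t - 1) ω, X t ω, Y t ω, Q t ω) : State V d n)) =
      Φ ∘ fun ω (i : Finset.range t) => ξ i ω := funext he
  rw [hfun]
  have hdisj : Disjoint (Finset.range t) {t} := by simp
  have hind := hs.indep.indepFun_finset₀ (Finset.range t) {t} hdisj hξ
  refine ⟨hΦ.comp_aemeasurable (aemeasurable_pi_lambda _ fun i => hξ i), ?_⟩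
  have hev : Measurable fun z : (({t} : Finset ℕ) → Draw n B Z) =>
      z ⟨t, Finset.mem_singleton_self t⟩ :=
    measurable_pi_apply (⟨t, Finset.mem_singleton_self t⟩ : ({t} : Finset ℕ))
  exact hind.comp hΦ hev

end Problem.IsALEXR

end Run

/-! ### Linear convergence up to the noise level. -/

theorem le_pow_mul_add_of_le_mul_add {a : ℕ → ℝ} {q ν : ℝ} (hq0 : 0 ≤ q) (hq1 : q < 1) (hν : 0 ≤ ν)
    (h : ∀ t, a (t + 1) ≤ q * a t + ν) (t : ℕ) : a t ≤ q ^ t * a 0 + ν / (1 - q) := by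
  have hq : 0 < 1 - q := by linarith
  induction t with
  | zero =>
    have : 0 ≤ ν / (1 - q) := by positivity
    simpa using this
  | succ t ih =>
    have h1 := mul_le_mul_of_nonneg_left ih hq0
    have h2 : q * (ν / (1 - q)) + ν = ν / (1 - q) := by field_simp; ring
    have h3 := h t
    rw [pow_succ]
    nlinarith

/-- The factor 2 in front of the logarithm yields (2+y)⁻² with y = Δ/ε, and 4y ≤ (2+y)² finishes. -/
theorem two_mul_mul_pow_le {Δ ε x : ℝ} (hΔ : 0 ≤ Δ) (hε : 0 < ε) (hx : 0 < x) (hx1 : x ≤ 1) {T : ℕ}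
    (hT : 2 / x * Real.log (2 + Δ / ε) ≤ T) : 2 * Δ * (1 - x) ^ T ≤ ε / 2 := by
  set y := Δ / ε with hy
  have hy0 : 0 ≤ y := by positivity
  have hΔy : Δ = y * ε := by rw [hy]; field_simp
  have h1 : (1 - x) ^ T ≤ Real.exp (-(x * T)) := by
    have h2 : 1 - x ≤ Real.exp (-x) := by linarith [Real.add_one_le_exp (-x)]
    refine (pow_le_pow_left₀ (by linarith) h2 T).trans_eq ?_
    rw [← Real.exp_nat_mul]
    congr 1
    ring
  have h2 : Real.exp (-(x * T)) ≤ 1 / (2 + y) ^ 2 := by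
    have h3 : 2 * Real.log (2 + y) ≤ x * T := by
      have h4 := mul_le_mul_of_nonneg_left hT hx.le
      have h5 : x * (2 / x * Real.log (2 + y)) = 2 * Real.log (2 + y) := by field_simp
      linarith
    have h6 : Real.exp (2 * Real.log (2 + y)) = (2 + y) ^ 2 := by
      rw [two_mul, Real.exp_add, Real.exp_log (by linarith)]
      ring
    rw [Real.exp_neg, ← one_div, ← h6]
    exact one_div_le_one_div_of_le (Real.exp_pos _) (Real.exp_le_exp.2 h3)
  have h7 : 2 * Δ * (1 - x) ^ T ≤ 2 * Δ * (1 / (2 + y) ^ 2) :=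
    mul_le_mul_of_nonneg_left (h1.trans h2) (by positivity)
  refine h7.trans ?_
  rw [mul_one_div, div_le_iff₀ (by positivity), hΔy]
  have h8 : 0 ≤ ε * (y - 2) ^ 2 := by positivity
  have h9 : 0 ≤ ε * y := by positivity
  nlinarith

section Convergence

variable {V : Type u} [NormedAddCommGroup V] [NormedSpace ℝ V] {d n m : ℕ}
  {Z : Fin n → Type w} [∀ i, MeasurableSpace (Z i)] {p : Problem V d n Z}
  {b : Module.Basis (Fin m) ℝ V} {μ Cf Lf Cg σ₀ σ₁ δ : ℝ} {S B k : ℕ}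

/-- Linear convergence of ALEXR up to the noise level `ν`. -/
theorem Problem.Assumptions.error_bound (h : p.Assumptions b μ Cf Lf Cg σ₀ σ₁ δ) (hμ : 0 < μ)
    (hCf : 0 ≤ Cf) (hLf : 0 < Lf) (hB : 1 ≤ B) (hS1 : 1 ≤ S) (hS : S ≤ n) (L : V ≃L[ℝ] Primal k)
    {ψ : Fin n → DGF V} {μψ ρ₀ : ℝ} (hμψ : 0 < μψ) (hψ : ∀ i, (ψ i).Admissible (p.f i) μψ ρ₀)
    {τ ρ κ θ η k₁ k₂ ν : ℝ} (hρ : 0 < ρ) (hρ1 : ρ ≤ 1) (hρ₀ : ρ ≤ ρ₀) (hκ : 0 < κ) (hκ₁ : κ ≤ μψ)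
    (hκ₂ : κ ≤ 1 / Lf) (hθ : 1 / 2 ≤ θ) (hθ1 : θ < 1) (hηdef : η = μ * θ / (1 - θ))
    (hτdef : τ = S / (n * (1 - θ))) (hτ1 : 1 ≤ τ)
    (hη1 : 2 * Cg ^ 2 / (ρ * κ) ≤ η / 16) (hη2 : Cf * k₁ ≤ η / 8)
    (hcurv : ∀ i, ∀ x ∈ p.X, ∀ x' ∈ p.X,
      ‖p.inner i x' - p.inner i x - p.innerD i x (x' - x)‖ ≤ k₁ * ‖x' - x‖ ^ 2 + k₂)
    (hν0 : 0 ≤ ν)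
    (hν : 10 * (‖(L.symm : Primal k →L[ℝ] V)‖ ^ 2 * (‖(L : V →L[ℝ] Primal k)‖ ^ 2 * σ₀ ^ 2 / B)) /
          (2 * τ * κ)
        + 2 / η * (2 * (δ ^ 2 / S + Cf ^ 2 * σ₁ ^ 2 / B)) + Cf * k₂ ≤ ν)
    {Ω : Type v} [MeasurableSpace Ω] {Pr : Measure Ω} [IsProbabilityMeasure Pr]
    {ξ : ℕ → Ω → Draw n B Z} {x₀ : Primal d} {y₀ : Fin n → StrongDual ℝ V} {q₀ : Fin n → V}
    {X : ℕ → Ω → Primal d} {Y : ℕ → Ω → Fin n → StrongDual ℝ V} {Q : ℕ → Ω → Fin n → V}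
    {xs : Primal d} (hxs : p.IsMinimizer xs) (hs : p.IsSampling S B Pr ξ)
    (hrun : p.IsALEXR ψ S B θ η τ x₀ y₀ q₀ ξ X Y Q) (t : ℕ) :
    0 ≤ p.initGap ψ μ x₀ y₀ q₀ xs ∧ Integrable (fun ω => ‖X t ω - xs‖ ^ 2) Pr ∧
    μ / 2 * ∫ ω, ‖X t ω - xs‖ ^ 2 ∂Pr ≤
      2 * p.initGap ψ μ x₀ y₀ q₀ xs * (1 - ρ * (1 - θ) / 4) ^ t + 4 * ν / ρ := by
  let : MeasurableSpace V := borel V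
  have : BorelSpace V := ⟨rfl⟩
  have : FiniteDimensional ℝ V := b.finiteDimensional_of_finite
  have hSpos : (0 : ℝ) < S := by exact_mod_cast hS1
  have hn : (0 : ℝ) < n := by exact_mod_cast hS1.trans hS
  have hh : 0 < 1 - θ := by linarith
  have hτ : 0 < τ := by linarith
  have hη : 0 < η := by
    have : 0 < θ := by linarith
    rw [hηdef]
    positivity
  choose T hTm hTs using fun i =>
    (ψ i).exists_dual_step (h.outer i) hCf hLf hμψ (hψ i) hτ hρ1 hρ₀
  have hT : p.IsDualStep ψ τ ρ T := fun i gt q y hy hq =>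
    ⟨(hTs i gt q y hy hq).1, (hTs i gt q y hy hq).2.1, (hTs i gt q y hy hq).2.2.1⟩
  have hTu : p.ComputesDual ψ τ T := fun i gt q y hy hq => (hTs i gt q y hy hq).2.2.2
  choose D hDm hD using fun i => (ψ i).exists_measurable_bregman (h.outer i) (hψ i)
    (fderiv ℝ (p.f i) (p.inner i xs))
  obtain ⟨Pm, hPc, hPm⟩ := h.exists_prox hη.le hμ
  have hlow : ∀ i, ∀ y ∈ conjDom (p.f i), ∀ a ∈ conjDom (p.f i), ∀ q,
      (ψ i).IsSubgrad (p.f i) y q → κ / 2 * ‖a - y‖ ^ 2 ≤ bregman ((ψ i).val (p.f i)) a y q :=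
    fun i y hy a ha q hq => DGF.bregman_lower (h.outer i) hLf (hψ i) hκ₁ hκ₂ hy ha hq
  have hD0 : ∀ i, ∀ y ∈ conjDom (p.f i), ∀ q, (ψ i).IsSubgrad (p.f i) y q → 0 ≤ D i (y, q) :=
    fun i y hy q hq => by
      rw [← hD i y hy q hq]
      exact le_trans (by positivity) (hlow i y hy _ ((h.outer i).fderiv_mem_conjDom _) q hq)
  have hde := fun t ω => hrun.dual_eq hT hTu t ω
  have hst := fun t => hrun.state_indep h hs hTm hT hTu hPc hPm t
  have hstep := fun t => h.expected_step hμ.le hCf hB hS1 hS L hTm hτ hρ hκ (by linarith : 0 ≤ θ)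
    hθ1.le hη hη1 hη2 hT hlow hxs hDm hD hcurv (hst t).1 (hst (t + 1)).1 (hs.law t) (hst t).2
    (fun ω => (hde t ω).1) (fun ω => by simp) (fun ω => (hrun.primal t ω).1)
    (fun ω => by
      have := (hrun.primal t ω).2
      rw [hrun.gradEst_eq hT hTu t ω] at this
      exact this) (fun ω i => (hde t ω).2 i)
  have hint : ∀ t, Integrable (fun ω => ‖X t ω - xs‖ ^ 2) Pr ∧
      Integrable (fun ω => ‖X t ω - X (t - 1) ω‖ ^ 2) Pr ∧
      ∀ i, Integrable (fun ω => D i (Y t ω i, Q t ω i)) Pr := by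
    intro t
    induction t with
    | zero =>
      simp only [hrun.x_init.2, hrun.y_init.2, hrun.q_init.2, Nat.zero_sub]
      exact ⟨integrable_const _, integrable_const _, fun i => integrable_const _⟩
    | succ t ih =>
      obtain ⟨h1, h2, h3, -⟩ := hstep t ih.1 ih.2.1 ih.2.2
      exact ⟨h1, h2, h3⟩
  set a : ℕ → ℝ := fun t => ∫ ω, ‖X t ω - xs‖ ^ 2 ∂Pr with ha
  set e : ℕ → ℝ := fun t => ∫ ω, ‖X t ω - X (t - 1) ω‖ ^ 2 ∂Pr with he
  set g : ℕ → ℝ := fun t => (1 / n : ℝ) * ∑ i, ∫ ω, D i (Y t ω i, Q t ω i) ∂Pr with hg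
  have ha0 : ∀ t, 0 ≤ a t := fun t => integral_nonneg fun ω => sq_nonneg _
  have he0 : ∀ t, 0 ≤ e t := fun t => integral_nonneg fun ω => sq_nonneg _
  have hg0 : ∀ t, 0 ≤ g t := fun t => mul_nonneg (by positivity) <|
    Finset.sum_nonneg fun i _ => integral_nonneg fun ω =>
      hD0 i _ ((hde t ω).1.2.2 i).1 _ ((hde t ω).1.2.2 i).2
  -- Weight of the dual part of the Lyapunov function; one step lowers it by ρ/2, independently of
  -- n/S.
  set W : ℝ := (τ + ρ / 2) * (n / S) with hW
  have hrec : ∀ t, (η + μ) / 2 * a (t + 1) + η / 8 * e (t + 1) + W * g (t + 1) ≤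
      η / 2 * a t + η / 16 * e t + (W - ρ / 2) * g t + ν := fun t => by
    have h1 := (hstep t (hint t).1 (hint t).2.1 (hint t).2.2).2.2.2
    have h2 : W - ρ / 2 = τ + (τ + ρ / 2) * (n / S - 1) := by rw [hW]; ring
    rw [h2]
    refine h1.trans ?_
    linarith
  -- The choice of η makes the primal contraction factor η/(η+μ) exactly θ.
  have hημ : (1 - θ) * (η + μ) = μ := by rw [hηdef]; field_simp; ring
  have hηθ : η = θ * (η + μ) := by linarith
  -- The choice of τ gives (1-θ)τn/S = 1, and τ ≥ 1 ≥ ρ/2 bounds the rest of W by the same amount.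
  have hWle : (1 - θ) * W ≤ 2 := by
    have h1 : (1 - θ) * (τ * (n / S)) = 1 := by rw [hτdef]; field_simp
    have h2 : (n : ℝ) / S ≤ τ * (n / S) := le_mul_of_one_le_left (by positivity) hτ1
    have h3 : (1 - θ) * (ρ / 2 * (n / S)) ≤ (1 - θ) * (τ * (n / S)) := by
      refine mul_le_mul_of_nonneg_left ?_ hh.le
      refine mul_le_mul_of_nonneg_right ?_ (by positivity)
      linarith
    have h4 : (1 - θ) * W = (1 - θ) * (τ * (n / S)) + (1 - θ) * (ρ / 2 * (n / S)) := by
      rw [hW]; ring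
    linarith
  have hρh : ρ * (1 - θ) ≤ 1 - θ := mul_le_of_le_one_left hh.le hρ1
  -- A common rate for the three parts: θ for the distance, 1/2 for the movement, 1 - ρ/(2W) for the
  -- dual part.
  set q : ℝ := 1 - ρ * (1 - θ) / 4 with hq
  have hq0 : 0 ≤ q := by rw [hq]; linarith
  have hρh0 : 0 < ρ * (1 - θ) := by positivity
  have hq1 : q < 1 := by rw [hq]; linarith
  set Ly : ℕ → ℝ := fun t => (η + μ) / 2 * a t + η / 8 * e t + W * g t with hLy
  have hLyrec : ∀ t, Ly (t + 1) ≤ q * Ly t + ν := fun t => by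
    refine (hrec t).trans ?_
    have h1 : η / 2 * a t ≤ q * ((η + μ) / 2 * a t) := by
      have h2 : θ * ((η + μ) / 2 * a t) ≤ q * ((η + μ) / 2 * a t) := by
        refine mul_le_mul_of_nonneg_right ?_ (mul_nonneg (by linarith) (ha0 t))
        rw [hq]
        linarith
      have h3 : η / 2 * a t = θ * ((η + μ) / 2 * a t) := by
        linear_combination (a t / 2) * hηθ
      rw [h3]; exact h2
    have h2 : η / 16 * e t ≤ q * (η / 8 * e t) := by
      have h3 : (1 / 2 : ℝ) * (η / 8 * e t) ≤ q * (η / 8 * e t) := by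
        refine mul_le_mul_of_nonneg_right ?_ (mul_nonneg (by linarith) (he0 t))
        rw [hq]
        linarith
      linarith
    have h3 : (W - ρ / 2) * g t ≤ q * (W * g t) := by
      have h4 : W - ρ / 2 ≤ q * W := by
        have h5 := mul_le_mul_of_nonneg_left hWle hρ.le
        have h6 : q * W = W - ρ * ((1 - θ) * W) / 4 := by rw [hq]; ring
        linarith
      have := mul_le_mul_of_nonneg_right h4 (hg0 t)
      linarith
    simp only [hLy]
    linarith
  have hbound := le_pow_mul_add_of_le_mul_add hq0 hq1 hν0 hLyrec t
  have hgap : p.initGap ψ μ x₀ y₀ q₀ xs = μ / 2 * a 0 + g 0 := by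
    simp only [ha, hg, hrun.x_init.2, hrun.y_init.2, hrun.q_init.2, integral_const, probReal_univ,
      one_smul, Problem.initGap]
    congr 2
    exact Finset.sum_congr rfl fun i _ => hD i _ (hrun.y_init.1 i) _ (hrun.q_init.1 i)
  have he00 : e 0 = 0 := by simp [he]
  refine ⟨?_, (hint t).1, ?_⟩
  · rw [hgap]
    exact add_nonneg (mul_nonneg (by positivity) (ha0 0)) (hg0 0)
  -- Multiplying by 1-θ turns (η+μ)/2 into μ/2 and W into at most 2; the movement term vanishes
  -- initially since x_{-1} = x_0.
  · have h1 : (1 - θ) * Ly 0 ≤ 2 * p.initGap ψ μ x₀ y₀ q₀ xs := by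
      have h2 := mul_le_mul_of_nonneg_right hWle (hg0 0)
      have h3 : (1 - θ) * Ly 0 = (1 - θ) * (η + μ) / 2 * a 0 + (1 - θ) * W * g 0 := by
        simp only [hLy, he00]; ring
      have h4 := mul_nonneg (by positivity : 0 ≤ μ / 2) (ha0 0)
      rw [h3, hημ, hgap]
      linarith
    have h2 : μ / 2 * a t ≤ (1 - θ) * Ly t := by
      have h3 : (1 - θ) * Ly t = (1 - θ) * (η + μ) / 2 * a t +
          (1 - θ) * (η / 8 * e t + W * g t) := by
        simp only [hLy]; ring
      have h4 : 0 ≤ (1 - θ) * (η / 8 * e t + W * g t) := by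
        have : 0 ≤ W := by positivity
        exact mul_nonneg hh.le (add_nonneg (mul_nonneg (by positivity) (he0 t))
          (mul_nonneg this (hg0 t)))
      rw [h3, hημ]
      linarith
    have h3 := mul_le_mul_of_nonneg_left hbound hh.le
    have h4 := mul_le_mul_of_nonneg_left h1 (pow_nonneg hq0 t)
    have h5 : (1 - θ) * (ν / (1 - q)) = 4 * ν / ρ := by
      rw [hq]; field_simp; ring
    have h6 : (1 - θ) * (q ^ t * Ly 0 + ν / (1 - q)) =
        q ^ t * ((1 - θ) * Ly 0) + (1 - θ) * (ν / (1 - q)) := by ring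
    rw [h6, h5] at h3
    linarith

/-- If the noise level is below the target accuracy, ALEXR reaches this accuracy. -/
theorem Problem.Assumptions.reachesAccuracy (h : p.Assumptions b μ Cf Lf Cg σ₀ σ₁ δ) (hμ : 0 < μ)
    (hCf : 0 ≤ Cf) (hLf : 0 < Lf) (hB : 1 ≤ B) (hS1 : 1 ≤ S) (hS : S ≤ n) (L : V ≃L[ℝ] Primal k)
    {ψ : Fin n → DGF V} {μψ ρ₀ : ℝ} (hμψ : 0 < μψ) (hψ : ∀ i, (ψ i).Admissible (p.f i) μψ ρ₀)
    {τ ρ κ θ η k₁ k₂ ε N : ℝ} (hρ : 0 < ρ) (hρ1 : ρ ≤ 1) (hρ₀ : ρ ≤ ρ₀) (hκ : 0 < κ) (hκ₁ : κ ≤ μψ)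
    (hκ₂ : κ ≤ 1 / Lf) (hθ : 1 / 2 ≤ θ) (hθ1 : θ < 1) (hηdef : η = μ * θ / (1 - θ))
    (hτdef : τ = S / (n * (1 - θ))) (hτ1 : 1 ≤ τ)
    (hη1 : 2 * Cg ^ 2 / (ρ * κ) ≤ η / 16) (hη2 : Cf * k₁ ≤ η / 8)
    (hcurv : ∀ i, ∀ x ∈ p.X, ∀ x' ∈ p.X,
      ‖p.inner i x' - p.inner i x - p.innerD i x (x' - x)‖ ≤ k₁ * ‖x' - x‖ ^ 2 + k₂) (hε : 0 < ε)
    (hν : 10 * (‖(L.symm : Primal k →L[ℝ] V)‖ ^ 2 * (‖(L : V →L[ℝ] Primal k)‖ ^ 2 * σ₀ ^ 2 / B)) /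
          (2 * τ * κ)
        + 2 / η * (2 * (δ ^ 2 / S + Cf ^ 2 * σ₁ ^ 2 / B)) + Cf * k₂ ≤ ρ * ε / 8)
    (hN : N = 8 / (ρ * (1 - θ))) :
    Problem.ReachesAccuracy.{u, w, v} p ψ S B μ θ η τ ε N := by
  intro Ω _ Pr _ ξ x₀ y₀ q₀ X Y Q xs hxs hs hrun T hT
  have hh : 0 < 1 - θ := by linarith
  -- The noise level ρε/8 leaves ε/2, and the transient term gets the other ε/2.
  obtain ⟨h0, hi, hb⟩ := h.error_bound hμ hCf hLf hB hS1 hS L hμψ hψ hρ hρ1 hρ₀ hκ hκ₁ hκ₂ hθ hθ1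
    hηdef hτdef hτ1 hη1 hη2 hcurv (by positivity) hν hxs hs hrun T
  refine ⟨hi, hb.trans ?_⟩
  have hx : 0 < ρ * (1 - θ) / 4 := by positivity
  have hx1 : ρ * (1 - θ) / 4 ≤ 1 := by nlinarith
  have h1 := two_mul_mul_pow_le h0 hε hx hx1 (T := T) (by
    refine le_trans (le_of_eq ?_) hT
    rw [hN]
    congr 1
    field_simp
    norm_num)
  have h2 : 4 * (ρ * ε / 8) / ρ = ε / 2 := by field_simp; norm_num
  linarith

end Convergence

/-! ### Choice of constants and the two complexity bounds. -/

theorem exists_small_constant {E A ρ : ℝ} (hE : 0 ≤ E) (hA : 0 ≤ A) (hρ : 0 < ρ) :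
    ∃ c : ℝ, 0 < c ∧ c ≤ 1 / 2 ∧ E ≤ 1 / (2 * c) ∧ c * A ≤ ρ / 8 := by
  have hA' : 0 ≤ 8 * A / ρ := by positivity
  have hD : 0 < 2 + 2 * E + 8 * A / ρ := by positivity
  refine ⟨1 / (2 + 2 * E + 8 * A / ρ), by positivity, ?_, ?_, ?_⟩
  · exact one_div_le_one_div_of_le (by norm_num) (by linarith)
  · rw [mul_one_div, one_div_div]
    linarith
  · rw [one_div_mul_eq_div, div_le_iff₀ hD]
    have h1 : ρ / 8 * (8 * A / ρ) = A := by field_simp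
    have h2 : 0 ≤ ρ / 8 * (2 + 2 * E) := by positivity
    linarith

/-- Here ε ≤ 1/B is used: (1-θ)M = cε ≤ c/B, so (1-θ)a ≤ c whenever a/B ≤ M. Taking a = n/S gives θ
≥ 1/2 and τ ≥ 1; taking a = 1/μ bounds η from below. -/
theorem stepsize_bounds {n S B : ℕ} {c μ ε M θ : ℝ} (hc : 0 < c) (hc2 : c ≤ 1 / 2) (hμ : 0 < μ)
    (hε : 0 < ε) (hS1 : 1 ≤ S) (hS : S ≤ n) (hB : 1 ≤ B) (hεB : ε ≤ 1 / B)
    (hM1 : 1 / (μ * B) ≤ M) (hM2 : (n : ℝ) / (B * S) ≤ M) (hθ : θ = 1 - c * ε / M) :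
    1 / 2 ≤ θ ∧ θ < 1 ∧ (1 : ℝ) ≤ S / (n * (1 - θ)) ∧ 1 / (2 * c) ≤ μ * θ / (1 - θ) ∧
      1 / (μ * θ / (1 - θ)) ≤ 2 * (1 - θ) / μ := by
  have hSpos : (0 : ℝ) < S := by exact_mod_cast hS1
  have hBpos : (0 : ℝ) < B := by exact_mod_cast hB
  have hSn : (S : ℝ) ≤ n := by exact_mod_cast hS
  have hn : (0 : ℝ) < n := hSpos.trans_le hSn
  have hM : 0 < M := lt_of_lt_of_le (by positivity) hM1
  have hh : 1 - θ = c * ε / M := by rw [hθ]; ring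
  have hh0 : 0 < 1 - θ := by rw [hh]; positivity
  have hcε : c * ε ≤ c * (1 / B) := mul_le_mul_of_nonneg_left hεB hc.le
  have hscale : ∀ a, a / B ≤ M → (1 - θ) * a ≤ c := fun a ha => by
    have h1 := mul_le_mul_of_nonneg_left ha hh0.le
    have h2 : (1 - θ) * M = c * ε := by rw [hh]; field_simp
    have h3 : (1 - θ) * a / B ≤ c / B := by
      rw [mul_div_assoc]
      calc _ ≤ _ := h1
        _ ≤ c * (1 / B) := by rw [h2]; exact hcε
        _ = c / B := by ring
    exact (div_le_div_iff_of_pos_right hBpos).1 h3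
  have hnS : (1 - θ) * (n / S) ≤ c := hscale _ (le_trans (le_of_eq (by field_simp)) hM2)
  have hμ' : (1 - θ) * (1 / μ) ≤ c := hscale _ (le_trans (le_of_eq (by field_simp)) hM1)
  have hle : 1 - θ ≤ (1 - θ) * (n / S) :=
    le_mul_of_one_le_right hh0.le ((one_le_div hSpos).2 hSn)
  have hθ2 : 1 / 2 ≤ θ := by linarith
  refine ⟨hθ2, by linarith, ?_, ?_, ?_⟩
  · rw [le_div_iff₀ (by positivity), one_mul]
    have h1 : (1 - θ) * (n / S) * S = n * (1 - θ) := by field_simp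
    have h2 : (1 - θ) * (n / S) * S ≤ 1 * S := by gcongr; linarith
    linarith
  · rw [div_le_div_iff₀ (by positivity) hh0]
    rw [mul_one_div, div_le_iff₀ hμ] at hμ'
    have h1 := mul_le_mul_of_nonneg_left hθ2 (by positivity : 0 ≤ μ * (2 * c))
    linarith
  · have hθ0 : 0 < θ := by linarith
    rw [one_div_div, div_le_div_iff₀ (by positivity) hμ]
    have h1 := mul_le_mul_of_nonneg_left hθ2 (by positivity : 0 ≤ (1 - θ) * μ)
    linarith

section Main

variable {V : Type u} [NormedAddCommGroup V] [NormedSpace ℝ V] {d n m : ℕ}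
  {Z : Fin n → Type w} [∀ i, MeasurableSpace (Z i)] {p : Problem V d n Z}
  {b : Module.Basis (Fin m) ℝ V} {μ Cf Lf Cg σ₀ σ₁ δ : ℝ} {S B k : ℕ}

/-- The accuracy guarantee for a step size of order `ε / M`, given a curvature bound. -/
theorem Problem.Assumptions.reachesAccuracy_of_scale (h : p.Assumptions b μ Cf Lf Cg σ₀ σ₁ δ)
    (hμ : 0 < μ) (hCf : 0 ≤ Cf) (hLf : 0 < Lf) (hB : 1 ≤ B) (hS1 : 1 ≤ S) (hS : S ≤ n)
    (L : V ≃L[ℝ] Primal k)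
    {ψ : Fin n → DGF V} {μψ ρ₀ : ℝ} (hμψ : 0 < μψ) (hψ : ∀ i, (ψ i).Admissible (p.f i) μψ ρ₀)
    {ρ κ θ k₁ k₂ ε c A M : ℝ} (hρ : 0 < ρ) (hρ1 : ρ ≤ 1) (hρ₀ : ρ ≤ ρ₀) (hκ : 0 < κ)
    (hκ₁ : κ ≤ μψ) (hκ₂ : κ ≤ 1 / Lf) (hε : 0 < ε) (hεB : ε ≤ 1 / B) (hc : 0 < c) (hc2 : c ≤ 1 / 2)
    (hcE : 32 * Cg ^ 2 / (ρ * κ) ≤ 1 / (2 * c))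
    (hcA : c * (5 * (‖(L.symm : Primal k →L[ℝ] V)‖ ^ 2 *
      (‖(L : V →L[ℝ] Primal k)‖ ^ 2 * σ₀ ^ 2)) / κ + 8 * (δ ^ 2 + Cf ^ 2 * σ₁ ^ 2) + A) ≤ ρ / 8)
    (hM1 : 1 / (μ * S) ≤ M) (hM2 : 1 / (μ * B) ≤ M) (hM3 : (n : ℝ) / (B * S) ≤ M)
    (hθ : θ = 1 - c * ε / M) (hk₁ : Cf * k₁ ≤ μ * θ / (1 - θ) / 8) (hk₂ : Cf * k₂ ≤ A * (c * ε))
    (hcurv : ∀ i, ∀ x ∈ p.X, ∀ x' ∈ p.X,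
      ‖p.inner i x' - p.inner i x - p.innerD i x (x' - x)‖ ≤ k₁ * ‖x' - x‖ ^ 2 + k₂) :
    Problem.ReachesAccuracy.{u, w, v} p ψ S B μ θ (μ * θ / (1 - θ)) (S / (n * (1 - θ))) ε
      (8 / (ρ * c) * (M / ε)) := by
  have hSpos : (0 : ℝ) < S := by exact_mod_cast hS1
  have hBpos : (0 : ℝ) < B := by exact_mod_cast hB
  have hn : (0 : ℝ) < n := by exact_mod_cast hS1.trans hS
  have hM : 0 < M := lt_of_lt_of_le (by positivity) hM2
  obtain ⟨hθ2, hθ1, hτ1, hη, hη'⟩ := stepsize_bounds hc hc2 hμ hε hS1 hS hB hεB hM2 hM3 hθ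
  have hh : 1 - θ = c * ε / M := by rw [hθ]; ring
  have hh0 : 0 < 1 - θ := by linarith
  have hhM : (1 - θ) * M = c * ε := by rw [hh]; field_simp
  -- Each noise source is 1-θ times a quantity below M: n/(BS) for the values, 1/(μS) for the
  -- subset, 1/(μB) for the gradients.
  have hscale : ∀ a, a ≤ M → (1 - θ) * a ≤ c * ε := fun a ha =>
    (mul_le_mul_of_nonneg_left ha hh0.le).trans_eq hhM
  refine h.reachesAccuracy hμ hCf hLf hB hS1 hS L hμψ hψ hρ hρ1 hρ₀ hκ hκ₁ hκ₂ hθ2 hθ1 rfl rfl hτ1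
    (k₁ := k₁) (k₂ := k₂) ?_ hk₁ hcurv hε ?_ ?_
  · have h1 : 32 * Cg ^ 2 / (ρ * κ) = 16 * (2 * Cg ^ 2 / (ρ * κ)) := by ring
    linarith
  · set G : ℝ := ‖(L.symm : Primal k →L[ℝ] V)‖ ^ 2 * (‖(L : V →L[ℝ] Primal k)‖ ^ 2 * σ₀ ^ 2) with hG
    have hG0 : 0 ≤ G := by positivity
    have h1 : 10 * (‖(L.symm : Primal k →L[ℝ] V)‖ ^ 2 *
        (‖(L : V →L[ℝ] Primal k)‖ ^ 2 * σ₀ ^ 2 / B)) / (2 * (S / (n * (1 - θ))) * κ) =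
        5 * G / κ * ((1 - θ) * (n / (B * S))) := by
      rw [hG]; field_simp; ring
    have h2 : 5 * G / κ * ((1 - θ) * (n / (B * S))) ≤ 5 * G / κ * (c * ε) :=
      mul_le_mul_of_nonneg_left (hscale _ hM3) (by positivity)
    have h3 : 2 / (μ * θ / (1 - θ)) * (2 * (δ ^ 2 / S + Cf ^ 2 * σ₁ ^ 2 / B)) ≤
        8 * (δ ^ 2 + Cf ^ 2 * σ₁ ^ 2) * (c * ε) := by
      have e1 : 2 / (μ * θ / (1 - θ)) * (2 * (δ ^ 2 / S + Cf ^ 2 * σ₁ ^ 2 / B)) =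
          1 / (μ * θ / (1 - θ)) * (4 * (δ ^ 2 / S + Cf ^ 2 * σ₁ ^ 2 / B)) := by ring
      have e2 : 2 * (1 - θ) / μ * (4 * (δ ^ 2 / S + Cf ^ 2 * σ₁ ^ 2 / B)) =
          8 * (δ ^ 2 * ((1 - θ) * (1 / (μ * S))) +
            Cf ^ 2 * σ₁ ^ 2 * ((1 - θ) * (1 / (μ * B)))) := by field_simp; ring
      have e3 := mul_le_mul_of_nonneg_left (hscale _ hM1) (sq_nonneg δ)
      have e4 := mul_le_mul_of_nonneg_left (hscale _ hM2) (by positivity : 0 ≤ Cf ^ 2 * σ₁ ^ 2)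
      have e5 := mul_le_mul_of_nonneg_right hη'
        (by positivity : 0 ≤ 4 * (δ ^ 2 / S + Cf ^ 2 * σ₁ ^ 2 / B))
      rw [e1]
      linarith
    have h4 := mul_le_mul_of_nonneg_right hcA hε.le
    rw [h1]
    linarith
  · rw [hh]
    field_simp

/-- Lipschitz continuity bounds the linearization error of the inner functions by a quadratic with
any leading coefficient, at the cost of a constant. -/
theorem Problem.Assumptions.linearization_error_le (h : p.Assumptions b μ Cf Lf Cg σ₀ σ₁ δ) {k₁ : ℝ}
    (hk : 0 < k₁) (i : Fin n) {x x' : Primal d} (hx : x ∈ p.X) (hx' : x' ∈ p.X) :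
    ‖p.inner i x' - p.inner i x - p.innerD i x (x' - x)‖ ≤ k₁ * ‖x' - x‖ ^ 2 + Cg ^ 2 / k₁ := by
  have h1 := h.g_lipschitz i x' hx' x hx
  have h2 := h.Dg_bound i x hx x' hx'
  have h3 := mul_le_young hk (x := ‖x' - x‖) (y := 2 * Cg)
  have h4 : (2 * Cg) ^ 2 / (4 * k₁) = Cg ^ 2 / k₁ := by field_simp; ring
  calc _ ≤ ‖p.inner i x' - p.inner i x‖ + ‖p.innerD i x (x' - x)‖ := norm_sub_le _ _
    _ ≤ ‖x' - x‖ * (2 * Cg) := by linarith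
    _ ≤ _ := by rw [← h4]; exact h3

end Main

end CFCCO

theorem theorem1 {V : Type u} [NormedAddCommGroup V] [NormedSpace ℝ V] {m : ℕ}
    (b : Module.Basis (Fin m) ℝ V)
    (Cf Lf Cg Lg μψ ρ σ₀ σ₁ δ : ℝ) (hCf : 0 < Cf) (hLf : 0 < Lf) (hCg : 0 < Cg) (hLg : 0 < Lg)
    (hμψ : 0 < μψ) (hρ : 0 < ρ) :
    -- (i) smooth inner functions
    (∃ c K : ℝ, 0 < c ∧ c < 1 ∧ 0 < K ∧
      ∀ (d n : ℕ) (Z : Fin n → Type w) [∀ i, MeasurableSpace (Z i)] (p : Problem V d n Z)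
        (ψ : Fin n → DGF V) (S B : ℕ) (μ ε M θ : ℝ),
        0 < μ → 1 ≤ S → S ≤ n → 1 ≤ B → 0 < ε → ε ≤ 1 / B →
        p.Assumptions b μ Cf Lf Cg σ₀ σ₁ δ → (∀ i, (ψ i).Admissible (p.f i) μψ ρ) →
        p.InnerSmooth Lg →
        M = max (max (1 / (μ * S)) (1 / (μ * B))) (n / (B * S)) →
        θ = 1 - c * ε / M →
        Problem.ReachesAccuracy.{u, w, v} p ψ S B μ θ (μ * θ / (1 - θ)) (S / (n * (1 - θ))) ε
          (K * (M / ε))) ∧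
    -- (ii) possibly non-smooth inner functions
    (∃ c K : ℝ, 0 < c ∧ c < 1 ∧ 0 < K ∧
      ∀ (d n : ℕ) (Z : Fin n → Type w) [∀ i, MeasurableSpace (Z i)] (p : Problem V d n Z)
        (ψ : Fin n → DGF V) (S B : ℕ) (μ ε M θ : ℝ),
        0 < μ → 1 ≤ S → S ≤ n → 1 ≤ B → 0 < ε → ε ≤ 1 / B →
        p.Assumptions b μ Cf Lf Cg σ₀ σ₁ δ → (∀ i, (ψ i).Admissible (p.f i) μψ ρ) →
        M = max (1 / μ) (n / (B * S)) →
        θ = 1 - c * ε / M →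
        Problem.ReachesAccuracy.{u, w, v} p ψ S B μ θ (μ * θ / (1 - θ)) (S / (n * (1 - θ))) ε
          (K * (M / ε))) := by
  have hV : FiniteDimensional ℝ V := b.finiteDimensional_of_finite
  -- Coordinates in the given basis, with the Euclidean norm.
  let L : V ≃L[ℝ] Primal m :=
    (b.equivFun.trans (WithLp.linearEquiv 2 ℝ (Fin m → ℝ)).symm).toContinuousLinearEquiv
  -- The cap at 1 covers ψ_i = f_i^*, for which the two Bregman divergences coincide.
  obtain ⟨ρ₁, hρ₁, hρ₁1, hρ₁ρ⟩ : ∃ ρ₁ : ℝ, 0 < ρ₁ ∧ ρ₁ ≤ 1 ∧ ρ₁ ≤ ρ :=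
    ⟨min 1 ρ, lt_min one_pos hρ, min_le_left _ _, min_le_right _ _⟩
  obtain ⟨κ, hκ, hκ₁, hκ₂⟩ : ∃ κ : ℝ, 0 < κ ∧ κ ≤ μψ ∧ κ ≤ 1 / Lf :=
    ⟨min μψ (1 / Lf), lt_min hμψ (by positivity), min_le_left _ _, min_le_right _ _⟩
  set E : ℝ := 32 * Cg ^ 2 / (ρ₁ * κ)
  set A : ℝ := 5 * (‖(L.symm : Primal m →L[ℝ] V)‖ ^ 2 *
      (‖(L : V →L[ℝ] Primal m)‖ ^ 2 * σ₀ ^ 2)) / κ + 8 * (δ ^ 2 + Cf ^ 2 * σ₁ ^ 2)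
  have hE : 0 ≤ E := by positivity
  have hA : 0 ≤ A := by positivity
  constructor
  -- The extra 4 Cf Lg forces η ≥ 4 Cf Lg, so the curvature coefficient k₁ = Lg/2 satisfies Cf k₁ ≤
  -- η/8, with k₂ = 0.
  · obtain ⟨c, hc, hc2, hcE, hcA⟩ := exists_small_constant (E := E + 4 * (Cf * Lg)) (A := A + 0)
      (by positivity) (by positivity) hρ₁
    refine ⟨c, 8 / (ρ₁ * c), hc, by linarith, by positivity, ?_⟩
    intro d n Z _ p ψ S B μ ε M θ hμ hS1 hS hB hε hεB h hψ hsm hM hθ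
    have hM1 : 1 / (μ * S) ≤ M := hM ▸ (le_max_left _ _).trans (le_max_left _ _)
    have hM2 : 1 / (μ * B) ≤ M := hM ▸ (le_max_right _ _).trans (le_max_left _ _)
    have hM3 : (n : ℝ) / (B * S) ≤ M := hM ▸ le_max_right _ _
    obtain ⟨-, -, -, hη, -⟩ := stepsize_bounds hc hc2 hμ hε hS1 hS hB hεB hM2 hM3 hθ
    have hCL : 0 ≤ 4 * (Cf * Lg) := by positivity
    refine h.reachesAccuracy_of_scale hμ hCf.le hLf hB hS1 hS L hμψ hψ (k₁ := Lg / 2) (k₂ := 0)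
      hρ₁ hρ₁1 hρ₁ρ hκ hκ₁ hκ₂ hε hεB hc hc2 (by linarith) hcA hM1 hM2 hM3 hθ (by linarith)
      (by simp) fun i x hx x' hx' => ?_
    rw [add_zero]
    exact (hsm i x hx).2 x' hx'
  -- The extra 16 Cf² Cg² accounts for the constant part of the linearization error.
  · obtain ⟨c, hc, hc2, hcE, hcA⟩ := exists_small_constant (E := E)
      (A := A + 16 * Cf ^ 2 * Cg ^ 2) hE (by positivity) hρ₁
    refine ⟨c, 8 / (ρ₁ * c), hc, by linarith, by positivity, ?_⟩
    intro d n Z _ p ψ S B μ ε M θ hμ hS1 hS hB hε hεB h hψ hM hθ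
    have hM0 : 1 / μ ≤ M := hM ▸ le_max_left _ _
    have hS1' : (1 : ℝ) ≤ S := by exact_mod_cast hS1
    have hB1' : (1 : ℝ) ≤ B := by exact_mod_cast hB
    have hM1 : 1 / (μ * S) ≤ M :=
      (one_div_le_one_div_of_le hμ (le_mul_of_one_le_right hμ.le hS1')).trans hM0
    have hM2 : 1 / (μ * B) ≤ M :=
      (one_div_le_one_div_of_le hμ (le_mul_of_one_le_right hμ.le hB1')).trans hM0
    have hM3 : (n : ℝ) / (B * S) ≤ M := hM ▸ le_max_right _ _
    obtain ⟨-, hθ1, -, hη, hη'⟩ := stepsize_bounds hc hc2 hμ hε hS1 hS hB hεB hM2 hM3 hθ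
    have hη0 : 0 < μ * θ / (1 - θ) := lt_of_lt_of_le (by positivity) hη
    have hMpos : 0 < M := lt_of_lt_of_le (by positivity) hM0
    -- The one place where 1/μ ≤ M is needed in full: with k₁ = η/(8 Cf), the constant Cf k₂ equals
    -- 8 Cf² Cg²/η and must be of order cε.
    have hinv : 1 / (μ * θ / (1 - θ)) ≤ 2 * (c * ε) := by
      refine hη'.trans ?_
      have h1 := mul_le_mul_of_nonneg_left hM0 (by linarith : 0 ≤ 1 - θ)
      have h2 : (1 - θ) * M = c * ε := by rw [hθ]; field_simp; ring
      have h3 : 2 * (1 - θ) / μ = 2 * ((1 - θ) * (1 / μ)) := by ring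
      rw [h3]
      linarith
    set η := μ * θ / (1 - θ)
    have hk : 0 < η / (8 * Cf) := by positivity
    refine h.reachesAccuracy_of_scale hμ hCf.le hLf hB hS1 hS L hμψ hψ (k₁ := η / (8 * Cf))
      (k₂ := Cg ^ 2 / (η / (8 * Cf))) hρ₁ hρ₁1 hρ₁ρ hκ hκ₁ hκ₂ hε hεB hc hc2 hcE hcA hM1 hM2 hM3 hθ
      (le_of_eq ?_) ?_ fun i x hx x' hx' => h.linearization_error_le hk i hx hx'
    · show Cf * (η / (8 * Cf)) = η / 8
      field_simp
    have h1 : Cf * (Cg ^ 2 / (η / (8 * Cf))) = 8 * Cf ^ 2 * Cg ^ 2 * (1 / η) := by field_simp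
    have h2 := mul_le_mul_of_nonneg_left hinv (by positivity : 0 ≤ 8 * Cf ^ 2 * Cg ^ 2)
    rw [h1]
    linarith
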